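/- **Theorem (Bertrand's Theorem for Surfaces of Constant Curvature).** Let $S\subset\mathbb R^3$ be a surface of revolution ${\bf x}(u,\phi)=(f(u)\cos\phi,f(u)\sin\phi,g(u))$, $u\in I$, whose profile curve $(f,g)$ is smooth, simple (without self-intersections) and of unit speed, $(f')^2+(g')^2=1$, with $f>0$ in the interior $(c,d)$ of the interval $I$, and of one of the following types: spherical ($I=[c,d]$, $f(c)=f(d)=0$); hyperboloidal ($I=(c,d)$, $-\infty\le c<d\le\infty$); toroidal ($I=[c,d]$, $(f,g)$ a smooth closed loop with $f>0$ throughout; here $u$ is taken modulo $d-c$); paraboloidal ($I=[c,d)$, $-\infty<c<d\le\infty$, $f(c)=0$). Let $V=V(u)$ be a central potential on $S$ that is real analytic except, at most, at points where $f=0$, and let $m>0$ be the mass of the particle. Write $$H=\frac{p_u^2}{2m}+\frac{p_\phi^2}{2mf(u)^2}+V(u),\qquad W(u)=\frac{l^2}{2mf(u)^2}+V(u)$$ for the Hamiltonian of the motion in the region $f>0$ and for the effective potential with angular momentum $l$. An orbit is non-singular if it exists, in the region $f>0$, for all times $t\ge 0$; it is bounded if it stays in a bounded subset of $\mathbb R^3$,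 circular if $u$ is constant along it, and closed if the motion on $S$ is periodic. Assume that $S$ has constant Gaussian curvature, that there is at least one bounded, non-singular, non-circular orbit, and that for some real $l$ the effective potential $W$ has a local minimum at a point with $f>0$. Then all bounded non-singular orbits are closed if and only if there is a rational number $\beta>0$ such that one of the following holds (on the region $f>0$): 1. $-ff''+(f')^2=\beta^2$ and $V=a\,\Theta(u)+C$ for some real constants $a,C$ (generalized gravitational potential), where $\Theta$ is the antiderivative of $1/f^2$ with $f'/f=-\beta^2\,\Theta$; or 2. $-ff''+(f')^2=\beta^2/4$ and $V=\dfrac{k}{\Theta(u)^2}+C$ for some real constants $k,C$ (generalized harmonic oscillator), where $\Theta$ is the antiderivative of $1/f^2$ with $f'/f=-\frac{\beta^2}{4}\,\Theta$, and $\Theta$ does not vanish. -/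

import Mathlib

open scoped ContDiff

noncomputable section

/-- The four topological types of surfaces of revolution, with the parameter interval of the
profile curve: `[c,d]` (spherical), `(c,d)` with possibly infinite ends (hyperboloidal), `[c,d]`
with the ends glued (toroidal), `[c,d)` with `d` possibly infinite (paraboloidal). -/
inductive ProfileKind where
  | spherical (c d : ℝ)
  | hyperboloidal (c d : EReal)
  | toroidal (c d : ℝ)
  | paraboloidal (c : ℝ) (d : EReal)

namespace ProfileKind

/-- The set of parameters on which the profile curve is defined. A closed profile curve is
described by its periodic extension to the whole line. -/
def carrier : ProfileKind → Set ℝ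
  | spherical c d => Set.Icc c d
  | hyperboloidal c d => {u : ℝ | c < (u : EReal) ∧ (u : EReal) < d}
  | toroidal _ _ => Set.univ
  | paraboloidal c d => {u : ℝ | c ≤ u ∧ (u : EReal) < d}

/-- The open set of parameters of the points of the surface that are not on the axis: the open
interval `(c,d)`, or the whole line for a closed profile curve. -/
def dom : ProfileKind → Set ℝ
  | spherical c d => Set.Ioo c d
  | hyperboloidal c d => {u : ℝ | c < (u : EReal) ∧ (u : EReal) < d}
  | toroidal _ _ => Set.univ
  | paraboloidal c d => {u : ℝ | c < u ∧ (u : EReal) < d}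

/-- The conditions that a profile curve `u ↦ (f u, 0, g u)` of the given type satisfies at the ends
of its interval, together with the absence of self-intersections. -/
def EndConditions (f g : ℝ → ℝ) : ProfileKind → Prop
  | spherical c d => c < d ∧ f c = 0 ∧ f d = 0 ∧
      Set.InjOn (fun u => (f u, g u)) (Set.Icc c d)
  | hyperboloidal c d => c < d ∧
      Set.InjOn (fun u => (f u, g u)) {u : ℝ | c < (u : EReal) ∧ (u : EReal) < d}
  | toroidal c d => c < d ∧ Function.Periodic f (d - c) ∧ Function.Periodic g (d - c) ∧
      Set.InjOn (fun u => (f u, g u)) (Set.Ico c d)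
  | paraboloidal c d => (c : EReal) < d ∧ f c = 0 ∧
      Set.InjOn (fun u => (f u, g u)) {u : ℝ | c ≤ u ∧ (u : EReal) < d}

end ProfileKind

/-- A surface of revolution in `ℝ³`, obtained by rotating about the `z`-axis a simple smooth
unit-speed profile curve `u ↦ (f u, 0, g u)` of one of the four types. -/
structure SurfaceOfRevolution where
  kind : ProfileKind
  f : ℝ → ℝ
  g : ℝ → ℝ
  smooth_f : ContDiffOn ℝ ∞ f kind.carrier
  smooth_g : ContDiffOn ℝ ∞ g kind.carrier
  f_pos : ∀ u ∈ kind.dom, 0 < f u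
  unit_speed : ∀ u ∈ kind.dom, deriv f u ^ 2 + deriv g u ^ 2 = 1
  ends : kind.EndConditions f g

namespace SurfaceOfRevolution

variable (S : SurfaceOfRevolution)

/-- The open set of parameters `u` where `f u > 0`, on which the motion takes place. -/
abbrev dom : Set ℝ := S.kind.dom

/-- The parametrization `x(u,φ) = (f(u) cos φ, f(u) sin φ, g(u))`. -/
def param (u φ : ℝ) : Fin 3 → ℝ := ![S.f u * Real.cos φ, S.f u * Real.sin φ, S.g u]

/-- The partial derivative `x_u`. -/
def paramU (u φ : ℝ) : Fin 3 → ℝ := deriv (fun s => S.param s φ) u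

/-- The partial derivative `x_φ`. -/
def paramPhi (u φ : ℝ) : Fin 3 → ℝ := deriv (fun s => S.param u s) φ

/-- The partial derivative `x_uu`. -/
def paramUU (u φ : ℝ) : Fin 3 → ℝ := deriv (fun s => S.paramU s φ) u

/-- The partial derivative `x_uφ`. -/
def paramUPhi (u φ : ℝ) : Fin 3 → ℝ := deriv (fun s => S.paramU u s) φ

/-- The partial derivative `x_φφ`. -/
def paramPhiPhi (u φ : ℝ) : Fin 3 → ℝ := deriv (fun s => S.paramPhi u s) φ

/-- The determinant `EG - F²` of the first fundamental form. -/
def firstFormDet (u φ : ℝ) : ℝ :=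
  (S.paramU u φ ⬝ᵥ S.paramU u φ) * (S.paramPhi u φ ⬝ᵥ S.paramPhi u φ)
    - (S.paramU u φ ⬝ᵥ S.paramPhi u φ) ^ 2

/-- The coefficient of the second fundamental form that belongs to the second partial derivative
`w` of the parametrization: `((x_u ∧ x_φ) · w) / √(EG - F²)`. -/
def secondFormCoeff (u φ : ℝ) (w : Fin 3 → ℝ) : ℝ :=
  (crossProduct (S.paramU u φ) (S.paramPhi u φ) ⬝ᵥ w) / Real.sqrt (S.firstFormDet u φ)

/-- The Gaussian curvature at the point `x(u,φ)`: the quotient of the determinants of the second and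
the first fundamental form. -/
def gaussianCurvature (u φ : ℝ) : ℝ :=
  (S.secondFormCoeff u φ (S.paramUU u φ) * S.secondFormCoeff u φ (S.paramPhiPhi u φ)
    - S.secondFormCoeff u φ (S.paramUPhi u φ) ^ 2) / S.firstFormDet u φ

/-- The Gaussian curvature is constant (away from the points on the axis). -/
def HasConstantCurvature : Prop :=
  ∃ K : ℝ, ∀ u ∈ S.dom, ∀ φ : ℝ, S.gaussianCurvature u φ = K

/-- `V` is an analytic central potential on `S`: a function of `u` that is well defined on the
surface and real analytic except, at most, at the points on the axis. -/
def IsCentralPotential (V : ℝ → ℝ) : Prop :=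
  AnalyticOnNhd ℝ V S.dom ∧
    ∀ u ∈ S.dom, ∀ v ∈ S.dom, S.f u = S.f v → S.g u = S.g v → V u = V v

/-- The effective potential `W(u) = l² / (2 m f(u)²) + V(u)`. -/
def effectivePotential (V : ℝ → ℝ) (m l u : ℝ) : ℝ := l ^ 2 / (2 * m * S.f u ^ 2) + V u

/-- A non-singular orbit of a particle of mass `m` in the central field `V` on `S`: a solution of
Hamilton's equations for `H = p_u² / (2m) + p_φ² / (2 m f(u)²) + V(u)` that exists for all times
`t ≥ 0`. (The values of the four functions at `t < 0` are irrelevant.) -/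
structure NonsingularOrbit (V : ℝ → ℝ) (m : ℝ) where
  u : ℝ → ℝ
  φ : ℝ → ℝ
  pu : ℝ → ℝ
  pφ : ℝ → ℝ
  mem_dom : ∀ t, 0 ≤ t → u t ∈ S.dom
  eq_u : ∀ t, 0 ≤ t → HasDerivWithinAt u (pu t / m) (Set.Ici 0) t
  eq_φ : ∀ t, 0 ≤ t → HasDerivWithinAt φ (pφ t / (m * S.f (u t) ^ 2)) (Set.Ici 0) t
  eq_pu : ∀ t, 0 ≤ t → HasDerivWithinAt pu
    (pφ t ^ 2 * deriv S.f (u t) / (m * S.f (u t) ^ 3) - deriv V (u t)) (Set.Ici 0) t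
  eq_pφ : ∀ t, 0 ≤ t → HasDerivWithinAt pφ 0 (Set.Ici 0) t

namespace NonsingularOrbit

variable {S} {V : ℝ → ℝ} {m : ℝ} (o : S.NonsingularOrbit V m)

/-- The position in space at time `t`. -/
def position (t : ℝ) : Fin 3 → ℝ := S.param (o.u t) (o.φ t)

/-- The orbit stays in a bounded part of space. -/
def Bounded : Prop := Bornology.IsBounded (o.position '' Set.Ici 0)

/-- The coordinate `u` is constant along the orbit. -/
def Circular : Prop := ∀ t, 0 ≤ t → o.u t = o.u 0

/-- The orbit closes up: the motion on the surface is periodic. -/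
def Closed : Prop := ∃ T : ℝ, 0 < T ∧ ∀ t, 0 ≤ t → o.position (t + T) = o.position t

end NonsingularOrbit

/-- Every bounded non-singular orbit is closed. -/
def AllBoundedOrbitsClosed (V : ℝ → ℝ) (m : ℝ) : Prop :=
  ∀ o : S.NonsingularOrbit V m, o.Bounded → o.Closed

/-- The differential equation `-f f'' + (f')² = q`. -/
def SatisfiesProfileEquation (q : ℝ) : Prop :=
  ∀ u ∈ S.dom, -(S.f u * deriv (deriv S.f) u) + deriv S.f u ^ 2 = q

/-- `Θ` is the antiderivative of `1 / f²` normalized by `f' / f = -q Θ`. -/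
def IsNormalizedPrimitive (q : ℝ) (Θ : ℝ → ℝ) : Prop :=
  ∀ u ∈ S.dom, HasDerivAt Θ (1 / S.f u ^ 2) u ∧ deriv S.f u / S.f u = -q * Θ u

/-- `V` is, up to an additive constant, the generalized gravitational potential `a Θ`. -/
def IsGravitational (q : ℝ) (V : ℝ → ℝ) : Prop :=
  ∃ Θ : ℝ → ℝ, S.IsNormalizedPrimitive q Θ ∧
    ∃ a C : ℝ, ∀ u ∈ S.dom, V u = a * Θ u + C

/-- `V` is, up to an additive constant, the generalized harmonic oscillator potential `k / Θ²`. -/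
def IsHarmonic (q : ℝ) (V : ℝ → ℝ) : Prop :=
  ∃ Θ : ℝ → ℝ, S.IsNormalizedPrimitive q Θ ∧ (∀ u ∈ S.dom, Θ u ≠ 0) ∧
    ∃ k C : ℝ, ∀ u ∈ S.dom, V u = k / Θ u ^ 2 + C

end SurfaceOfRevolution

end

/-! ### Local geometry: the parameter domain and the Gaussian curvature. -/

namespace SurfaceOfRevolution

open Set Filter Topology

variable {S : SurfaceOfRevolution}

/-! Constant curvature `K` means `f'' = -K f`, so `q = (f')² - f f'' = (f')² + K f²` is constant. In
the coordinate `θ` with `dθ = du / f²`, the function `slope = -f'/f` then has constant derivative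
`q`, and `1 / f²` is a quadratic polynomial in it. An orbit of angular momentum `l` satisfies `dφ =
(l/m) dθ/du dt`, so its shape is governed by equations in `θ` alone.

Sufficiency. For `l ≠ 0` the quantity `Θ` (gravitational case) or `Θ²` (harmonic case) satisfies, up
to a shift, the oscillator equation of frequency `β` in the variable `φ` (`closed_of_gravitational`,
`closed_of_harmonic`). Since `β` is rational, `u` is periodic in `φ` with a period in `2πℤ`, and `φ'
= G(φ)` with `G` of the same period, so the motion closes (`closed_of_eq_cos_add_sin`). A bounded
orbit with `l = 0` is a state of rest, since otherwise it would escape.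

Necessity. The given orbit is closed and oscillates in a well, so some nonconstant `W` with `l > 0`
has a local minimum (`exists_isLocalMin`). In a coordinate `y` in which a nondegenerate well becomes
`l² y² / (2m)`, the apsidal angle of amplitude `A` is the integral of `H(A sin s)` over a period,
where `H = dθ/dy`. Closedness makes it a rational multiple of `2π`; by continuity it does not depend
on `A`. Hence `H(0)` is rational, and the even part of `H` is constant near `0`. The Taylor
coefficients at `y = 0` turn this into two conditions on the `θ`-derivatives of `V`
(`exists_rat_sq_eq`, `isochronous_condition`).

If `slope ≠ 0` at the minimum, there is an interval of nondegenerate circular orbits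
(`exists_nondegenerate`). On it the frequency is a constant rational `ρ`, and the second condition
reduces to `(q - ρ²)(4q - ρ²) = 0` (`eq_or_eq_of_isochronous`). Each factor leaves a linear equation
for `V`, solved in `gravitational_or_harmonic`.

If `slope = 0` there, the point is critical for every `l`. When `q = 0` the surface is a cylinder,
and an incommensurable angular velocity gives an orbit that is not closed
(`circular_of_closed_of_deriv_f_eq_zero`). When `q ≠ 0`, isochrony for three different `l` and the
strict convexity of the square force `V` to be constant (`eventually_eq_of_isochronous`). -/

lemma isOpen_dom (S : SurfaceOfRevolution) : IsOpen S.dom := by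
  unfold dom ProfileKind.dom
  split
  · exact isOpen_Ioo
  · exact (isOpen_Ioi.inter isOpen_Iio).preimage continuous_coe_real_ereal
  · exact isOpen_univ
  · exact isOpen_Ioi.inter (isOpen_Iio.preimage continuous_coe_real_ereal)

lemma ordConnected_dom (S : SurfaceOfRevolution) : OrdConnected S.dom := by
  unfold dom ProfileKind.dom
  split
  · exact ordConnected_Ioo
  · exact ⟨fun a ha b hb x hx => ⟨ha.1.trans_le (EReal.coe_le_coe_iff.2 hx.1),
      (EReal.coe_le_coe_iff.2 hx.2).trans_lt hb.2⟩⟩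
  · exact ordConnected_univ
  · exact ⟨fun a ha b hb x hx => ⟨lt_of_lt_of_le ha.1 hx.1,
      (EReal.coe_le_coe_iff.2 hx.2).trans_lt hb.2⟩⟩

lemma isPreconnected_dom (S : SurfaceOfRevolution) : IsPreconnected S.dom :=
  isPreconnected_iff_ordConnected.2 S.ordConnected_dom

lemma convex_dom (S : SurfaceOfRevolution) : Convex ℝ S.dom :=
  S.ordConnected_dom.convex

lemma dom_subset_carrier (S : SurfaceOfRevolution) : S.dom ⊆ S.kind.carrier := by
  unfold dom ProfileKind.dom ProfileKind.carrier
  split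
  · exact Ioo_subset_Icc_self
  · exact subset_rfl
  · exact subset_rfl
  · exact fun u hu => ⟨hu.1.le, hu.2⟩

lemma dom_mem_nhds {u : ℝ} (hu : u ∈ S.dom) : S.dom ∈ 𝓝 u := S.isOpen_dom.mem_nhds hu

lemma contDiffAt_f {u : ℝ} (hu : u ∈ S.dom) : ContDiffAt ℝ ∞ S.f u :=
  S.smooth_f.contDiffAt (mem_of_superset (dom_mem_nhds hu) S.dom_subset_carrier)

lemma contDiffAt_g {u : ℝ} (hu : u ∈ S.dom) : ContDiffAt ℝ ∞ S.g u :=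
  S.smooth_g.contDiffAt (mem_of_superset (dom_mem_nhds hu) S.dom_subset_carrier)

lemma hasDerivAt_f {u : ℝ} (hu : u ∈ S.dom) : HasDerivAt S.f (deriv S.f u) u :=
  ((contDiffAt_f hu).differentiableAt (by simp)).hasDerivAt

lemma hasDerivAt_g {u : ℝ} (hu : u ∈ S.dom) : HasDerivAt S.g (deriv S.g u) u :=
  ((contDiffAt_g hu).differentiableAt (by simp)).hasDerivAt

lemma hasDerivAt_deriv_f {u : ℝ} (hu : u ∈ S.dom) :
    HasDerivAt (deriv S.f) (deriv (deriv S.f) u) u :=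
  (((S.smooth_f.mono S.dom_subset_carrier).deriv_of_isOpen (m := 1) S.isOpen_dom
    (WithTop.coe_le_coe.2 le_top)).differentiableOn (by simp) |>.differentiableAt
    (dom_mem_nhds hu)).hasDerivAt

lemma hasDerivAt_deriv_g {u : ℝ} (hu : u ∈ S.dom) :
    HasDerivAt (deriv S.g) (deriv (deriv S.g) u) u :=
  (((S.smooth_g.mono S.dom_subset_carrier).deriv_of_isOpen (m := 1) S.isOpen_dom
    (WithTop.coe_le_coe.2 le_top)).differentiableOn (by simp) |>.differentiableAt
    (dom_mem_nhds hu)).hasDerivAt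

lemma paramU_eq {u : ℝ} (hu : u ∈ S.dom) (φ : ℝ) :
    S.paramU u φ = ![deriv S.f u * Real.cos φ, deriv S.f u * Real.sin φ, deriv S.g u] := by
  refine HasDerivAt.deriv (hasDerivAt_pi.2 fun i => ?_)
  fin_cases i
  · exact (hasDerivAt_f hu).mul_const _
  · exact (hasDerivAt_f hu).mul_const _
  · exact hasDerivAt_g hu

lemma paramPhi_eq (u φ : ℝ) :
    S.paramPhi u φ = ![-(S.f u * Real.sin φ), S.f u * Real.cos φ, 0] := by
  refine HasDerivAt.deriv (hasDerivAt_pi.2 fun i => ?_)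
  fin_cases i
  · exact ((Real.hasDerivAt_cos φ).const_mul (S.f u)).congr_deriv (mul_neg _ _)
  · exact (Real.hasDerivAt_sin φ).const_mul (S.f u)
  · exact hasDerivAt_const φ (S.g u)

lemma paramUU_eq {u : ℝ} (hu : u ∈ S.dom) (φ : ℝ) :
    S.paramUU u φ = ![deriv (deriv S.f) u * Real.cos φ, deriv (deriv S.f) u * Real.sin φ,
      deriv (deriv S.g) u] := by
  have h : (fun s => S.paramU s φ) =ᶠ[𝓝 u]
      fun s => ![deriv S.f s * Real.cos φ, deriv S.f s * Real.sin φ, deriv S.g s] :=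
    eventually_of_mem (dom_mem_nhds hu) fun s hs => paramU_eq hs φ
  refine h.deriv_eq.trans (HasDerivAt.deriv (hasDerivAt_pi.2 fun i => ?_))
  fin_cases i
  · exact (hasDerivAt_deriv_f hu).mul_const _
  · exact (hasDerivAt_deriv_f hu).mul_const _
  · exact hasDerivAt_deriv_g hu

lemma paramUPhi_eq {u : ℝ} (hu : u ∈ S.dom) (φ : ℝ) :
    S.paramUPhi u φ = ![-(deriv S.f u * Real.sin φ), deriv S.f u * Real.cos φ, 0] := by
  have h : (fun s => S.paramU u s) =
      fun s => ![deriv S.f u * Real.cos s, deriv S.f u * Real.sin s, deriv S.g u] :=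
    funext fun s => paramU_eq hu s
  rw [paramUPhi, h]
  refine HasDerivAt.deriv (hasDerivAt_pi.2 fun i => ?_)
  fin_cases i
  · simpa using (Real.hasDerivAt_cos φ).const_mul (deriv S.f u)
  · simpa using (Real.hasDerivAt_sin φ).const_mul (deriv S.f u)
  · exact hasDerivAt_const φ (deriv S.g u)

lemma paramPhiPhi_eq (u φ : ℝ) :
    S.paramPhiPhi u φ = ![-(S.f u * Real.cos φ), -(S.f u * Real.sin φ), 0] := by
  have h : (fun s => S.paramPhi u s) = fun s => ![-(S.f u * Real.sin s), S.f u * Real.cos s, 0] :=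
    funext fun s => paramPhi_eq u s
  rw [paramPhiPhi, h]
  refine HasDerivAt.deriv (hasDerivAt_pi.2 fun i => ?_)
  fin_cases i
  · exact ((Real.hasDerivAt_sin φ).const_mul (S.f u)).neg
  · exact ((Real.hasDerivAt_cos φ).const_mul (S.f u)).congr_deriv (mul_neg _ _)
  · exact hasDerivAt_const φ (0 : ℝ)

lemma deriv_mul_deriv_add {u : ℝ} (hu : u ∈ S.dom) :
    deriv S.f u * deriv (deriv S.f) u + deriv S.g u * deriv (deriv S.g) u = 0 := by
  have h1 := ((hasDerivAt_deriv_f hu).pow 2).add ((hasDerivAt_deriv_g hu).pow 2)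
  have h2 : HasDerivAt (deriv S.f ^ 2 + deriv S.g ^ 2) 0 u :=
    (hasDerivAt_const u (1 : ℝ)).congr_of_eventuallyEq
      (eventually_of_mem (dom_mem_nhds hu) fun s hs => S.unit_speed s hs)
  have := h1.unique h2
  norm_num at this
  linarith

/-- The fundamental forms give `g' (f' g'' - g' f'') / f`; unit speed and its derivative `f' f'' +
g' g'' = 0` eliminate `g`. -/
lemma gaussianCurvature_eq {u : ℝ} (hu : u ∈ S.dom) (φ : ℝ) :
    S.gaussianCurvature u φ = -deriv (deriv S.f) u / S.f u := by
  have hf := S.f_pos u hu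
  have hsc := Real.sin_sq_add_cos_sq φ
  have hdet : S.firstFormDet u φ = S.f u ^ 2 := by
    rw [firstFormDet, paramU_eq hu, paramPhi_eq]
    simp [dotProduct, Fin.sum_univ_three]
    have := S.unit_speed u hu
    linear_combination (S.f u ^ 2 * (Real.sin φ ^ 2 + Real.cos φ ^ 2)) * this +
      (S.f u ^ 2 + S.f u ^ 2 * deriv S.f u ^ 2 * (Real.sin φ ^ 2 + Real.cos φ ^ 2)) * hsc
  have hsq : Real.sqrt (S.firstFormDet u φ) = S.f u := by
    rw [hdet, Real.sqrt_sq hf.le]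
  rw [gaussianCurvature]
  simp only [secondFormCoeff, hsq]
  rw [hdet, paramU_eq hu, paramPhi_eq, paramUU_eq hu, paramUPhi_eq hu, paramPhiPhi_eq]
  have h1 := S.unit_speed u hu
  have h2 := deriv_mul_deriv_add hu
  simp [dotProduct, Fin.sum_univ_three, crossProduct]
  have key : ∀ A B C : ℝ,
      A = S.f u * (deriv S.f u * deriv (deriv S.g) u - deriv S.g u * deriv (deriv S.f) u) →
      B = S.f u ^ 2 * deriv S.g u → C = 0 →
      (A / S.f u * (B / S.f u) - (C / S.f u) ^ 2) / S.f u ^ 2 =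
        -deriv (deriv S.f) u / S.f u := by
    rintro A B C rfl rfl rfl
    field_simp
    linear_combination S.f u ^ 3 * (deriv S.f u * h2 - deriv (deriv S.f) u * h1)
  apply key
  · linear_combination (S.f u * (deriv S.f u * deriv (deriv S.g) u -
      deriv S.g u * deriv (deriv S.f) u)) * hsc
  · linear_combination (S.f u ^ 2 * deriv S.g u) * hsc
  · ring

/-- On a surface of constant curvature, `f'' = -K f`. -/
lemma HasConstantCurvature.exists_deriv_deriv (hS : S.HasConstantCurvature) :
    ∃ K : ℝ, ∀ u ∈ S.dom, deriv (deriv S.f) u = -K * S.f u := by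
  obtain ⟨K, hK⟩ := hS
  refine ⟨K, fun u hu => ?_⟩
  have h := hK u hu 0
  rw [gaussianCurvature_eq hu, div_eq_iff (S.f_pos u hu).ne'] at h
  linarith

end SurfaceOfRevolution

/-! ### Global consequences of `f'' = -K f`. -/

namespace SurfaceOfRevolution

open Set Filter Topology

variable {S : SurfaceOfRevolution}

lemma eq_of_hasDerivAt_zero {F : ℝ → ℝ} (h : ∀ u ∈ S.dom, HasDerivAt F 0 u) {u v : ℝ}
    (hu : u ∈ S.dom) (hv : v ∈ S.dom) : F u = F v :=
  S.isOpen_dom.is_const_of_deriv_eq_zero S.isPreconnected_dom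
    (fun x hx => (h x hx).differentiableAt.differentiableWithinAt)
    (fun x hx => (h x hx).deriv) hu hv

lemma nonempty_dom (S : SurfaceOfRevolution) : S.dom.Nonempty := by
  have h := S.ends
  unfold dom ProfileKind.dom
  unfold ProfileKind.EndConditions at h
  split at h
  · exact nonempty_Ioo.2 h.1
  · obtain ⟨x, hx⟩ := EReal.lt_iff_exists_real_btwn.1 h.1
    exact ⟨x, hx⟩
  · exact univ_nonempty
  · obtain ⟨x, hx⟩ := EReal.lt_iff_exists_real_btwn.1 h.1
    exact ⟨x, EReal.coe_lt_coe_iff.1 hx.1, hx.2⟩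

lemma exists_eq_of_hasDerivAt_zero {F : ℝ → ℝ} (h : ∀ u ∈ S.dom, HasDerivAt F 0 u) :
    ∃ c, ∀ u ∈ S.dom, F u = c := by
  obtain ⟨u₀, hu₀⟩ := S.nonempty_dom
  exact ⟨F u₀, fun u hu => eq_of_hasDerivAt_zero h hu hu₀⟩

/-- The surface has constant Gaussian curvature `K`. -/
def CurvatureEq (S : SurfaceOfRevolution) (K : ℝ) : Prop :=
  ∀ u ∈ S.dom, deriv (deriv S.f) u = -K * S.f u

lemma abs_deriv_f_le_one {u : ℝ} (hu : u ∈ S.dom) : |deriv S.f u| ≤ 1 := by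
  rw [← sq_le_one_iff_abs_le_one]
  nlinarith [S.unit_speed u hu, sq_nonneg (deriv S.g u)]

namespace CurvatureEq

variable {K : ℝ} (hK : S.CurvatureEq K)
include hK

lemma hasDerivAt_deriv {u : ℝ} (hu : u ∈ S.dom) : HasDerivAt (deriv S.f) (-K * S.f u) u := by
  rw [← hK u hu]
  exact hasDerivAt_deriv_f hu

lemma exists_const : ∃ q : ℝ, ∀ u ∈ S.dom, deriv S.f u ^ 2 + K * S.f u ^ 2 = q := by
  obtain ⟨u₀, hu₀⟩ := S.nonempty_dom
  refine ⟨deriv S.f u₀ ^ 2 + K * S.f u₀ ^ 2, fun u hu => ?_⟩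
  refine eq_of_hasDerivAt_zero (F := fun u => deriv S.f u ^ 2 + K * S.f u ^ 2)
    (fun v hv => ?_) hu hu₀
  have := ((hK.hasDerivAt_deriv hv).pow 2).add (((hasDerivAt_f hv).pow 2).const_mul K)
  refine this.congr_deriv ?_
  norm_num
  ring

lemma satisfiesProfileEquation_iff {q : ℝ} :
    S.SatisfiesProfileEquation q ↔ ∀ u ∈ S.dom, deriv S.f u ^ 2 + K * S.f u ^ 2 = q := by
  refine forall₂_congr fun u hu => ?_
  rw [hK u hu]
  constructor <;> intro h <;> linarith

/-- Rotating the pair `(√K f, f')` by the angle `√K u` gives two constants, from which `f` is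
recovered. The case `K < 0` is the same with exponentials. -/
lemma exists_trig (h0 : 0 < K) : ∃ A B : ℝ, ∀ u ∈ S.dom,
    S.f u = A * Real.cos (√K * u) + B * Real.sin (√K * u) := by
  have hk : √K ≠ 0 := (Real.sqrt_pos.2 h0).ne'
  have hk2 : √K * √K = K := Real.mul_self_sqrt h0.le
  have hc (u : ℝ) : HasDerivAt (fun u => Real.cos (√K * u)) (-(√K * Real.sin (√K * u))) u := by
    have := ((hasDerivAt_id u).const_mul √K).cos
    refine this.congr_deriv ?_
    simp; ring
  have hs (u : ℝ) : HasDerivAt (fun u => Real.sin (√K * u)) (√K * Real.cos (√K * u)) u := by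
    have := ((hasDerivAt_id u).const_mul √K).sin
    refine this.congr_deriv ?_
    simp; ring
  obtain ⟨A, hA⟩ := exists_eq_of_hasDerivAt_zero (S := S)
    (F := fun u => √K * (S.f u * Real.cos (√K * u)) - deriv S.f u * Real.sin (√K * u))
    (fun v hv => by
      refine ((((hasDerivAt_f hv).mul (hc v)).const_mul √K).sub
        ((hK.hasDerivAt_deriv hv).mul (hs v))).congr_deriv ?_
      linear_combination (-S.f v * Real.sin (√K * v)) * hk2)
  obtain ⟨B, hB⟩ := exists_eq_of_hasDerivAt_zero (S := S)
    (F := fun u => √K * (S.f u * Real.sin (√K * u)) + deriv S.f u * Real.cos (√K * u))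
    (fun v hv => by
      refine ((((hasDerivAt_f hv).mul (hs v)).const_mul √K).add
        ((hK.hasDerivAt_deriv hv).mul (hc v))).congr_deriv ?_
      linear_combination (S.f v * Real.cos (√K * v)) * hk2)
  refine ⟨A / √K, B / √K, fun u hu => ?_⟩
  · rw [← hA u hu, ← hB u hu]
    field_simp
    linear_combination (-S.f u * √K) * Real.sin_sq_add_cos_sq (√K * u)

lemma exists_exp (h0 : K < 0) : ∃ A B : ℝ, ∀ u ∈ S.dom,
    S.f u = A * Real.exp (√(-K) * u) + B * Real.exp (-√(-K) * u) := by
  have hk : √(-K) ≠ 0 := (Real.sqrt_pos.2 (by linarith)).ne'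
  have hk2 : √(-K) * √(-K) = -K := Real.mul_self_sqrt (by linarith)
  have he (c u : ℝ) : HasDerivAt (fun u => Real.exp (c * u)) (c * Real.exp (c * u)) u := by
    have := ((hasDerivAt_id u).const_mul c).exp
    refine this.congr_deriv ?_
    simp; ring
  obtain ⟨A, hA⟩ := exists_eq_of_hasDerivAt_zero (S := S)
    (F := fun u => (√(-K) * S.f u + deriv S.f u) * Real.exp (-√(-K) * u))
    (fun v hv => by
      refine ((((hasDerivAt_f hv).const_mul √(-K)).add (hK.hasDerivAt_deriv hv)).mul
        (he _ v)).congr_deriv ?_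
      simp only [Pi.add_apply]
      linear_combination (-S.f v * Real.exp (-√(-K) * v)) * hk2)
  obtain ⟨B, hB⟩ := exists_eq_of_hasDerivAt_zero (S := S)
    (F := fun u => (√(-K) * S.f u - deriv S.f u) * Real.exp (√(-K) * u))
    (fun v hv => by
      refine ((((hasDerivAt_f hv).const_mul √(-K)).sub (hK.hasDerivAt_deriv hv)).mul
        (he _ v)).congr_deriv ?_
      simp only [Pi.sub_apply]
      linear_combination (S.f v * Real.exp (√(-K) * v)) * hk2)
  refine ⟨A / (2 * √(-K)), B / (2 * √(-K)), fun u hu => ?_⟩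
  · rw [← hA u hu, ← hB u hu]
    have : Real.exp (-√(-K) * u) * Real.exp (√(-K) * u) = 1 := by
      rw [← Real.exp_add]; simp
    rw [neg_mul] at this
    field_simp
    linear_combination (-2 * √(-K) * S.f u) * this

lemma exists_affine (h0 : K = 0) : ∃ A B : ℝ, ∀ u ∈ S.dom, S.f u = A * u + B := by
  obtain ⟨A, hA⟩ := exists_eq_of_hasDerivAt_zero (S := S)
    (F := deriv S.f) (fun v hv => (hK.hasDerivAt_deriv hv).congr_deriv (by simp [h0]))
  obtain ⟨B, hB⟩ := exists_eq_of_hasDerivAt_zero (S := S)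
    (F := fun u => S.f u - A * u) (fun v hv =>
      ((hasDerivAt_f hv).sub ((hasDerivAt_id v).const_mul _)).congr_deriv
        (by simp [hA v hv]))
  exact ⟨A, B, fun u hu => by linarith [hB u hu]⟩

/-- The profile is only assumed smooth; analyticity, needed to propagate identities from a small
interval to all of `dom`, comes from the explicit solutions. -/
lemma analyticOnNhd_f : AnalyticOnNhd ℝ S.f S.dom := by
  intro u hu
  rcases lt_trichotomy K 0 with h0 | h0 | h0
  · obtain ⟨A, B, h⟩ := hK.exists_exp h0
    refine AnalyticAt.congr ?_ (eventually_of_mem (dom_mem_nhds hu) fun v hv => (h v hv).symm)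
    fun_prop
  · obtain ⟨A, B, h⟩ := hK.exists_affine h0
    refine AnalyticAt.congr ?_ (eventually_of_mem (dom_mem_nhds hu) fun v hv => (h v hv).symm)
    fun_prop
  · obtain ⟨A, B, h⟩ := hK.exists_trig h0
    refine AnalyticAt.congr ?_ (eventually_of_mem (dom_mem_nhds hu) fun v hv => (h v hv).symm)
    fun_prop

/-- A surface of constant curvature is not a torus of revolution. -/
lemma kind_ne_toroidal (c d : ℝ) : S.kind ≠ .toroidal c d := by
  intro hk
  have hdom : S.dom = univ := by simp [dom, hk, ProfileKind.dom]
  have hmem (u : ℝ) : u ∈ S.dom := hdom ▸ mem_univ u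
  have hends := S.ends
  rw [hk] at hends
  obtain ⟨hcd, hf, hg, -⟩ := hends
  have hT : 0 < d - c := sub_pos.2 hcd
  have hf0 : ∀ u, S.f u = S.f (u + (d - c)) := fun u => (hf u).symm
  have hdf : ∀ u, deriv S.f u = 0 := by
    -- For `K ≤ 0` the function `f'` is monotone and periodic, hence constant, and Rolle makes it
    -- vanish. For `K > 0` the solution changes sign over the half period `π / √K`, against `f > 0`.
    rcases le_or_gt K 0 with h0 | h0
    · obtain ⟨q, hq⟩ := hK.exists_const
      have hmono : Monotone (deriv S.f) := monotone_of_deriv_nonneg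
        (fun u => (hK.hasDerivAt_deriv (hmem u)).differentiableAt) fun u => by
          rw [hK u (hmem u)]
          exact mul_nonneg (by linarith) (S.f_pos u (hmem u)).le
      have hper : Function.Periodic (deriv S.f) (d - c) := by
        intro u
        rw [← deriv_comp_add_const]
        congr 1
        exact funext hf
      have hconst : ∀ u v, u ≤ v → deriv S.f v ≤ deriv S.f u := by
        intro u v huv
        obtain ⟨n, hn⟩ := exists_nat_ge ((v - u) / (d - c))
        rw [div_le_iff₀ hT] at hn
        calc deriv S.f v ≤ deriv S.f (u + n * (d - c)) := hmono (by linarith)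
          _ = deriv S.f u := hper.nat_mul n u
      obtain ⟨u₀, -, hu₀⟩ := exists_deriv_eq_zero (f := S.f) hcd
        (fun u _ => (hasDerivAt_f (hmem u)).continuousAt.continuousWithinAt)
        (by rw [hf0 c]; congr 1; ring)
      intro u
      rcases le_total u u₀ with h | h
      · exact le_antisymm ((hmono h).trans hu₀.le) (hu₀.ge.trans (hconst _ _ h))
      · exact le_antisymm ((hconst _ _ h).trans hu₀.le) (hu₀.ge.trans (hmono h))
    · obtain ⟨A, B, h⟩ := hK.exists_trig h0
      have h1 := S.f_pos 0 (hmem 0)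
      have h2 := S.f_pos (Real.pi / √K) (hmem _)
      rw [h _ (hmem _)] at h1 h2
      rw [mul_div_cancel₀ _ (Real.sqrt_pos.2 h0).ne'] at h2
      simp at h1 h2
      linarith
  -- The periodic `g` also has a critical point, where the unit speed condition would read `0 = 1`.
  obtain ⟨u₀, -, hu₀⟩ := exists_deriv_eq_zero (f := S.g) hcd
    (fun u _ => (hasDerivAt_g (hmem u)).continuousAt.continuousWithinAt)
    (by rw [← hg c]; congr 1; ring)
  have := S.unit_speed u₀ (hmem u₀)
  rw [hu₀, hdf u₀] at this
  norm_num at this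

lemma injOn_profile : InjOn (fun u => (S.f u, S.g u)) S.dom := by
  have h := S.ends
  have hne := hK.kind_ne_toroidal
  refine InjOn.mono S.dom_subset_carrier ?_
  unfold ProfileKind.carrier
  unfold ProfileKind.EndConditions at h
  split at h
  · exact h.2.2.2
  · exact h.2
  · rename_i c d hk
    exact absurd hk (hne c d)
  · exact h.2.2

/-- A shift by half a period reverses the sign of `f`. This bounds the length of `dom` when `K > 0`.
-/
lemma f_add_pi_div_sqrt (h0 : 0 < K) {u : ℝ} (hu : u ∈ S.dom) (hv : u + Real.pi / √K ∈ S.dom) :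
    False := by
  obtain ⟨A, B, h⟩ := hK.exists_trig h0
  have h1 := S.f_pos _ hu
  have h2 := S.f_pos _ hv
  rw [h _ hu] at h1
  rw [h _ hv, mul_add, mul_div_cancel₀ _ (Real.sqrt_pos.2 h0).ne', Real.cos_add_pi,
    Real.sin_add_pi] at h2
  linarith

end CurvatureEq

end SurfaceOfRevolution

/-! ### Differential equations and inequalities on a half-line. -/

open Set Filter Topology

lemma monotoneOn_Ici_of_hasDerivWithinAt {F F' : ℝ → ℝ} {a : ℝ}
    (h : ∀ t, a ≤ t → HasDerivWithinAt F (F' t) (Ici a) t) (h' : ∀ t, a ≤ t → 0 ≤ F' t) :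
    MonotoneOn F (Ici a) := by
  refine monotoneOn_of_hasDerivWithinAt_nonneg (f' := F') (convex_Ici a)
    (fun t ht => (h t ht).continuousWithinAt) (fun t ht => ?_) (fun t ht => ?_)
  · exact (h t (interior_subset ht)).mono interior_subset
  · exact h' t (interior_subset ht)

lemma eq_of_hasDerivWithinAt_Ici_zero {F : ℝ → ℝ} {a : ℝ}
    (h : ∀ t, a ≤ t → HasDerivWithinAt F 0 (Ici a) t) {t : ℝ} (ht : a ≤ t) : F t = F a := by
  refine le_antisymm ?_ ?_
  · have := monotoneOn_Ici_of_hasDerivWithinAt (F := -F) (F' := fun _ => 0)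
      (fun t ht => by simpa using (h t ht).neg) (fun _ _ => le_rfl) (mem_Ici.2 le_rfl) ht ht
    simpa using this
  · exact monotoneOn_Ici_of_hasDerivWithinAt h (fun _ _ => le_rfl) (mem_Ici.2 le_rfl) ht ht

/-- A function on a half-line whose derivative is at least `c` grows at least linearly. -/
lemma add_mul_le_of_hasDerivWithinAt {F F' : ℝ → ℝ} {a c : ℝ}
    (h : ∀ t, a ≤ t → HasDerivWithinAt F (F' t) (Ici a) t) (h' : ∀ t, a ≤ t → c ≤ F' t)
    {t : ℝ} (ht : a ≤ t) : F a + c * (t - a) ≤ F t := by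
  have := monotoneOn_Ici_of_hasDerivWithinAt (F := fun t => F t - c * t) (F' := fun t => F' t - c)
    (fun t ht => ((h t ht).sub ((hasDerivWithinAt_id t _).const_mul c)).congr_deriv (by simp))
    (fun t ht => sub_nonneg.2 (h' t ht)) (mem_Ici.2 le_rfl) ht ht
  simp only at this
  linarith

/-- A function whose derivative is eventually bounded below by a positive constant is not bounded
above. -/
lemma exists_gt_of_hasDerivWithinAt {F F' : ℝ → ℝ} {a c : ℝ} (hc : 0 < c)
    (h : ∀ t, a ≤ t → HasDerivWithinAt F (F' t) (Ici a) t) (h' : ∀ t, a ≤ t → c ≤ F' t)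
    (R : ℝ) : ∃ t, a ≤ t ∧ R < F t := by
  refine ⟨a + (|R - F a| + 1) / c, ?_, ?_⟩
  · have : 0 ≤ (|R - F a| + 1) / c := by positivity
    linarith
  · have := add_mul_le_of_hasDerivWithinAt h h' (t := a + (|R - F a| + 1) / c)
      (by have : 0 ≤ (|R - F a| + 1) / c := by positivity
          linarith)
    rw [add_sub_cancel_left, mul_div_cancel₀ _ hc.ne'] at this
    linarith [le_abs_self (R - F a)]

/-- A uniformly accelerated function is not bounded above. -/
lemma exists_gt_of_hasDerivWithinAt_two {w p b : ℝ → ℝ} {c : ℝ} (hc : 0 < c)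
    (hw : ∀ t, 0 ≤ t → HasDerivWithinAt w (p t) (Ici 0) t)
    (hp : ∀ t, 0 ≤ t → HasDerivWithinAt p (b t) (Ici 0) t) (h : ∀ t, 0 ≤ t → c ≤ b t) (R : ℝ) :
    ∃ t, 0 ≤ t ∧ R < w t := by
  obtain ⟨a, ha, hpa⟩ := exists_gt_of_hasDerivWithinAt hc hp h 1
  obtain ⟨t, ht, h1⟩ := exists_gt_of_hasDerivWithinAt (F := w) (F' := p) (a := a) one_pos
    (fun t ht => (hw t (ha.trans ht)).mono (Ici_subset_Ici.2 ha)) (fun t ht => hpa.le.trans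
      (monotoneOn_Ici_of_hasDerivWithinAt hp (fun t ht => hc.le.trans (h t ht)) ha
        (ha.trans ht) ht)) R
  exact ⟨t, ha.trans ht, h1⟩

/-- Solutions of `X' = ν Y`, `Y' = -β² ν X` rotate with the angle `β φ`, where `φ' = ν`. -/
lemma exists_eq_cos_add_sin {φ X Y ν : ℝ → ℝ} {β : ℝ} (hβ : β ≠ 0)
    (hφ : ∀ t, 0 ≤ t → HasDerivWithinAt φ (ν t) (Ici 0) t)
    (hX : ∀ t, 0 ≤ t → HasDerivWithinAt X (ν t * Y t) (Ici 0) t)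
    (hY : ∀ t, 0 ≤ t → HasDerivWithinAt Y (-(β ^ 2 * ν t * X t)) (Ici 0) t) :
    ∃ A B : ℝ, ∀ t, 0 ≤ t → X t = A * Real.cos (β * φ t) + B * Real.sin (β * φ t) := by
  have hA : ∀ t, 0 ≤ t → HasDerivWithinAt
      (fun t => β * X t * Real.cos (β * φ t) - Y t * Real.sin (β * φ t)) 0 (Ici 0) t := by
    intro t ht
    have hc := ((hφ t ht).const_mul β).cos
    have hs := ((hφ t ht).const_mul β).sin
    refine ((((hX t ht).const_mul β).mul hc).sub ((hY t ht).mul hs)).congr_deriv ?_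
    ring
  have hB : ∀ t, 0 ≤ t → HasDerivWithinAt
      (fun t => β * X t * Real.sin (β * φ t) + Y t * Real.cos (β * φ t)) 0 (Ici 0) t := by
    intro t ht
    have hc := ((hφ t ht).const_mul β).cos
    have hs := ((hφ t ht).const_mul β).sin
    refine ((((hX t ht).const_mul β).mul hs).add ((hY t ht).mul hc)).congr_deriv ?_
    ring
  refine ⟨(β * X 0 * Real.cos (β * φ 0) - Y 0 * Real.sin (β * φ 0)) / β,
    (β * X 0 * Real.sin (β * φ 0) + Y 0 * Real.cos (β * φ 0)) / β, fun t ht => ?_⟩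
  have h1 := eq_of_hasDerivWithinAt_Ici_zero hA ht
  have h2 := eq_of_hasDerivWithinAt_Ici_zero hB ht
  rw [← h1, ← h2]
  field_simp
  linear_combination (-β * X t) * Real.sin_sq_add_cos_sq (β * φ t)

/-- A solution of an autonomous scalar equation `φ' = G φ` with `P`-periodic `G` repeats itself,
shifted by `P`, as soon as it has advanced by `P`. -/
lemma eq_add_of_hasDerivWithinAt_periodic {φ G : ℝ → ℝ} {P T : ℝ} (hG : ContDiff ℝ 1 G)
    (hP : ∀ x, G (x + P) = G x)
    (hφ : ∀ t, 0 ≤ t → HasDerivWithinAt φ (G (φ t)) (Ici 0) t) (hT : 0 ≤ T)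
    (h : φ T = φ 0 + P) {t : ℝ} (ht : 0 ≤ t) : φ (t + T) = φ t + P := by
  have hcont : ContinuousOn φ (Ici 0) := fun t ht => (hφ t ht).continuousWithinAt
  have hcont2 : ContinuousOn (fun t => φ (t + T) - P) (Icc 0 t) :=
    (hcont.comp (by fun_prop) fun s hs => add_nonneg hs.1 hT).sub continuousOn_const
  have hcont1 := hcont.mono (Icc_subset_Ici_self : Icc 0 t ⊆ Ici 0)
  -- `G` is only locally Lipschitz, so uniqueness is applied on the compact set of values taken by
  -- the two solutions `φ(t + T) - P` and `φ(t)`.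
  set k : Set ℝ := φ '' Icc 0 t ∪ (fun t => φ (t + T) - P) '' Icc 0 t
  have hk : IsCompact k := (isCompact_Icc.image_of_continuousOn hcont1).union
    (isCompact_Icc.image_of_continuousOn hcont2)
  obtain ⟨L, hL⟩ :=
    (hG.locallyLipschitz.locallyLipschitzOn (s := k)).exists_lipschitzOnWith_of_compact
    hk
  have := ODE_solution_unique_of_mem_Icc_right (v := fun _ => G) (s := fun _ => k) (K := L)
    (f := fun t => φ (t + T) - P) (g := φ) (a := 0) (b := t) (fun _ _ => hL) hcont2
    (fun s hs => by
      have h1 : HasDerivWithinAt φ (G (φ (s + T))) (Ici (s + T)) (s + T) :=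
        (hφ (s + T) (add_nonneg hs.1 hT)).mono (Ici_subset_Ici.2 (add_nonneg hs.1 hT))
      have h2 : HasDerivWithinAt (fun t => φ (t + T)) (G (φ (s + T)) * 1) (Ici s) s :=
        h1.comp s ((hasDerivWithinAt_id s _).add_const T) fun x hx => by
          simpa using hx
      have h3 := h2.sub_const P
      rw [mul_one, show φ (s + T) = φ (s + T) - P + P by ring, hP] at h3
      exact h3)
    (fun s hs => Or.inr ⟨s, Ico_subset_Icc_self hs, rfl⟩) hcont1
    (fun s hs => (hφ s hs.1).mono (Ici_subset_Ici.2 hs.1))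
    (fun s hs => Or.inl ⟨s, Ico_subset_Icc_self hs, rfl⟩) (by simp [h])
  have h1 := this (right_mem_Icc.2 ht)
  simp only at h1
  linarith

/-! ### Bounded orbits and a criterion for closedness. -/

namespace SurfaceOfRevolution

variable {S : SurfaceOfRevolution} {V : ℝ → ℝ} {m : ℝ}

namespace NonsingularOrbit

variable (o : S.NonsingularOrbit V m)

lemma pφ_eq {t : ℝ} (ht : 0 ≤ t) : o.pφ t = o.pφ 0 :=
  eq_of_hasDerivWithinAt_Ici_zero o.eq_pφ ht

lemma continuousOn_u : ContinuousOn o.u (Ici 0) := fun t ht => (o.eq_u t ht).continuousWithinAt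

lemma exists_f_le (ho : o.Bounded) : ∃ M, 0 < M ∧ ∀ t, 0 ≤ t → S.f (o.u t) ≤ M := by
  obtain ⟨R, hR⟩ := ho.exists_norm_le
  have hR' : ∀ t, 0 ≤ t → ‖o.position t‖ ≤ R := fun t ht => hR _ ⟨t, ht, rfl⟩
  have hR0 : 0 ≤ R := (norm_nonneg _).trans (hR' 0 le_rfl)
  refine ⟨2 * R + 1, by linarith, fun t ht => ?_⟩
  have h0 := (norm_le_pi_norm (o.position t) 0).trans (hR' t ht)
  have h1 := (norm_le_pi_norm (o.position t) 1).trans (hR' t ht)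
  have h0' : |S.f (o.u t) * Real.cos (o.φ t)| ≤ R := h0
  have h1' : |S.f (o.u t) * Real.sin (o.φ t)| ≤ R := h1
  have h2 := sq_le_sq' (abs_le.1 h0').1 (abs_le.1 h0').2
  have h3 := sq_le_sq' (abs_le.1 h1').1 (abs_le.1 h1').2
  have h4 := Real.sin_sq_add_cos_sq (o.φ t)
  refine le_trans (abs_le_of_sq_le_sq' (b := 2 * R) ?_ (by linarith)).2 (by linarith)
  have : S.f (o.u t) ^ 2 = (S.f (o.u t) * Real.cos (o.φ t)) ^ 2 +
      (S.f (o.u t) * Real.sin (o.φ t)) ^ 2 := by linear_combination (-S.f (o.u t) ^ 2) * h4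
  nlinarith

/-- Boundedness in space bounds `f`. If `K ≤ 0`, then `(f')² ≥ q`, so `u` cannot vary much while `f`
stays bounded; if `K > 0`, the domain itself has bounded length. -/
lemma exists_abs_le {K q : ℝ} (hK : S.CurvatureEq K) (hq0 : 0 < q)
    (hq : S.SatisfiesProfileEquation q) (ho : o.Bounded) :
    ∃ R, ∀ t, 0 ≤ t → |o.u t| ≤ R := by
  obtain ⟨M, hM0, hM⟩ := o.exists_f_le ho
  rw [hK.satisfiesProfileEquation_iff] at hq
  suffices ∃ R, ∀ s t, 0 ≤ s → 0 ≤ t → o.u s < o.u t → o.u t - o.u s ≤ R by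
    obtain ⟨R, hR⟩ := this
    refine ⟨|o.u 0| + |R|, fun t ht => ?_⟩
    rcases lt_trichotomy (o.u 0) (o.u t) with h | h | h
    · have := hR 0 t le_rfl ht h
      rw [abs_le]; constructor <;> cases abs_cases (o.u 0) <;> cases abs_cases R <;> linarith
    · rw [← h]; linarith [abs_nonneg R]
    · have := hR t 0 ht le_rfl h
      rw [abs_le]; constructor <;> cases abs_cases (o.u 0) <;> cases abs_cases R <;> linarith
  rcases le_or_gt K 0 with h0 | h0
  · refine ⟨M / √q, fun s t hs ht hst => ?_⟩
    have hsub : Icc (o.u s) (o.u t) ⊆ S.dom :=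
      S.ordConnected_dom.out (o.mem_dom s hs) (o.mem_dom t ht)
    obtain ⟨ξ, hξ, h1⟩ := exists_deriv_eq_slope S.f hst
      (fun x hx => (hasDerivAt_f (hsub hx)).continuousAt.continuousWithinAt)
      (fun x hx => (hasDerivAt_f (hsub (Ioo_subset_Icc_self hx))).differentiableAt
        |>.differentiableWithinAt)
    have hξd := hsub (Ioo_subset_Icc_self hξ)
    have h2 := hq ξ hξd
    rw [eq_div_iff (sub_pos.2 hst).ne'] at h1
    have h3 : q ≤ deriv S.f ξ ^ 2 := by nlinarith [sq_nonneg (S.f ξ)]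
    have h4 : √q ≤ |deriv S.f ξ| := Real.sqrt_le_sqrt h3 |>.trans (Real.sqrt_sq_eq_abs _).le
    have h5 : |deriv S.f ξ| * (o.u t - o.u s) ≤ M := by
      rw [← abs_of_pos (sub_pos.2 hst), ← abs_mul, h1, abs_le]
      constructor <;> linarith [hM s hs, hM t ht, S.f_pos _ (o.mem_dom s hs),
        S.f_pos _ (o.mem_dom t ht)]
    rw [le_div_iff₀ (Real.sqrt_pos.2 hq0)]
    nlinarith [sub_pos.2 hst]
  · refine ⟨Real.pi / √K, fun s t hs ht hst => ?_⟩
    by_contra! hcon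
    refine hK.f_add_pi_div_sqrt h0 (o.mem_dom s hs) ?_
    exact S.ordConnected_dom.out (o.mem_dom s hs) (o.mem_dom t ht)
      ⟨by
        have := Real.pi_pos
        have := Real.sqrt_nonneg K
        linarith [show 0 ≤ Real.pi / √K by positivity],
        by linarith⟩

lemma position_eq {s t : ℝ} (hu : o.u s = o.u t) (n : ℤ) (hφ : o.φ s = o.φ t + n * (2 * Real.pi)) :
    o.position s = o.position t := by
  simp only [position, param, hu, hφ, Real.cos_add_int_mul_two_pi, Real.sin_add_int_mul_two_pi]

/-- An orbit along which `φ' = G(φ)`, and an injective function of `u` is an explicit periodic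
function of `φ`, is closed. -/
lemma closed_of_eq_cos_add_sin (hm : 0 < m) (ho : o.Bounded) (hl : o.pφ 0 ≠ 0) {β : ℚ}
    {Ξ P : ℝ → ℝ} (hP : ContDiff ℝ 1 P) (hΞ : InjOn Ξ S.dom)
    (hΞP : ∀ u ∈ S.dom, 1 / S.f u ^ 2 = P (Ξ u)) {A B : ℝ}
    (h : ∀ t, 0 ≤ t → Ξ (o.u t) = A * Real.cos (β * o.φ t) + B * Real.sin (β * o.φ t)) :
    o.Closed := by
  set l := o.pφ 0
  obtain ⟨M, hM0, hM⟩ := o.exists_f_le ho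
  set X : ℝ → ℝ := fun x => A * Real.cos (β * x) + B * Real.sin (β * x) with hX
  set G : ℝ → ℝ := fun x => l / m * P (X x) with hGdef
  have hG : ContDiff ℝ 1 G := by
    have : ContDiff ℝ 1 X := by fun_prop
    exact contDiff_const.mul (hP.comp this)
  have hder : ∀ t, 0 ≤ t → HasDerivWithinAt o.φ (G (o.φ t)) (Ici 0) t := by
    intro t ht
    refine (o.eq_φ t ht).congr_deriv ?_
    have := hΞP _ (o.mem_dom t ht)
    rw [h t ht] at this
    simp only [hGdef, hX]
    rw [← this, o.pφ_eq ht]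
    have := (S.f_pos _ (o.mem_dom t ht)).ne'
    change l / _ = _
    field_simp
  -- `β * β.den` is an integer, so advancing `φ` by `2π β.den` is a full number of turns both in
  -- space and in the phase `β φ`.
  have hXP : ∀ (n : ℤ) x, X (x + n * (β.den * (2 * Real.pi))) = X x := by
    intro n x
    have hden : (β : ℝ) * β.den = β.num := by exact_mod_cast Rat.mul_den_eq_num β
    have : (β : ℝ) * (x + n * (β.den * (2 * Real.pi))) =
        β * x + ((n * β.num : ℤ) : ℝ) * (2 * Real.pi) := by
      push_cast
      linear_combination (n * (2 * Real.pi)) * hden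
    simp only [hX, this, Real.cos_add_int_mul_two_pi, Real.sin_add_int_mul_two_pi]
  have hadv : ∃ n : ℤ, ∃ T, 0 < T ∧ o.φ T = o.φ 0 + n * (β.den * (2 * Real.pi)) := by
    have hden : (0 : ℝ) < β.den := by exact_mod_cast β.den_pos
    -- `σ` is the sign of `l`. Then `σ φ` grows at least at the rate `|l| / (m M²)`, and the
    -- intermediate value theorem gives the time at which it has advanced by exactly one period.
    obtain ⟨σ, hσ⟩ : ∃ σ : ℤ, (σ : ℝ) * l = |l| ∧ (σ : ℝ) * σ = 1 := by
      rcases lt_or_gt_of_ne hl with h | h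
      · exact ⟨-1, by rw [abs_of_neg h]; simp, by norm_num⟩
      · exact ⟨1, by rw [abs_of_pos h]; simp, by norm_num⟩
    have hd : ∀ t, 0 ≤ t → HasDerivWithinAt (fun t => σ * o.φ t)
        (σ * (o.pφ t / (m * S.f (o.u t) ^ 2))) (Ici 0) t :=
      fun t ht => (o.eq_φ t ht).const_mul _
    obtain ⟨t, ht, h1⟩ := exists_gt_of_hasDerivWithinAt (c := |l| / (m * M ^ 2))
      (by positivity) hd (fun t ht => by
        rw [o.pφ_eq ht, ← mul_div_assoc, hσ.1]
        have := S.f_pos _ (o.mem_dom t ht)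
        have := hM t ht
        gcongr) (σ * o.φ 0 + β.den * (2 * Real.pi))
    have hcont : ContinuousOn (fun t => σ * o.φ t) (Icc 0 t) := fun s hs =>
      (hd s hs.1).continuousWithinAt.mono Icc_subset_Ici_self
    obtain ⟨T, hT, hT2⟩ := intermediate_value_Icc ht hcont
      (show σ * o.φ 0 + β.den * (2 * Real.pi) ∈ _ from
        ⟨by have := Real.pi_pos; linarith [show 0 ≤ β.den * (2 * Real.pi) by positivity],
          h1.le⟩)
    simp only at hT2
    refine ⟨σ, T, lt_of_le_of_ne hT.1 ?_, ?_⟩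
    · rintro rfl
      have := Real.pi_pos
      linarith [show 0 < β.den * (2 * Real.pi) by positivity]
    · linear_combination σ * hT2 + (o.φ 0 - o.φ T) * hσ.2
  obtain ⟨n, T, hT, hφT⟩ := hadv
  refine ⟨T, hT, fun t ht => ?_⟩
  have h1 := eq_add_of_hasDerivWithinAt_periodic (P := n * (β.den * (2 * Real.pi))) hG
    (fun x => by simp only [hGdef, hXP]) hder hT.le hφT ht
  refine o.position_eq (hΞ (o.mem_dom _ (by linarith)) (o.mem_dom _ ht) ?_) (n * β.den) ?_
  · rw [h t ht, h (t + T) (by linarith), h1]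
    exact hXP n _
  · rw [h1]; push_cast; ring

lemma closed_of_circular_of_radial (hc : o.Circular) (hl : o.pφ 0 = 0) : o.Closed := by
  have hφ : ∀ t, 0 ≤ t → o.φ t = o.φ 0 := fun t ht =>
    eq_of_hasDerivWithinAt_Ici_zero (fun t ht => (o.eq_φ t ht).congr_deriv
      (by rw [o.pφ_eq ht, hl, zero_div])) ht
  refine ⟨1, one_pos, fun t ht => o.position_eq ?_ 0 ?_⟩
  · rw [hc t ht, hc (t + 1) (by linarith)]
  · rw [hφ t ht, hφ (t + 1) (by linarith)]; simp

end NonsingularOrbit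

end SurfaceOfRevolution

/-! ### Sufficiency: both families of potentials have closed orbits. -/

namespace SurfaceOfRevolution

variable {S : SurfaceOfRevolution} {V : ℝ → ℝ} {m : ℝ} {q : ℝ} {Θ : ℝ → ℝ}

namespace IsNormalizedPrimitive

variable (hΘ : S.IsNormalizedPrimitive q Θ)
include hΘ

lemma deriv_f {u : ℝ} (hu : u ∈ S.dom) : deriv S.f u = -q * Θ u * S.f u := by
  rw [← (hΘ u hu).2, div_mul_cancel₀ _ (S.f_pos u hu).ne']

lemma strictMonoOn : StrictMonoOn Θ S.dom := by
  refine strictMonoOn_of_deriv_pos S.convex_dom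
    (fun u hu => (hΘ u hu).1.continuousAt.continuousWithinAt) fun u hu => ?_
  have hu' := interior_subset hu
  rw [(hΘ u hu').1.deriv]
  have := S.f_pos u hu'
  positivity

/-- This is `(f')² + K f² = q` with `f' = -q Θ f` inserted. It makes the angular velocity a
polynomial in `Θ`, which the closedness criterion requires. -/
lemma one_div_f_sq {K : ℝ} (hK : S.CurvatureEq K) (hq0 : 0 < q)
    (hq : S.SatisfiesProfileEquation q) {u : ℝ} (hu : u ∈ S.dom) :
    1 / S.f u ^ 2 = q * Θ u ^ 2 + K / q := by
  have h1 := hK.satisfiesProfileEquation_iff.1 hq u hu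
  rw [hΘ.deriv_f hu] at h1
  have := (S.f_pos u hu).ne'
  field_simp
  linear_combination -h1

lemma comp_orbit (o : S.NonsingularOrbit V m) {t : ℝ} (ht : 0 ≤ t) :
    HasDerivWithinAt (fun t => Θ (o.u t)) (1 / S.f (o.u t) ^ 2 * (o.pu t / m)) (Ici 0) t :=
  (hΘ _ (o.mem_dom t ht)).1.comp_hasDerivWithinAt t (o.eq_u t ht)

end IsNormalizedPrimitive

namespace NonsingularOrbit

variable (o : S.NonsingularOrbit V m)

/-- Binet's equation: `dΘ/dφ = p_u / l` and `d(p_u / l)/dφ = -β² (Θ + c)` with `c = m a / (l² β²)`,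
an oscillator of frequency `β` in the variable `φ`. -/
lemma closed_of_gravitational (hm : 0 < m) {K : ℝ} (hK : S.CurvatureEq K) {β : ℚ} (hβ : 0 < β)
    (hq : S.SatisfiesProfileEquation ((β : ℝ) ^ 2))
    (hΘ : S.IsNormalizedPrimitive ((β : ℝ) ^ 2) Θ) {a : ℝ}
    (hV : ∀ u ∈ S.dom, deriv V u = a / S.f u ^ 2) (ho : o.Bounded) (hl : o.pφ 0 ≠ 0) :
    o.Closed := by
  have hβ' : (0 : ℝ) < β := by exact_mod_cast hβ
  set l := o.pφ 0 with hldef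
  set c : ℝ := m * a / (l ^ 2 * β ^ 2) with hc
  obtain ⟨A, B, h⟩ := exists_eq_cos_add_sin (φ := o.φ) (X := fun t => Θ (o.u t) + c)
    (Y := fun t => o.pu t / l) (ν := fun t => l / (m * S.f (o.u t) ^ 2)) hβ'.ne'
    (fun t ht => (o.eq_φ t ht).congr_deriv (by rw [o.pφ_eq ht]))
    (fun t ht => ((hΘ.comp_orbit o ht).add_const c).congr_deriv (by
      have := (S.f_pos _ (o.mem_dom t ht)).ne'
      field_simp))
    (fun t ht => ((o.eq_pu t ht).div_const l).congr_deriv (by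
      have := (S.f_pos _ (o.mem_dom t ht)).ne'
      rw [o.pφ_eq ht, hV _ (o.mem_dom t ht), hΘ.deriv_f (o.mem_dom t ht), ← hldef, hc]
      field_simp
      ring))
  refine o.closed_of_eq_cos_add_sin hm ho hl (Ξ := fun u => Θ u + c)
    (P := fun x => (β : ℝ) ^ 2 * (x - c) ^ 2 + K / (β : ℝ) ^ 2) (by fun_prop)
    (fun u hu v hv huv => hΘ.strictMonoOn.injOn hu hv (by simpa using huv))
    (fun u hu => ?_) h
  rw [hΘ.one_div_f_sq hK (by positivity) hq hu, add_sub_cancel_right]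

/-- As for the planar oscillator, the square linearizes the motion: after elimination of `p_u²` by
energy conservation, `Θ² - c` is an oscillator in `φ` of frequency `β`, twice `√q`. -/
lemma closed_of_harmonic (hm : 0 < m) {K : ℝ} (hK : S.CurvatureEq K) {β : ℚ} (hβ : 0 < β)
    (hq : S.SatisfiesProfileEquation ((β : ℝ) ^ 2 / 4))
    (hΘ : S.IsNormalizedPrimitive ((β : ℝ) ^ 2 / 4) Θ) (hΘ0 : ∀ u ∈ S.dom, Θ u ≠ 0) {k : ℝ}
    (hV : ∀ u ∈ S.dom, deriv V u = -2 * k / (Θ u ^ 3 * S.f u ^ 2)) (ho : o.Bounded)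
    (hl : o.pφ 0 ≠ 0) : o.Closed := by
  have hβ' : (0 : ℝ) < β := by exact_mod_cast hβ
  set l := o.pφ 0 with hldef
  -- The conserved quantity is `2m` times the energy, up to an additive constant.
  have hE : ∀ t, 0 ≤ t → HasDerivWithinAt (fun t => o.pu t ^ 2 + l ^ 2 * (β ^ 2 / 4) * Θ (o.u t) ^ 2
      + 2 * m * k / Θ (o.u t) ^ 2) 0 (Ici 0) t := by
    intro t ht
    have h0 := hΘ0 _ (o.mem_dom t ht)
    have h1 := hΘ.comp_orbit o ht
    have h2 := (((o.eq_pu t ht).pow 2).add ((h1.pow 2).const_mul (l ^ 2 * (β ^ 2 / 4 : ℝ)))).add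
      ((hasDerivWithinAt_const t (Ici 0) (2 * m * k)).div (h1.pow 2) (pow_ne_zero 2 h0))
    refine h2.congr_deriv ?_
    have := (S.f_pos _ (o.mem_dom t ht)).ne'
    simp only [Pi.pow_apply]
    rw [o.pφ_eq ht, hV _ (o.mem_dom t ht), hΘ.deriv_f (o.mem_dom t ht), ← hldef]
    field_simp
    ring
  set e := o.pu 0 ^ 2 + l ^ 2 * (β ^ 2 / 4) * Θ (o.u 0) ^ 2 + 2 * m * k / Θ (o.u 0) ^ 2 with he
  have hE' : ∀ t, 0 ≤ t → o.pu t ^ 2 + l ^ 2 * (β ^ 2 / 4) * Θ (o.u t) ^ 2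
      + 2 * m * k / Θ (o.u t) ^ 2 = e := fun t ht => eq_of_hasDerivWithinAt_Ici_zero hE ht
  set c : ℝ := 2 * e / (l ^ 2 * β ^ 2) with hc
  obtain ⟨A, B, h⟩ := exists_eq_cos_add_sin (φ := o.φ) (X := fun t => Θ (o.u t) ^ 2 - c)
    (Y := fun t => 2 * Θ (o.u t) * o.pu t / l) (ν := fun t => l / (m * S.f (o.u t) ^ 2)) hβ'.ne'
    (fun t ht => (o.eq_φ t ht).congr_deriv (by rw [o.pφ_eq ht]))
    (fun t ht => (((hΘ.comp_orbit o ht).pow 2).sub_const c).congr_deriv (by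
      have := (S.f_pos _ (o.mem_dom t ht)).ne'
      field_simp
      norm_num; ring))
    (fun t ht => ((((hΘ.comp_orbit o ht).const_mul 2).mul (o.eq_pu t ht)).div_const l).congr_deriv
      (by
        have := (S.f_pos _ (o.mem_dom t ht)).ne'
        have h0 := hΘ0 _ (o.mem_dom t ht)
        rw [o.pφ_eq ht, hV _ (o.mem_dom t ht), hΘ.deriv_f (o.mem_dom t ht), ← hldef, hc,
          ← hE' t ht]
        field_simp
        ring))
  -- `Θ` has no zero on the connected domain, so it keeps its sign and its square is still
  -- injective.
  have hsgn : InjOn (fun u => Θ u ^ 2) S.dom := by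
    have hcont : ContinuousOn Θ S.dom := fun u hu => (hΘ u hu).1.continuousAt.continuousWithinAt
    intro u hu v hv huv
    rcases sq_eq_sq_iff_eq_or_eq_neg.1 huv with h1 | h1
    · exact hΘ.strictMonoOn.injOn hu hv h1
    · exfalso
      have hO := (S.isPreconnected_dom.image Θ hcont).ordConnected
      obtain ⟨w, hw, hw0⟩ : (0 : ℝ) ∈ Θ '' S.dom := by
        rcases le_total (Θ v) 0 with h2 | h2
        · exact hO.out (mem_image_of_mem Θ hv) (mem_image_of_mem Θ hu) ⟨h2, by linarith⟩
        · exact hO.out (mem_image_of_mem Θ hu) (mem_image_of_mem Θ hv) ⟨by linarith, h2⟩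
      exact hΘ0 w hw hw0
  refine o.closed_of_eq_cos_add_sin hm ho hl (Ξ := fun u => Θ u ^ 2 - c)
    (P := fun x => (β : ℝ) ^ 2 / 4 * (x + c) + K / ((β : ℝ) ^ 2 / 4)) (by fun_prop)
    (fun u hu v hv huv => hsgn hu hv (by simpa using huv))
    (fun u hu => ?_) h
  rw [hΘ.one_div_f_sq hK (by positivity) hq hu, sub_add_cancel]

lemma pu_eq_of_radial (hl : o.pφ 0 = 0) {t : ℝ} (ht : 0 ≤ t) :
    HasDerivWithinAt o.pu (-deriv V (o.u t)) (Ici 0) t :=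
  (o.eq_pu t ht).congr_deriv (by rw [o.pφ_eq ht, hl]; simp)

lemma circular_of_free (hm : 0 < m) {R : ℝ} (hR : ∀ t, 0 ≤ t → |o.u t| ≤ R)
    (hV : ∀ u ∈ S.dom, deriv V u = 0) (hl : o.pφ 0 = 0) : o.Circular := by
  have hpu : ∀ t, 0 ≤ t → o.pu t = o.pu 0 := fun t ht => eq_of_hasDerivWithinAt_Ici_zero
    (fun t ht => (o.pu_eq_of_radial hl ht).congr_deriv (by rw [hV _ (o.mem_dom t ht), neg_zero])) ht
  have h0 : o.pu 0 = 0 := by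
    by_contra h
    obtain ⟨t, ht, h1⟩ := exists_gt_of_hasDerivWithinAt (F := fun t => o.pu 0 * o.u t)
      (a := 0) (c := o.pu 0 ^ 2 / m) (by positivity) (fun t ht => (o.eq_u t ht).const_mul _)
      (fun t ht => by rw [hpu t ht]; apply le_of_eq; ring) (|o.pu 0| * R)
    have h2 := mul_le_mul_of_nonneg_left (hR t ht) (abs_nonneg (o.pu 0))
    rw [← abs_mul] at h2
    linarith [le_abs_self (o.pu 0 * o.u t)]
  exact fun t ht => eq_of_hasDerivWithinAt_Ici_zero
    (fun t ht => (o.eq_u t ht).congr_deriv (by rw [hpu t ht, h0, zero_div])) ht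

/-- A radial orbit would have acceleration `-a / (m f²)`, of constant sign and bounded away from `0`
because `f ≤ M`; `u` would then be unbounded. -/
lemma pφ_ne_zero_of_gravitational (hm : 0 < m) (ho : o.Bounded) {R : ℝ}
    (hR : ∀ t, 0 ≤ t → |o.u t| ≤ R) {a : ℝ} (ha : a ≠ 0)
    (hV : ∀ u ∈ S.dom, deriv V u = a / S.f u ^ 2) : o.pφ 0 ≠ 0 := by
  intro hl
  obtain ⟨M, hM0, hM⟩ := o.exists_f_le ho
  obtain ⟨t, ht, h1⟩ := exists_gt_of_hasDerivWithinAt_two (w := fun t => -a * o.u t)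
    (p := fun t => -a * (o.pu t / m)) (c := a ^ 2 / (m * M ^ 2)) (by positivity)
    (fun t ht => (o.eq_u t ht).const_mul _)
    (fun t ht => ((o.pu_eq_of_radial hl ht).div_const m).const_mul _)
    (fun t ht => by
      rw [hV _ (o.mem_dom t ht)]
      have := S.f_pos _ (o.mem_dom t ht)
      have := hM t ht
      calc a ^ 2 / (m * M ^ 2) ≤ a ^ 2 / (m * S.f (o.u t) ^ 2) := by gcongr
        _ = _ := by field_simp) (|a| * R)
  have h2 := mul_le_mul_of_nonneg_left (hR t ht) (abs_nonneg a)
  rw [← abs_mul] at h2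
  linarith [neg_abs_le (a * o.u t)]

/-- For a radial orbit the force pushes away from `Θ = 0`. Once the momentum points that way, `u`
escapes linearly. If it never did, the orbit would move towards `Θ = 0`, where the force does not
decay, and the momentum would have to change sign. -/
lemma pφ_ne_zero_of_harmonic (hm : 0 < m) {R : ℝ} (hR : ∀ t, 0 ≤ t → |o.u t| ≤ R) (hq : 0 < q)
    (hΘ : S.IsNormalizedPrimitive q Θ) (hΘ0 : ∀ u ∈ S.dom, Θ u ≠ 0) {k : ℝ} (hk : 0 < k)
    (hV : ∀ u ∈ S.dom, deriv V u = -2 * k / (Θ u ^ 3 * S.f u ^ 2)) : o.pφ 0 ≠ 0 := by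
  intro hl
  have hcont : ContinuousOn Θ S.dom := fun u hu => (hΘ u hu).1.continuousAt.continuousWithinAt
  obtain ⟨σ, hσ1, hσ⟩ : ∃ σ : ℝ, |σ| = 1 ∧ ∀ u ∈ S.dom, 0 < σ * Θ u := by
    have hO := (S.isPreconnected_dom.image Θ hcont).ordConnected
    have h0 : (0 : ℝ) ∉ Θ '' S.dom := by
      rintro ⟨w, hw, hw0⟩
      exact hΘ0 w hw hw0
    by_cases h : ∀ u ∈ S.dom, 0 < Θ u
    · exact ⟨1, by simp, by simpa using h⟩
    · push Not at h
      obtain ⟨v, hv, hv0⟩ := h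
      refine ⟨-1, by simp, fun u hu => ?_⟩
      by_contra! hu0
      exact h0 (hO.out (mem_image_of_mem Θ hv) (mem_image_of_mem Θ hu) ⟨hv0, by linarith⟩)
  have hσ2 : σ ^ 2 = 1 := by rw [← sq_abs, hσ1, one_pow]
  have hacc : ∀ u ∈ S.dom, σ * (2 * k / (Θ u ^ 3 * S.f u ^ 2)) =
      2 * k / ((σ * Θ u) ^ 3 * S.f u ^ 2) := by
    intro u hu
    have h1 := hΘ0 u hu
    have h2 := (S.f_pos u hu).ne'
    have h3 : σ ≠ 0 := by rintro rfl; simp at hσ1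
    field_simp
    linear_combination (σ ^ 2 + 1) * hσ2
  have hp : ∀ t, 0 ≤ t → HasDerivWithinAt (fun t => σ * o.pu t)
      (2 * k / ((σ * Θ (o.u t)) ^ 3 * S.f (o.u t) ^ 2)) (Ici 0) t := fun t ht =>
    ((o.pu_eq_of_radial hl ht).const_mul σ).congr_deriv (by
      rw [hV _ (o.mem_dom t ht), ← hacc _ (o.mem_dom t ht)]; ring)
  have hpos : ∀ t, 0 ≤ t → 0 < 2 * k / ((σ * Θ (o.u t)) ^ 3 * S.f (o.u t) ^ 2) := by
    intro t ht
    have h1 := hσ _ (o.mem_dom t ht)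
    have h2 := S.f_pos _ (o.mem_dom t ht)
    positivity
  have hmono := monotoneOn_Ici_of_hasDerivWithinAt hp fun t ht => (hpos t ht).le
  by_cases hneg : ∃ a, 0 ≤ a ∧ 0 < σ * o.pu a
  · obtain ⟨a, ha, hpa⟩ := hneg
    obtain ⟨t, ht, h1⟩ := exists_gt_of_hasDerivWithinAt (F := fun t => σ * o.u t)
      (a := a) (c := σ * o.pu a / m) (by positivity)
      (fun t ht => ((o.eq_u t (ha.trans ht)).mono (Ici_subset_Ici.2 ha)).const_mul _)
      (fun t ht => by
        rw [← mul_div_assoc]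
        have := hmono ha (ha.trans ht) ht
        simp only at this
        gcongr) R
    have h2 := hR t (ha.trans ht)
    have h3 := le_abs_self (σ * o.u t)
    rw [abs_mul, hσ1, one_mul] at h3
    linarith
  · push Not at hneg
    have hf : MonotoneOn (fun t => S.f (o.u t)) (Ici 0) :=
      monotoneOn_Ici_of_hasDerivWithinAt
        (F' := fun t => deriv S.f (o.u t) * (o.pu t / m))
        (fun t ht => (hasDerivAt_f (o.mem_dom t ht)).comp_hasDerivWithinAt t (o.eq_u t ht))
        (fun t ht => by
          rw [hΘ.deriv_f (o.mem_dom t ht)]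
          have h1 := hσ _ (o.mem_dom t ht)
          have h2 := S.f_pos _ (o.mem_dom t ht)
          have h3 := hneg t ht
          have : -q * Θ (o.u t) * S.f (o.u t) * (o.pu t / m) =
              q * S.f (o.u t) / m * ((σ * Θ (o.u t)) * -(σ * o.pu t)) := by
            field_simp
            linear_combination (Θ (o.u t) * o.pu t) * hσ2
          rw [this]
          exact mul_nonneg (by positivity) (mul_nonneg h1.le (by linarith)))
    have h0 := S.f_pos _ (o.mem_dom 0 le_rfl)
    -- Unit speed gives `q |Θ| f = |f'| ≤ 1`, and `f` is nondecreasing along the orbit, so `2k /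
    -- (|Θ|³ f²) ≥ 2k q³ f ≥ 2k q³ f(u(0))`.
    obtain ⟨t, ht, h1⟩ := exists_gt_of_hasDerivWithinAt (c := 2 * k * q ^ 3 * S.f (o.u 0))
      (by positivity) hp (fun t ht => by
        have h1 := hσ _ (o.mem_dom t ht)
        have h2 := S.f_pos _ (o.mem_dom t ht)
        have h3 : S.f (o.u 0) ≤ S.f (o.u t) := hf (mem_Ici.2 le_rfl) ht ht
        have h4 := abs_deriv_f_le_one (o.mem_dom t ht)
        have h5 : |deriv S.f (o.u t)| = q * (σ * Θ (o.u t)) * S.f (o.u t) := by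
          rw [hΘ.deriv_f (o.mem_dom t ht), abs_mul, abs_mul, abs_neg, abs_of_pos hq,
            abs_of_pos h2, ← abs_of_pos h1, abs_mul, hσ1, one_mul]
        rw [h5] at h4
        have h6 : (q * (σ * Θ (o.u t)) * S.f (o.u t)) ^ 3 ≤ 1 := pow_le_one₀ (by positivity) h4
        rw [le_div_iff₀ (by positivity)]
        calc 2 * k * q ^ 3 * S.f (o.u 0) * ((σ * Θ (o.u t)) ^ 3 * S.f (o.u t) ^ 2)
            ≤ 2 * k * q ^ 3 * S.f (o.u t) * ((σ * Θ (o.u t)) ^ 3 * S.f (o.u t) ^ 2) := by gcongr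
          _ = 2 * k * (q * (σ * Θ (o.u t)) * S.f (o.u t)) ^ 3 := by ring
          _ ≤ 2 * k := by nlinarith) 0
    linarith [hneg t ht]

end NonsingularOrbit

lemma hasDerivAt_effectivePotential {l u : ℝ} (hu : u ∈ S.dom) (hm : m ≠ 0)
    (hV : DifferentiableAt ℝ V u) :
    HasDerivAt (S.effectivePotential V m l)
      (-(l ^ 2 * deriv S.f u / (m * S.f u ^ 3)) + deriv V u) u := by
  have h := (S.f_pos u hu).ne'
  have := ((hasDerivAt_const u (l ^ 2)).div (((hasDerivAt_f hu).pow 2).const_mul (2 * m))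
    (by simp [h, hm])).add hV.hasDerivAt
  refine this.congr_deriv ?_
  simp only [Pi.pow_apply]
  field_simp
  ring

theorem allBoundedOrbitsClosed_of_gravitational (hS : S.HasConstantCurvature) (hm : 0 < m) {β : ℚ}
    (hβ : 0 < β) (hq : S.SatisfiesProfileEquation ((β : ℝ) ^ 2))
    (hV : S.IsGravitational ((β : ℝ) ^ 2) V) : S.AllBoundedOrbitsClosed V m := by
  obtain ⟨K, hK⟩ := hS.exists_deriv_deriv
  replace hK : S.CurvatureEq K := hK
  obtain ⟨Θ, hΘ, a, C, hV⟩ := hV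
  have hβ' : (0 : ℝ) < β := by exact_mod_cast hβ
  have hdV : ∀ u ∈ S.dom, deriv V u = a / S.f u ^ 2 := fun u hu => by
    have h1 := ((hΘ u hu).1.const_mul a).add_const C
    rw [(h1.congr_of_eventuallyEq (eventually_of_mem (dom_mem_nhds hu) hV)).deriv,
      mul_one_div]
  intro o ho
  obtain ⟨R, hR⟩ := o.exists_abs_le hK (by positivity) hq ho
  by_cases hl : o.pφ 0 = 0
  · have ha : a = 0 := by
      by_contra ha
      exact o.pφ_ne_zero_of_gravitational hm ho hR ha hdV hl
    exact o.closed_of_circular_of_radial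
      (o.circular_of_free hm hR (fun u hu => by rw [hdV u hu, ha, zero_div]) hl) hl
  · exact o.closed_of_gravitational hm hK hβ hq hΘ hdV ho hl

theorem allBoundedOrbitsClosed_of_harmonic (hS : S.HasConstantCurvature) (hm : 0 < m)
    (hmin : ∃ l : ℝ, ∃ u₀ ∈ S.dom, IsLocalMin (S.effectivePotential V m l) u₀) {β : ℚ}
    (hβ : 0 < β) (hq : S.SatisfiesProfileEquation ((β : ℝ) ^ 2 / 4))
    (hV : S.IsHarmonic ((β : ℝ) ^ 2 / 4) V) : S.AllBoundedOrbitsClosed V m := by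
  obtain ⟨K, hK⟩ := hS.exists_deriv_deriv
  replace hK : S.CurvatureEq K := hK
  obtain ⟨Θ, hΘ, hΘ0, k, C, hV⟩ := hV
  have hβ' : (0 : ℝ) < β := by exact_mod_cast hβ
  have hdV : ∀ u ∈ S.dom, HasDerivAt V (-2 * k / (Θ u ^ 3 * S.f u ^ 2)) u := fun u hu => by
    have h1 := ((hasDerivAt_const u k).div ((hΘ u hu).1.pow 2) (pow_ne_zero 2 (hΘ0 u hu))).add_const
      C
    refine (h1.congr_of_eventuallyEq (eventually_of_mem (dom_mem_nhds hu) hV)).congr_deriv ?_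
    have := hΘ0 u hu
    have := (S.f_pos u hu).ne'
    simp only [Pi.pow_apply]
    field_simp
    ring
  -- The equation of the critical point is `l² (β²/4) Θ⁴ = 2 m k`, which excludes a repulsive sign
  -- of `k`.
  have hk : 0 ≤ k := by
    obtain ⟨l, u, hu, hloc⟩ := hmin
    have h1 := hloc.hasDerivAt_eq_zero
      (hasDerivAt_effectivePotential hu hm.ne' (hdV u hu).differentiableAt)
    rw [(hdV u hu).deriv, hΘ.deriv_f hu] at h1
    have h2 := hΘ0 u hu
    have h3 := (S.f_pos u hu).ne'
    field_simp at h1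
    by_contra! hk
    have h4 : 0 < m * -k := mul_pos hm (by linarith)
    have h5 : 0 ≤ l ^ 2 * (β : ℝ) ^ 2 * Θ u ^ 4 := by positivity
    nlinarith
  intro o ho
  obtain ⟨R, hR⟩ := o.exists_abs_le hK (by positivity) hq ho
  by_cases hl : o.pφ 0 = 0
  · rcases hk.eq_or_lt with hk | hk
    · exact o.closed_of_circular_of_radial
        (o.circular_of_free hm hR (fun u hu => by rw [(hdV u hu).deriv, ← hk]; simp) hl) hl
    · exact absurd hl (o.pφ_ne_zero_of_harmonic hm hR (by positivity) hΘ hΘ0 hk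
        fun u hu => (hdV u hu).deriv)
  · exact o.closed_of_harmonic hm hK hβ hq hΘ hΘ0 (fun u hu => (hdV u hu).deriv) ho hl

end SurfaceOfRevolution

/-! ### The librations in a well and their apsidal angle. -/

/-- The inverse of the primitive of a continuous function that is bounded below by a positive
constant: a global solution of `τ' = 1 / a(τ)`, `τ 0 = 0`. -/
lemma exists_hasDerivAt_one_div {a : ℝ → ℝ} (ha : Continuous a) {c : ℝ} (hc : 0 < c)
    (hca : ∀ x, c ≤ a x) :
    ∃ τ : ℝ → ℝ, τ 0 = 0 ∧ StrictMono τ ∧ ∀ s, HasDerivAt τ (1 / a (τ s)) s := by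
  set F : ℝ → ℝ := fun x => ∫ s in (0 : ℝ)..x, a s with hF
  have hder : ∀ x, HasDerivAt F (a x) x := fun x =>
    intervalIntegral.integral_hasDerivAt_right (ha.intervalIntegrable _ _)
      (ha.stronglyMeasurableAtFilter _ _) ha.continuousAt
  have hmono : StrictMono F := strictMono_of_deriv_pos fun x => by
    rw [(hder x).deriv]; exact hc.trans_le (hca x)
  have hcont : Continuous F := continuous_iff_continuousAt.2 fun x => (hder x).continuousAt
  have hmono2 : Monotone fun x => F x - c * x := monotone_of_deriv_nonneg
    (fun x => ((hder x).sub ((hasDerivAt_id x).const_mul c)).differentiableAt) fun x => by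
      have := ((hder x).sub ((hasDerivAt_id x).const_mul c)).deriv
      simp only [mul_one] at this
      exact (sub_nonneg.2 (hca x)).trans this.ge
  have hF0 : F 0 = 0 := intervalIntegral.integral_same
  have htop : Tendsto F atTop atTop := tendsto_atTop_mono' atTop
    ((eventually_ge_atTop 0).mono fun x hx => by
      have := hmono2 hx
      simp only [hF0] at this
      linarith : ∀ᶠ x in atTop, c * x ≤ F x) (tendsto_id.const_mul_atTop hc)
  have hbot : Tendsto F atBot atBot := tendsto_atBot_mono' atBot
    ((eventually_le_atBot 0).mono fun x hx => by
      have := hmono2 hx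
      simp only [hF0] at this
      linarith : ∀ᶠ x in atBot, F x ≤ c * x) (tendsto_id.const_mul_atBot hc)
  set e : ℝ ≃o ℝ := hmono.orderIsoOfSurjective F (hcont.surjective htop hbot) with he
  have hFe : ∀ s, F (e.symm s) = s := fun s => e.apply_symm_apply s
  refine ⟨e.symm, ?_, e.symm.strictMono, fun s => ?_⟩
  · apply hmono.injective
    rw [hFe, hF0]
  · rw [one_div]
    exact HasDerivAt.of_local_left_inverse e.symm.continuous.continuousAt (hder _)
      (hc.trans_le (hca _)).ne' (Eventually.of_forall hFe)

lemma abs_mul_sin_lt {A δ : ℝ} (hA : |A| < δ) (s : ℝ) : |A * Real.sin s| < δ := by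
  rw [abs_mul]
  exact (mul_le_of_le_one_right (abs_nonneg _) (Real.abs_sin_le_one s)).trans_lt hA

namespace SurfaceOfRevolution

variable {S : SurfaceOfRevolution} {V : ℝ → ℝ} {m : ℝ}

namespace NonsingularOrbit

variable (o : S.NonsingularOrbit V m)

/-- A point of the surface off the axis determines `f`, `g` and the angle modulo `2π`; constant
curvature excludes tori, so `(f, g)` determines `u`. Differentiating the periodicity of `u` gives
that of `p_u`. -/
lemma Closed.exists_period {o : S.NonsingularOrbit V m} (h : o.Closed) {K : ℝ}
    (hK : S.CurvatureEq K) (hm : m ≠ 0) :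
    ∃ T, 0 < T ∧ ∀ t, 0 ≤ t → o.u (t + T) = o.u t ∧ o.pu (t + T) = o.pu t ∧
      ∃ k : ℤ, o.φ (t + T) - o.φ t = 2 * Real.pi * k := by
  obtain ⟨T, hT, hpos⟩ := h
  have hstep : ∀ t, 0 ≤ t → S.f (o.u (t + T)) = S.f (o.u t) ∧ o.u (t + T) = o.u t := by
    intro t ht
    have h0 : S.f (o.u (t + T)) * Real.cos (o.φ (t + T)) = S.f (o.u t) * Real.cos (o.φ t) :=
      congrFun (hpos t ht) 0
    have h1 : S.f (o.u (t + T)) * Real.sin (o.φ (t + T)) = S.f (o.u t) * Real.sin (o.φ t) :=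
      congrFun (hpos t ht) 1
    have h2 : S.g (o.u (t + T)) = S.g (o.u t) := congrFun (hpos t ht) 2
    have hd := o.mem_dom t ht
    have hd' := o.mem_dom (t + T) (by linarith)
    have hf : S.f (o.u (t + T)) = S.f (o.u t) := by
      rw [← sq_eq_sq₀ (S.f_pos _ hd').le (S.f_pos _ hd).le]
      have e1 := Real.sin_sq_add_cos_sq (o.φ (t + T))
      have e2 := Real.sin_sq_add_cos_sq (o.φ t)
      calc S.f (o.u (t + T)) ^ 2 = (S.f (o.u (t + T)) * Real.cos (o.φ (t + T))) ^ 2 +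
            (S.f (o.u (t + T)) * Real.sin (o.φ (t + T))) ^ 2 := by
            linear_combination (-S.f (o.u (t + T)) ^ 2) * e1
        _ = S.f (o.u t) ^ 2 := by
            rw [h0, h1]; linear_combination (S.f (o.u t) ^ 2) * e2
    exact ⟨hf, hK.injOn_profile hd' hd (Prod.ext hf h2)⟩
  refine ⟨T, hT, fun t ht => ⟨(hstep t ht).2, ?_, ?_⟩⟩
  · have h1 : HasDerivWithinAt (fun t => o.u (t + T)) (o.pu (t + T) / m * 1) (Ici 0) t :=
      (o.eq_u (t + T) (by linarith)).comp t ((hasDerivWithinAt_id t _).add_const T)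
        fun x hx => add_nonneg hx hT.le
    have h2 := h1.congr (fun x hx => ((hstep x hx).2).symm) ((hstep t ht).2).symm
    have h3 := (uniqueDiffOn_Ici (0 : ℝ) t ht).eq_deriv _ h2 (o.eq_u t ht)
    field_simp at h3
    exact h3
  · have hd := o.mem_dom t ht
    have h0 : S.f (o.u (t + T)) * Real.cos (o.φ (t + T)) = S.f (o.u t) * Real.cos (o.φ t) :=
      congrFun (hpos t ht) 0
    have h1 : S.f (o.u (t + T)) * Real.sin (o.φ (t + T)) = S.f (o.u t) * Real.sin (o.φ t) :=
      congrFun (hpos t ht) 1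
    rw [(hstep t ht).1] at h0 h1
    have hne := (S.f_pos _ hd).ne'
    exact Real.Angle.angle_eq_iff_two_pi_dvd_sub.1 (Real.Angle.cos_sin_inj
      (mul_left_cancel₀ hne h0) (mul_left_cancel₀ hne h1))

lemma bounded_of_isCompact {k : Set ℝ} (hk : IsCompact k) (hkS : k ⊆ S.dom)
    (h : ∀ t, 0 ≤ t → o.u t ∈ k) : o.Bounded := by
  have hf : ContinuousOn S.f k := fun u hu =>
    (hasDerivAt_f (hkS hu)).continuousAt.continuousWithinAt
  have hg : ContinuousOn S.g k := fun u hu =>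
    (hasDerivAt_g (hkS hu)).continuousAt.continuousWithinAt
  obtain ⟨M, hM⟩ := hk.exists_bound_of_continuousOn hf
  obtain ⟨N, hN⟩ := hk.exists_bound_of_continuousOn hg
  refine isBounded_iff_forall_norm_le.2 ⟨max M N, ?_⟩
  rintro _ ⟨t, ht, rfl⟩
  have hM' := hM _ (h t ht)
  have hN' := hN _ (h t ht)
  have hM0 := (norm_nonneg _).trans hM'
  refine (pi_norm_le_iff_of_nonneg (hM0.trans (le_max_left _ _))).2 fun i => ?_
  fin_cases i
  · change ‖S.f (o.u t) * Real.cos (o.φ t)‖ ≤ _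
    rw [norm_mul]
    exact (mul_le_of_le_one_right (norm_nonneg _) (Real.abs_cos_le_one _)).trans
      (hM'.trans (le_max_left _ _))
  · change ‖S.f (o.u t) * Real.sin (o.φ t)‖ ≤ _
    rw [norm_mul]
    exact (mul_le_of_le_one_right (norm_nonneg _) (Real.abs_sin_le_one _)).trans
      (hM'.trans (le_max_left _ _))
  · exact hN'.trans (le_max_right _ _)

end NonsingularOrbit

/-- A coordinate `y = η⁻¹(u)` on an interval `|y| < δ` in which the effective potential is
`W(u₀) + l² y² / (2 m)`. -/
structure IsWellChart (S : SurfaceOfRevolution) (V : ℝ → ℝ) (m l : ℝ) (η : ℝ → ℝ) (δ : ℝ) :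
    Prop where
  pos : 0 < δ
  analyticAt : ∀ y, |y| < δ → AnalyticAt ℝ η y
  deriv_pos : ∀ y, |y| < δ → 0 < deriv η y
  mem_dom : ∀ y, |y| < δ → η y ∈ S.dom
  potential_eq : ∀ y, |y| < δ →
    S.effectivePotential V m l (η y) = S.effectivePotential V m l (η 0) + l ^ 2 / (2 * m) * y ^ 2

/-- The density `dθ / dy` of the coordinate `θ = ∫ du / f²` in the chart `u = η y`. -/
noncomputable def chartDensity (S : SurfaceOfRevolution) (η : ℝ → ℝ) (y : ℝ) : ℝ :=
  deriv η y / S.f (η y) ^ 2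

namespace IsWellChart

variable {l δ : ℝ} {η : ℝ → ℝ} (h : S.IsWellChart V m l η δ)
include h

lemma deriv_potential (hV : AnalyticOnNhd ℝ V S.dom) (hm : m ≠ 0) {y : ℝ} (hy : |y| < δ) :
    (-(l ^ 2 * deriv S.f (η y) / (m * S.f (η y) ^ 3)) + deriv V (η y)) * deriv η y =
      l ^ 2 / m * y := by
  have h1 := (hasDerivAt_effectivePotential (l := l) (h.mem_dom y hy) hm
    (hV _ (h.mem_dom y hy)).differentiableAt).comp y (h.analyticAt y hy).differentiableAt.hasDerivAt
  have h2 : HasDerivAt (fun y => S.effectivePotential V m l (η 0) + l ^ 2 / (2 * m) * y ^ 2)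
      (l ^ 2 / m * y) y := by
    refine ((((hasDerivAt_id y).pow 2).const_mul (l ^ 2 / (2 * m))).const_add _).congr_deriv ?_
    simp; ring
  have h3 : {y : ℝ | |y| < δ} ∈ 𝓝 y := (isOpen_lt continuous_abs continuous_const).mem_nhds hy
  exact h1.unique (h2.congr_of_eventuallyEq (eventually_of_mem h3 h.potential_eq))

lemma continuousAt_chartDensity {y : ℝ} (hy : |y| < δ) : ContinuousAt (S.chartDensity η) y := by
  have h1 := (h.analyticAt y hy)
  have hf := (hasDerivAt_f (h.mem_dom y hy)).continuousAt
  exact h1.deriv.continuousAt.div ((ContinuousAt.comp hf h1.continuousAt).pow 2)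
    (pow_ne_zero 2 (S.f_pos _ (h.mem_dom y hy)).ne')

lemma continuous_chartDensity_sin {A : ℝ} (hA : |A| < δ) :
    Continuous fun s => S.chartDensity η (A * Real.sin s) :=
  continuous_iff_continuousAt.2 fun s =>
    ContinuousAt.comp (f := fun s => A * Real.sin s)
      (h.continuousAt_chartDensity (abs_mul_sin_lt hA s)) (by fun_prop)

/-- If bounded orbits are closed, the apsidal angle of the orbit of amplitude `A` is a rational
multiple of `π`. -/
lemma exists_rat_integral_eq {K : ℝ} (hK : S.CurvatureEq K) (hV : AnalyticOnNhd ℝ V S.dom)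
    (hm : 0 < m) (hl : 0 < l) (hclosed : S.AllBoundedOrbitsClosed V m) {A : ℝ} (hA0 : 0 < A)
    (hA : A < δ) :
    ∃ r : ℚ, ∫ s in (0 : ℝ)..(2 * Real.pi), S.chartDensity η (A * Real.sin s) =
      2 * Real.pi * r := by
  have hA' : |A| < δ := by rwa [abs_of_pos hA0]
  have hsin := abs_mul_sin_lt hA'
  have hcη : Continuous fun s => deriv η (A * Real.sin s) :=
    continuous_iff_continuousAt.2 fun s =>
      ContinuousAt.comp (f := fun s => A * Real.sin s)
        (h.analyticAt _ (hsin s)).deriv.continuousAt (by fun_prop)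
  obtain ⟨c, hc, hca⟩ : ∃ c, 0 < c ∧ ∀ s, c ≤ m / l * deriv η (A * Real.sin s) := by
    obtain ⟨y₀, hy₀, hmin⟩ := (isCompact_Icc (a := -A) (b := A)).exists_isMinOn
      ⟨0, by constructor <;> linarith⟩ (f := deriv η) fun y hy =>
        (h.analyticAt y ((abs_le.2 hy).trans_lt hA)).deriv.continuousAt.continuousWithinAt
    have hpos := h.deriv_pos y₀ ((abs_le.2 hy₀).trans_lt hA)
    refine ⟨m / l * deriv η y₀, by positivity, fun s => ?_⟩
    have : deriv η y₀ ≤ deriv η (A * Real.sin s) := hmin (by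
      have := Real.neg_one_le_sin s
      have := Real.sin_le_one s
      constructor <;> nlinarith)
    gcongr
  -- `τ` is an eccentric anomaly: with `y = A sin τ` the energy relation gives `p_u = l A cos τ`,
  -- and `u' = p_u / m` then dictates `τ' = l / (m η'(y))`.
  obtain ⟨τ, hτ0, hτm, hτ⟩ :=
    exists_hasDerivAt_one_div (a := fun s => m / l * deriv η (A * Real.sin s))
    (by fun_prop) hc hca
  have hHc := h.continuous_chartDensity_sin hA'
  have hint : ∀ x, HasDerivAt (fun x => ∫ s in (0 : ℝ)..x, S.chartDensity η (A * Real.sin s))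
      (S.chartDensity η (A * Real.sin x)) x := fun x =>
    intervalIntegral.integral_hasDerivAt_right (hHc.intervalIntegrable _ _)
      (hHc.stronglyMeasurableAtFilter _ _) hHc.continuousAt
  let o : S.NonsingularOrbit V m :=
    { u := fun t => η (A * Real.sin (τ t))
      φ := fun t => ∫ s in (0 : ℝ)..τ t, S.chartDensity η (A * Real.sin s)
      pu := fun t => l * A * Real.cos (τ t)
      pφ := fun _ => l
      mem_dom := fun t _ => h.mem_dom _ (hsin _)
      eq_u := fun t _ => by
        have h1 := (h.analyticAt _ (hsin (τ t))).differentiableAt.hasDerivAt.comp t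
          ((hτ t).sin.const_mul A)
        refine (h1.congr_deriv ?_).hasDerivWithinAt
        have := (h.deriv_pos _ (hsin (τ t))).ne'
        field_simp
      eq_φ := fun t _ => by
        have h1 := (hint (τ t)).comp t (hτ t)
        refine (h1.congr_deriv ?_).hasDerivWithinAt
        have := (h.deriv_pos _ (hsin (τ t))).ne'
        rw [chartDensity]
        field_simp
      eq_pu := fun t _ => by
        have h1 := (hτ t).cos.const_mul (l * A)
        refine (h1.congr_deriv ?_).hasDerivWithinAt
        have h2 := (h.deriv_pos _ (hsin (τ t))).ne'
        have h3 := h.deriv_potential hV hm.ne' (hsin (τ t))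
        have h4 : l ^ 2 * deriv S.f (η (A * Real.sin (τ t))) /
            (m * S.f (η (A * Real.sin (τ t))) ^ 3) - deriv V (η (A * Real.sin (τ t))) =
            -(l ^ 2 / m * (A * Real.sin (τ t))) / deriv η (A * Real.sin (τ t)) := by
          rw [eq_div_iff h2, ← h3]; ring
        rw [h4]
        field_simp
      eq_pφ := fun t _ => hasDerivWithinAt_const t _ l }
  have hob : o.Bounded := o.bounded_of_isCompact
    ((isCompact_Icc (a := -A) (b := A)).image_of_continuousOn (f := η) fun y hy =>
      (h.analyticAt y ((abs_le.2 hy).trans_lt hA)).continuousAt.continuousWithinAt)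
    (by
      rintro _ ⟨y, hy, rfl⟩
      exact h.mem_dom y ((abs_le.2 hy).trans_lt hA))
    (fun t _ => ⟨_, by
      have := Real.neg_one_le_sin (τ t)
      have := Real.sin_le_one (τ t)
      constructor <;> nlinarith, rfl⟩)
  obtain ⟨T, hT, hper⟩ := (hclosed o hob).exists_period hK hm.ne'
  obtain ⟨-, hpu, j, hj⟩ := hper 0 le_rfl
  rw [zero_add] at hpu hj
  -- Return of the momentum to its maximum means `τ(T) = 2πn`. The total angle `2πj` is then `n`
  -- times the integral over one period, so the rational number is `j / n`.
  have hcos : Real.cos (τ T) = 1 := by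
    have : l * A * Real.cos (τ T) = l * A * Real.cos (τ 0) := hpu
    rw [hτ0, Real.cos_zero] at this
    exact mul_left_cancel₀ (by positivity) this
  obtain ⟨n, hn⟩ := (Real.cos_eq_one_iff _).1 hcos
  have hn0 : (n : ℝ) ≠ 0 := by
    intro h0
    rw [h0, zero_mul] at hn
    have := hτm hT
    rw [hτ0, ← hn] at this
    exact lt_irrefl _ this
  have hj' : (∫ s in (0 : ℝ)..τ T, S.chartDensity η (A * Real.sin s)) -
      (∫ s in (0 : ℝ)..τ 0, S.chartDensity η (A * Real.sin s)) = 2 * Real.pi * j := hj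
  have hP : Function.Periodic (fun s => S.chartDensity η (A * Real.sin s)) (2 * Real.pi) :=
    fun s => by simp
  have hnint := hP.intervalIntegral_add_zsmul_eq n 0
    (fun a b => hHc.intervalIntegrable a b)
  rw [hτ0, intervalIntegral.integral_same, sub_zero, ← hn] at hj'
  simp only [zero_add, zsmul_eq_mul] at hnint
  rw [hj'] at hnint
  refine ⟨j / n, ?_⟩
  push_cast
  field_simp
  linarith

end IsWellChart

end SurfaceOfRevolution

/-! ### Rational-valued families, circular means and Morse coordinates. -/

lemma eq_of_forall_exists_rat {X : Type*} [TopologicalSpace X] {F : X → ℝ} {s : Set X}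
    (hs : IsPreconnected s) (hF : ContinuousOn F s) (h : ∀ x ∈ s, ∃ r : ℚ, F x = r) {x y : X}
    (hx : x ∈ s) (hy : y ∈ s) : F x = F y := by
  -- The image of `s` is preconnected and lies in a countable, hence totally disconnected, set.
  have hc : (range ((↑) : ℚ → ℝ)).Countable := countable_range _
  refine hc.isTotallyDisconnected (F '' s) ?_ (hs.image F hF) (mem_image_of_mem F hx)
    (mem_image_of_mem F hy)
  rintro _ ⟨z, hz, rfl⟩
  obtain ⟨r, hr⟩ := h z hz
  exact ⟨r, hr.symm⟩

lemma continuous_integral_mul_sin {G : ℝ → ℝ} (hG : Continuous G) :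
    Continuous fun A => ∫ s in (0 : ℝ)..(2 * Real.pi), G (A * Real.sin s) :=
  intervalIntegral.continuous_parametric_intervalIntegral_of_continuous' (by fun_prop) _ _

/-- If the circular means `A ↦ ∫ G(A sin s) ds` are rational multiples of `2π`, they are
constant. -/
lemma integral_mul_sin_eq_of_rat {G : ℝ → ℝ} (hG : Continuous G) {d : ℝ}
    (h : ∀ A, 0 < A → A < d → ∃ r : ℚ, ∫ s in (0 : ℝ)..(2 * Real.pi), G (A * Real.sin s) =
      2 * Real.pi * r) {A : ℝ} (hA0 : 0 < A) (hA : A < d) :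
    ∫ s in (0 : ℝ)..(2 * Real.pi), G (A * Real.sin s) = 2 * Real.pi * G 0 := by
  have hc := continuous_integral_mul_sin hG
  set Φ := fun A => ∫ s in (0 : ℝ)..(2 * Real.pi), G (A * Real.sin s) with hΦ
  have hΦ0 : Φ 0 = 2 * Real.pi * G 0 := by simp [hΦ]
  have hconst : ∀ B ∈ Ioo 0 d, Φ B = Φ A := by
    intro B hB
    have := eq_of_forall_exists_rat (F := fun A => Φ A / (2 * Real.pi)) (s := Ioo 0 d)
      isPreconnected_Ioo (hc.div_const _).continuousOn (fun x hx => by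
        obtain ⟨r, hr⟩ := h x hx.1 hx.2
        exact ⟨r, by simp only [hΦ, hr]; field_simp⟩) hB ⟨hA0, hA⟩
    field_simp at this
    exact this
  have h1 : Tendsto Φ (𝓝[>] 0) (𝓝 (Φ 0)) := hc.continuousAt.mono_left nhdsWithin_le_nhds
  have h2 : Tendsto Φ (𝓝[>] 0) (𝓝 (Φ A)) := tendsto_const_nhds.congr'
    (eventually_of_mem (Ioo_mem_nhdsGT (hA0.trans hA)) fun B hB => (hconst B hB).symm)
  change Φ A = _
  rw [← hΦ0]
  exact tendsto_nhds_unique h2 h1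

/-- An even function that is analytic at `0`, vanishes there, and has vanishing circular means,
vanishes near `0`. -/
lemma AnalyticAt.eventually_eq_zero_of_integral_mul_sin {E : ℝ → ℝ} (hE : AnalyticAt ℝ E 0)
    (heven : ∀ y, E (-y) = E y) (h0 : E 0 = 0) {d : ℝ} (hd : 0 < d)
    (hcont : ∀ y, |y| < d → ContinuousAt E y)
    (h : ∀ A, 0 < A → A < d → ∫ s in (0 : ℝ)..(2 * Real.pi), E (A * Real.sin s) = 0) :
    ∀ᶠ y in 𝓝 0, E y = 0 := by
  rcases hE.eventually_eq_zero_or_eventually_ne_zero with h1 | h1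
  · exact h1
  exfalso
  rw [eventually_nhdsWithin_iff, Metric.eventually_nhds_iff] at h1
  obtain ⟨ε, hε, h1⟩ := h1
  -- If `E` did not vanish identically near `0`, its zero would be isolated: on `(0, A]` it would
  -- keep a sign, by evenness also on `[-A, 0)`, and its mean over the circle of radius `A` could
  -- not be `0`.
  set A := min ε d / 2 with hAdef
  have hmin : 0 < min ε d := lt_min hε hd
  have hA0 : 0 < A := by positivity
  have hAε : A < ε := by have := min_le_left ε d; linarith
  have hAd : A < d := by have := min_le_right ε d; linarith
  have hne : ∀ y ∈ Ioc 0 A, E y ≠ 0 := fun y hy => h1 (by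
    rw [Real.dist_eq, sub_zero, abs_of_pos hy.1]; exact hy.2.trans_lt hAε) (by simpa using hy.1.ne')
  have hcA : ContinuousOn E (Ioc 0 A) := fun y hy => (hcont y (by
    rw [abs_of_pos hy.1]; exact hy.2.trans_lt hAd)).continuousWithinAt
  have hmemA : A ∈ Ioc 0 A := ⟨hA0, le_rfl⟩
  obtain ⟨σ, hσ0, hσ⟩ : ∃ σ : ℝ, σ ≠ 0 ∧ ∀ y ∈ Ioc 0 A, 0 < σ * E y := by
    have hO := (isPreconnected_Ioc.image E hcA).ordConnected
    have hno : (0 : ℝ) ∉ E '' Ioc 0 A := by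
      rintro ⟨y, hy, hy0⟩
      exact hne y hy hy0
    refine ⟨E A, hne A hmemA, fun y hy => ?_⟩
    by_contra! hcon
    rcases lt_or_gt_of_ne (hne A hmemA) with h3 | h3
    · exact hno (hO.out (mem_image_of_mem E hmemA) (mem_image_of_mem E hy)
        ⟨h3.le, by nlinarith⟩)
    · exact hno (hO.out (mem_image_of_mem E hy) (mem_image_of_mem E hmemA)
        ⟨by nlinarith, h3.le⟩)
  have hnn : ∀ y, |y| ≤ A → 0 ≤ σ * E y := by
    intro y hy
    rcases lt_trichotomy y 0 with h2 | h2 | h2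
    · rw [← heven]
      exact (hσ (-y) ⟨by linarith, by rwa [abs_of_neg h2] at hy⟩).le
    · rw [h2, h0, mul_zero]
    · exact (hσ y ⟨h2, by rwa [abs_of_pos h2] at hy⟩).le
  have hsin : ∀ s, |A * Real.sin s| ≤ A := fun s => by
    rw [abs_mul, abs_of_pos hA0]
    exact mul_le_of_le_one_right hA0.le (Real.abs_sin_le_one s)
  have hcs : Continuous fun s => E (A * Real.sin s) :=
    continuous_iff_continuousAt.2 fun s =>
      ContinuousAt.comp (f := fun s => A * Real.sin s) (hcont _ ((hsin s).trans_lt hAd))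
        (by fun_prop)
  have hpos := intervalIntegral.integral_pos (a := 0) (b := 2 * Real.pi)
    (f := fun s => σ * E (A * Real.sin s)) (by positivity) (hcs.const_mul σ).continuousOn
    (fun s _ => hnn _ (hsin s)) ⟨Real.pi / 2, ⟨by positivity, by linarith [Real.pi_pos]⟩, by
      simpa using hσ A hmemA⟩
  rw [intervalIntegral.integral_const_mul, h A hA0 hAd, mul_zero] at hpos
  exact lt_irrefl _ hpos

/-- A nondegenerate minimum of an analytic function is a square in a suitable coordinate. -/
lemma AnalyticAt.exists_square_chart {W : ℝ → ℝ} {u₀ : ℝ} (hW : AnalyticAt ℝ W u₀)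
    (h1 : deriv W u₀ = 0) (h2 : 0 < deriv (deriv W) u₀) {b : ℝ} (hb : 0 < b) :
    ∃ η : ℝ → ℝ, η 0 = u₀ ∧ AnalyticAt ℝ η 0 ∧ 0 < deriv η 0 ∧
      ∀ᶠ y in 𝓝 0, W (η y) = W u₀ + b * y ^ 2 := by
  have hg : AnalyticAt ℝ (fun u => W u - W u₀) u₀ := hW.sub analyticAt_const
  have hord : ((2 : ℕ) : ℕ∞) ≤ analyticOrderAt (fun u => W u - W u₀) u₀ := by
    rw [natCast_le_analyticOrderAt_iff_iteratedDeriv_eq_zero hg]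
    intro i hi
    interval_cases i
    · simp
    · simp [iteratedDeriv_one, h1]
  obtain ⟨k, hk, hWk⟩ := (natCast_le_analyticOrderAt hg).1 hord
  simp only [smul_eq_mul] at hWk
  have hk0 : deriv (deriv W) u₀ = 2 * k u₀ := by
    have e1 : ∀ᶠ u in 𝓝 u₀, deriv W u = 2 * (u - u₀) * k u + (u - u₀) ^ 2 * deriv k u := by
      filter_upwards [hWk.eventually_nhds, hk.eventually_analyticAt] with u hu hku
      have e2 : W =ᶠ[𝓝 u] fun u => (u - u₀) ^ 2 * k u + W u₀ := hu.mono fun v hv => by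
        simp only [← hv]; ring
      rw [e2.deriv_eq]
      have := ((((hasDerivAt_id u).sub_const u₀).pow 2).mul
        hku.differentiableAt.hasDerivAt).add_const (W u₀)
      refine this.deriv.trans ?_
      simp
    rw [EventuallyEq.deriv_eq e1]
    have e3 := ((((hasDerivAt_id u₀).sub_const u₀).const_mul 2).mul
      hk.differentiableAt.hasDerivAt).add ((((hasDerivAt_id u₀).sub_const u₀).pow 2).mul
        hk.deriv.differentiableAt.hasDerivAt)
    refine e3.deriv.trans ?_
    simp
  have hkpos : 0 < k u₀ / b := div_pos (by linarith) hb
  -- Since `W - W(u₀) = (u - u₀)² k` with `k(u₀) > 0`, this is an analytic root of `(W - W(u₀)) / b`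
  -- with positive derivative; `η` is its local inverse.
  set Y : ℝ → ℝ := fun u => (u - u₀) * √(k u / b) with hY
  have hsq : AnalyticAt ℝ (fun u => √(k u / b)) u₀ := by
    have e1 : AnalyticAt ℝ (fun u => k u / b) u₀ := hk.div_const
    exact (e1.contDiffAt.sqrt (n := ω) hkpos.ne').analyticAt
  have hYa : AnalyticAt ℝ Y u₀ := (analyticAt_id.sub analyticAt_const).mul hsq
  have hYd : deriv Y u₀ = √(k u₀ / b) := by
    have := ((hasDerivAt_id u₀).sub_const u₀).mul hsq.differentiableAt.hasDerivAt
    refine this.deriv.trans ?_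
    simp
  have hYpos : 0 < deriv Y u₀ := by rw [hYd]; exact Real.sqrt_pos.2 hkpos
  have hY0 : Y u₀ = 0 := by simp [hY]
  set η := hYa.hasStrictDerivAt.localInverse _ _ _ hYpos.ne' with hη
  have hη0 : η 0 = u₀ := by
    rw [← hY0]; exact HasStrictFDerivAt.localInverse_apply_image ..
  have hηa : AnalyticAt ℝ η 0 := by
    rw [← hY0]; exact hYa.analyticAt_localInverse hYpos.ne'
  have hηd : deriv η 0 = (deriv Y u₀)⁻¹ := by
    have := hYa.hasStrictDerivAt.to_localInverse hYpos.ne'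
    rw [hY0] at this
    exact this.hasDerivAt.deriv
  have hr : ∀ᶠ y in 𝓝 0, Y (η y) = y := by
    have := hYa.hasStrictDerivAt.eventually_right_inverse hYpos.ne'
    rwa [hY0] at this
  have ht : Tendsto η (𝓝 0) (𝓝 u₀) := by
    have := hηa.continuousAt.tendsto
    rwa [hη0] at this
  refine ⟨η, hη0, hηa, by rw [hηd]; exact inv_pos.2 hYpos, ?_⟩
  have hkp : ∀ᶠ u in 𝓝 u₀, 0 < k u / b :=
    (hk.continuousAt.div_const b).eventually_const_lt hkpos
  filter_upwards [hr, ht.eventually hWk, ht.eventually hkp] with y e1 e2 e3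
  have e4 : Y (η y) ^ 2 = (η y - u₀) ^ 2 * (k (η y) / b) := by
    simp only [hY, mul_pow, Real.sq_sqrt e3.le]
  rw [e1] at e4
  rw [e4]
  field_simp
  linarith

/-! ### Isochrony: rationality and symmetry of the chart density. -/

namespace SurfaceOfRevolution

variable {S : SurfaceOfRevolution} {V : ℝ → ℝ} {m l δ : ℝ} {η : ℝ → ℝ}

namespace IsWellChart

variable (h : S.IsWellChart V m l η δ) {K : ℝ} (hK : S.CurvatureEq K)
  (hV : AnalyticOnNhd ℝ V S.dom) (hm : 0 < m) (hl : 0 < l)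
  (hclosed : S.AllBoundedOrbitsClosed V m)
include h

lemma chartDensity_pos {y : ℝ} (hy : |y| < δ) : 0 < S.chartDensity η y :=
  div_pos (h.deriv_pos y hy) (pow_pos (S.f_pos _ (h.mem_dom y hy)) 2)

include hK in
lemma analyticAt_chartDensity {y : ℝ} (hy : |y| < δ) : AnalyticAt ℝ (S.chartDensity η) y :=
  (h.analyticAt y hy).deriv.div
    (((hK.analyticOnNhd_f _ (h.mem_dom y hy)).comp (h.analyticAt y hy)).pow 2)
    (pow_ne_zero 2 (S.f_pos _ (h.mem_dom y hy)).ne')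

include hK hV hm hl hclosed

lemma integral_chartDensity_eq {A : ℝ} (hA0 : 0 < A) (hA : A < δ) :
    ∫ s in (0 : ℝ)..(2 * Real.pi), S.chartDensity η (A * Real.sin s) =
      2 * Real.pi * S.chartDensity η 0 := by
  obtain ⟨d, hAd, hd⟩ := exists_between hA
  have hd0 := hA0.trans hAd
  -- Clamping to `[-d, d]` produces a globally continuous function with the same values at the
  -- arguments `B sin s`, `B < d`.
  set p : ℝ → ℝ := fun y => max (-d) (min y d) with hp
  have hpd : ∀ y, |p y| < δ := fun y => (abs_le.2 ⟨le_max_left _ _,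
    max_le (by linarith) (min_le_right _ _)⟩ : |p y| ≤ d).trans_lt hd
  have hpe : ∀ y, |y| ≤ d → p y = y := fun y hy => by
    rw [abs_le] at hy
    simp only [hp, min_eq_left hy.2, max_eq_right hy.1]
  have hG : Continuous fun y => S.chartDensity η (p y) := continuous_iff_continuousAt.2 fun y =>
    ContinuousAt.comp (f := p) (h.continuousAt_chartDensity (hpd y)) (by fun_prop)
  have heq : ∀ B, 0 < B → B < d → ∫ s in (0 : ℝ)..(2 * Real.pi),
      S.chartDensity η (p (B * Real.sin s)) =
      ∫ s in (0 : ℝ)..(2 * Real.pi), S.chartDensity η (B * Real.sin s) := by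
    intro B hB0 hB
    congr 1
    ext s
    rw [hpe _ (abs_mul_sin_lt (by rwa [abs_of_pos hB0]) s).le]
  have := integral_mul_sin_eq_of_rat hG (d := d) (fun B hB0 hB => by
    rw [heq B hB0 hB]
    exact h.exists_rat_integral_eq hK hV hm hl hclosed hB0 (hB.trans hd)) hA0 hAd
  rw [heq A hA0 hAd, hpe 0 (by simpa using hd0.le)] at this
  exact this

lemma exists_rat_chartDensity : ∃ r : ℚ, 0 < r ∧ S.chartDensity η 0 = r := by
  have hδ := h.pos
  obtain ⟨r, hr⟩ := h.exists_rat_integral_eq hK hV hm hl hclosed (half_pos hδ) (half_lt_self hδ)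
  rw [h.integral_chartDensity_eq hK hV hm hl hclosed (half_pos hδ) (half_lt_self hδ)] at hr
  have hr' : S.chartDensity η 0 = r := by
    have := Real.pi_pos
    field_simp at hr
    exact hr
  refine ⟨r, ?_, hr'⟩
  have := h.chartDensity_pos (y := 0) (by simpa using hδ)
  rw [hr'] at this
  exact_mod_cast this

/-- All circular means of the density of radius below `δ` equal its central value, so the even part
minus that value has vanishing means and must vanish near `0`. -/
lemma eventually_chartDensity_add :
    ∀ᶠ y in 𝓝 0, S.chartDensity η y + S.chartDensity η (-y) = 2 * S.chartDensity η 0 := by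
  have hδ := h.pos
  have hneg : ∀ y, |y| < δ → AnalyticAt ℝ (fun y => S.chartDensity η (-y)) y := fun y hy =>
    AnalyticAt.fun_comp (h.analyticAt_chartDensity hK (by rwa [abs_neg])) (by fun_prop)
  have hE : ∀ y, |y| < δ → AnalyticAt ℝ (fun y => S.chartDensity η y + S.chartDensity η (-y) -
      2 * S.chartDensity η 0) y := fun y hy =>
    ((h.analyticAt_chartDensity hK hy).add (hneg y hy)).sub analyticAt_const
  refine ((hE 0 (by simpa using hδ)).eventually_eq_zero_of_integral_mul_sin (fun y => ?_) ?_ hδ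
    (fun y hy => (hE y hy).continuousAt) fun A hA0 hA => ?_).mono fun y hy => sub_eq_zero.1 hy
  · simp only [neg_neg]; ring
  · simp; ring
  · have hA' : |A| < δ := by rwa [abs_of_pos hA0]
    have hc := h.continuous_chartDensity_sin hA'
    have hc' : Continuous fun s => S.chartDensity η (-(A * Real.sin s)) := by
      have := h.continuous_chartDensity_sin (A := -A) (by rwa [abs_neg])
      simpa using this
    have hI := h.integral_chartDensity_eq hK hV hm hl hclosed hA0 hA
    have hI' : ∫ s in (0 : ℝ)..(2 * Real.pi), S.chartDensity η (-(A * Real.sin s)) =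
        ∫ s in (0 : ℝ)..(2 * Real.pi), S.chartDensity η (A * Real.sin s) := by
      have := intervalIntegral.integral_comp_sub_left (a := 0) (b := 2 * Real.pi)
        (fun s => S.chartDensity η (A * Real.sin s)) (2 * Real.pi)
      simpa [Real.sin_two_pi_sub] using this
    rw [intervalIntegral.integral_sub ((hc.fun_add hc').intervalIntegrable _ _)
      (continuous_const.intervalIntegrable _ _),
      intervalIntegral.integral_add (hc.intervalIntegrable _ _) (hc'.intervalIntegrable _ _),
      hI', hI]
    simp
    ring

end IsWellChart

end SurfaceOfRevolution

/-! ### The `θ`-calculus and the Taylor conditions at a circular orbit. -/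

lemma setOf_abs_lt_mem_nhds {y δ : ℝ} (hy : |y| < δ) : {y : ℝ | |y| < δ} ∈ 𝓝 y :=
  (isOpen_lt continuous_abs continuous_const).mem_nhds hy

namespace SurfaceOfRevolution

variable {S : SurfaceOfRevolution} {V : ℝ → ℝ} {m l δ : ℝ} {η : ℝ → ℝ}

/-- The derivative with respect to the coordinate `θ = ∫ du / f²`. -/
noncomputable def angularDeriv (S : SurfaceOfRevolution) (F : ℝ → ℝ) (u : ℝ) : ℝ :=
  S.f u ^ 2 * deriv F u

/-- The function `-f' / f`, an affine function of `θ = ∫ du / f²`. -/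
noncomputable def slope (S : SurfaceOfRevolution) (u : ℝ) : ℝ := -deriv S.f u / S.f u

lemma deriv_eq_angularDeriv_div {F : ℝ → ℝ} {u : ℝ} (hu : u ∈ S.dom) :
    deriv F u = S.angularDeriv F u / S.f u ^ 2 := by
  have := (S.f_pos u hu).ne'
  rw [angularDeriv]
  field_simp

lemma hasDerivAt_angularDeriv {F : ℝ → ℝ} (hF : AnalyticOnNhd ℝ F S.dom) {u : ℝ}
    (hu : u ∈ S.dom) : HasDerivAt F (S.angularDeriv F u / S.f u ^ 2) u := by
  rw [← deriv_eq_angularDeriv_div hu]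
  exact (hF u hu).differentiableAt.hasDerivAt

namespace CurvatureEq

variable {K q : ℝ} (hK : S.CurvatureEq K) (hq : S.SatisfiesProfileEquation q)

include hK in
lemma analyticOnNhd_angularDeriv {F : ℝ → ℝ} (hF : AnalyticOnNhd ℝ F S.dom) :
    AnalyticOnNhd ℝ (S.angularDeriv F) S.dom :=
  (hK.analyticOnNhd_f.pow 2).mul hF.deriv

include hK in
lemma analyticOnNhd_slope : AnalyticOnNhd ℝ S.slope S.dom :=
  hK.analyticOnNhd_f.deriv.neg.div hK.analyticOnNhd_f fun u hu => (S.f_pos u hu).ne'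

end CurvatureEq

lemma SatisfiesProfileEquation.hasDerivAt_slope {q : ℝ} (hq : S.SatisfiesProfileEquation q) {u : ℝ}
    (hu : u ∈ S.dom) : HasDerivAt S.slope (q / S.f u ^ 2) u := by
  have h := (S.f_pos u hu).ne'
  refine ((hasDerivAt_deriv_f hu).neg.div (hasDerivAt_f hu) h).congr_deriv ?_
  rw [← hq u hu]
  simp only [Pi.neg_apply]
  ring

/-- In terms of `θ` the derivative of `W` is `l²/m` times `slope + ε V_θ` with `ε = m / l²`; only
`ε` records the angular momentum. -/
lemma potential_deriv_eq {u : ℝ} (hu : u ∈ S.dom) (hm : m ≠ 0) (hl : l ≠ 0) :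
    -(l ^ 2 * deriv S.f u / (m * S.f u ^ 3)) + deriv V u =
      l ^ 2 / m * ((S.slope u + m / l ^ 2 * S.angularDeriv V u) / S.f u ^ 2) := by
  have h := (S.f_pos u hu).ne'
  rw [slope, angularDeriv]
  field_simp

lemma analyticOnNhd_effectivePotential {K : ℝ} (hK : S.CurvatureEq K) (hm : m ≠ 0)
    (hV : AnalyticOnNhd ℝ V S.dom) (l : ℝ) :
    AnalyticOnNhd ℝ (S.effectivePotential V m l) S.dom := fun u hu =>
  (analyticAt_const.div (analyticAt_const.mul ((hK.analyticOnNhd_f u hu).pow 2))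
    (mul_ne_zero (by simpa using hm) (pow_ne_zero 2 (S.f_pos u hu).ne'))).add (hV u hu)

lemma deriv_effectivePotential (hV : AnalyticOnNhd ℝ V S.dom) (hm : m ≠ 0) (hl : l ≠ 0) {u : ℝ}
    (hu : u ∈ S.dom) : deriv (S.effectivePotential V m l) u =
      l ^ 2 / m * ((S.slope u + m / l ^ 2 * S.angularDeriv V u) / S.f u ^ 2) := by
  rw [(hasDerivAt_effectivePotential hu hm (hV u hu).differentiableAt).deriv,
    potential_deriv_eq hu hm hl]

lemma deriv_deriv_effectivePotential {K q : ℝ} (hK : S.CurvatureEq K)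
    (hq : S.SatisfiesProfileEquation q) (hV : AnalyticOnNhd ℝ V S.dom) (hm : m ≠ 0) (hl : l ≠ 0)
    {u₀ : ℝ} (hu : u₀ ∈ S.dom) (h1 : S.slope u₀ + m / l ^ 2 * S.angularDeriv V u₀ = 0) :
    deriv (deriv (S.effectivePotential V m l)) u₀ =
      l ^ 2 / m * ((q + m / l ^ 2 * S.angularDeriv (S.angularDeriv V) u₀) / S.f u₀ ^ 4) := by
  have hf := S.f_pos u₀ hu
  rw [EventuallyEq.deriv_eq (eventually_of_mem (dom_mem_nhds hu) fun u hu =>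
    deriv_effectivePotential hV hm hl hu)]
  have := ((((hq.hasDerivAt_slope hu).add ((hasDerivAt_angularDeriv
    (hK.analyticOnNhd_angularDeriv hV) hu).const_mul (m / l ^ 2))).div
    ((hasDerivAt_f hu).pow 2) (pow_ne_zero 2 hf.ne')).const_mul (l ^ 2 / m))
  refine this.deriv.trans ?_
  simp only [Pi.add_apply, Pi.pow_apply, h1]
  field_simp
  ring

lemma exists_wellChart {K q : ℝ} (hK : S.CurvatureEq K) (hq : S.SatisfiesProfileEquation q)
    (hV : AnalyticOnNhd ℝ V S.dom) (hm : 0 < m) (hl : 0 < l) {u₀ : ℝ} (hu : u₀ ∈ S.dom)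
    (h1 : S.slope u₀ + m / l ^ 2 * S.angularDeriv V u₀ = 0)
    (h2 : 0 < q + m / l ^ 2 * S.angularDeriv (S.angularDeriv V) u₀) :
    ∃ η δ, S.IsWellChart V m l η δ ∧ η 0 = u₀ := by
  have hf := S.f_pos u₀ hu
  obtain ⟨η, hη0, hηa, hηd, hηW⟩ :=
    (analyticOnNhd_effectivePotential hK hm.ne' hV l u₀ hu).exists_square_chart
    (by rw [deriv_effectivePotential hV hm.ne' hl.ne' hu, h1, zero_div, mul_zero])
    (by rw [deriv_deriv_effectivePotential hK hq hV hm.ne' hl.ne' hu h1]; positivity)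
    (b := l ^ 2 / (2 * m)) (by positivity)
  have hdom : ∀ᶠ y in 𝓝 0, η y ∈ S.dom :=
    hηa.continuousAt.eventually_mem (by rw [hη0]; exact dom_mem_nhds hu)
  have hall := hηa.eventually_analyticAt.and ((hηa.deriv.continuousAt.eventually_const_lt hηd).and
    (hdom.and hηW))
  obtain ⟨δ, hδ, h⟩ := Metric.eventually_nhds_iff.1 hall
  simp only [Real.dist_eq, sub_zero] at h
  exact ⟨η, δ, ⟨hδ, fun y hy => (h hy).1, fun y hy => (h hy).2.1, fun y hy => (h hy).2.2.1,
    fun y hy => by rw [(h hy).2.2.2, hη0]⟩, hη0⟩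

namespace IsWellChart

variable (h : S.IsWellChart V m l η δ)
include h

lemma hasDerivAt_comp {F : ℝ → ℝ} {c y : ℝ} (hy : |y| < δ)
    (hF : HasDerivAt F (c / S.f (η y) ^ 2) (η y)) :
    HasDerivAt (fun y => F (η y)) (c * S.chartDensity η y) y := by
  refine (hF.comp y (h.analyticAt y hy).differentiableAt.hasDerivAt).congr_deriv ?_
  rw [chartDensity]
  ring

/-- With `w = slope + ε V_θ` and density `H`, this is the `y`-derivative of the normal form of `W`.
The three relations below follow by repeated differentiation, using `d/dy = H d/dθ` and that `slope`
has the constant `θ`-derivative `q`. -/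
lemma slope_add_mul_chartDensity (hV : AnalyticOnNhd ℝ V S.dom) (hm : 0 < m) (hl : 0 < l)
    {y : ℝ} (hy : |y| < δ) :
    (S.slope (η y) + m / l ^ 2 * S.angularDeriv V (η y)) * S.chartDensity η y = y := by
  have h1 := h.deriv_potential hV hm.ne' hy
  rw [potential_deriv_eq (h.mem_dom y hy) hm.ne' hl.ne'] at h1
  have hf := (S.f_pos _ (h.mem_dom y hy)).ne'
  rw [chartDensity]
  have h2 : l ^ 2 / m ≠ 0 := by positivity
  apply mul_left_cancel₀ h2
  rw [← h1]
  ring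

variable {K q : ℝ} (hK : S.CurvatureEq K) (hq : S.SatisfiesProfileEquation q)
  (hV : AnalyticOnNhd ℝ V S.dom) (hm : 0 < m) (hl : 0 < l)
include hK hq hV hm hl

lemma second_order_eq {y : ℝ} (hy : |y| < δ) :
    (q + m / l ^ 2 * S.angularDeriv (S.angularDeriv V) (η y)) * S.chartDensity η y ^ 2 +
      (S.slope (η y) + m / l ^ 2 * S.angularDeriv V (η y)) * deriv (S.chartDensity η) y = 1 := by
  have hd := h.mem_dom y hy
  have hV1 := hK.analyticOnNhd_angularDeriv hV
  have h1 := ((h.hasDerivAt_comp hy (hq.hasDerivAt_slope hd)).add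
    ((h.hasDerivAt_comp hy (hasDerivAt_angularDeriv hV1 hd)).const_mul (m / l ^ 2))).mul
    (h.analyticAt_chartDensity hK hy).differentiableAt.hasDerivAt
  have h2 := h1.unique ((hasDerivAt_id y).congr_of_eventuallyEq
    (eventually_of_mem (setOf_abs_lt_mem_nhds hy)
      fun z hz => h.slope_add_mul_chartDensity hV hm hl hz))
  rw [← h2]
  simp only [Pi.add_apply]
  ring

lemma third_order_eq {y : ℝ} (hy : |y| < δ) :
    m / l ^ 2 * S.angularDeriv (S.angularDeriv (S.angularDeriv V)) (η y) *
        S.chartDensity η y ^ 3 +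
      3 * (q + m / l ^ 2 * S.angularDeriv (S.angularDeriv V) (η y)) * S.chartDensity η y *
        deriv (S.chartDensity η) y +
      (S.slope (η y) + m / l ^ 2 * S.angularDeriv V (η y)) *
        deriv (deriv (S.chartDensity η)) y = 0 := by
  have hd := h.mem_dom y hy
  have hV1 := hK.analyticOnNhd_angularDeriv hV
  have hV2 := hK.analyticOnNhd_angularDeriv hV1
  have hH := h.analyticAt_chartDensity hK hy
  have hH1 := hH.differentiableAt.hasDerivAt
  have h1 := ((((h.hasDerivAt_comp hy (hasDerivAt_angularDeriv hV2 hd)).const_mul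
    (m / l ^ 2)).const_add q).mul (hH1.pow 2)).add
    (((h.hasDerivAt_comp hy (hq.hasDerivAt_slope hd)).add
    ((h.hasDerivAt_comp hy (hasDerivAt_angularDeriv hV1 hd)).const_mul (m / l ^ 2))).mul
    hH.deriv.differentiableAt.hasDerivAt)
  have h2 := h1.unique ((hasDerivAt_const y (1 : ℝ)).congr_of_eventuallyEq
    (eventually_of_mem (setOf_abs_lt_mem_nhds hy)
      fun z hz => h.second_order_eq hK hq hV hm hl hz))
  rw [← h2]
  simp only [Pi.add_apply, Pi.pow_apply]
  push_cast
  ring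

lemma fourth_order_eq {y : ℝ} (hy : |y| < δ) :
    m / l ^ 2 * S.angularDeriv (S.angularDeriv (S.angularDeriv (S.angularDeriv V))) (η y) *
        S.chartDensity η y ^ 4 +
      6 * (m / l ^ 2) * S.angularDeriv (S.angularDeriv (S.angularDeriv V)) (η y) *
        S.chartDensity η y ^ 2 * deriv (S.chartDensity η) y +
      (q + m / l ^ 2 * S.angularDeriv (S.angularDeriv V) (η y)) *
        (3 * deriv (S.chartDensity η) y ^ 2 +
          4 * S.chartDensity η y * deriv (deriv (S.chartDensity η)) y) +
      (S.slope (η y) + m / l ^ 2 * S.angularDeriv V (η y)) *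
        deriv (deriv (deriv (S.chartDensity η))) y = 0 := by
  have hd := h.mem_dom y hy
  have hV1 := hK.analyticOnNhd_angularDeriv hV
  have hV2 := hK.analyticOnNhd_angularDeriv hV1
  have hV3 := hK.analyticOnNhd_angularDeriv hV2
  have hH := h.analyticAt_chartDensity hK hy
  have hH1 := hH.differentiableAt.hasDerivAt
  have hH2 := hH.deriv.differentiableAt.hasDerivAt
  have h1 := ((((h.hasDerivAt_comp hy (hasDerivAt_angularDeriv hV3 hd)).const_mul
    (m / l ^ 2)).mul (hH1.pow 3)).add
    ((((((h.hasDerivAt_comp hy (hasDerivAt_angularDeriv hV2 hd)).const_mul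
    (m / l ^ 2)).const_add q).const_mul 3).mul hH1).mul hH2)).add
    (((h.hasDerivAt_comp hy (hq.hasDerivAt_slope hd)).add
    ((h.hasDerivAt_comp hy (hasDerivAt_angularDeriv hV1 hd)).const_mul (m / l ^ 2))).mul
    hH.deriv.deriv.differentiableAt.hasDerivAt)
  have h2 := h1.unique ((hasDerivAt_const y (0 : ℝ)).congr_of_eventuallyEq
    (eventually_of_mem (setOf_abs_lt_mem_nhds hy)
      fun z hz => h.third_order_eq hK hq hV hm hl hz))
  rw [← h2]
  simp only [Pi.add_apply, Pi.pow_apply, Pi.mul_apply]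
  push_cast
  ring

variable (hclosed : S.AllBoundedOrbitsClosed V m)

/-- At a nondegenerate circular orbit, the second derivative of `W` with respect to `θ` is
determined by the density of the chart. -/
lemma second_order_mul_sq : (q + m / l ^ 2 * S.angularDeriv (S.angularDeriv V) (η 0)) *
    S.chartDensity η 0 ^ 2 = 1 := by
  have h0 : |(0 : ℝ)| < δ := by simpa using h.pos
  have h1 := h.slope_add_mul_chartDensity hV hm hl h0
  have h2 := h.second_order_eq hK hq hV hm hl h0
  rw [(mul_eq_zero.1 h1).resolve_right (h.chartDensity_pos h0).ne', zero_mul, add_zero] at h2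
  exact h2

include hclosed

lemma exists_rat_sq_eq : ∃ r : ℚ, 0 < r ∧
    q + m / l ^ 2 * S.angularDeriv (S.angularDeriv V) (η 0) = (r : ℝ) ^ 2 := by
  obtain ⟨r, hr, hr'⟩ := h.exists_rat_chartDensity hK hV hm hl hclosed
  refine ⟨r⁻¹, inv_pos.2 hr, ?_⟩
  have h1 := h.second_order_mul_sq hK hq hV hm hl
  rw [hr'] at h1
  have : (r : ℝ) ≠ 0 := by exact_mod_cast hr.ne'
  push_cast
  rw [inv_pow]
  exact eq_inv_of_mul_eq_one_left h1

/-- The second-order condition for an isochronous family of librations. -/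
lemma isochronous_condition :
    5 * (m / l ^ 2 * S.angularDeriv (S.angularDeriv (S.angularDeriv V)) (η 0)) ^ 2 =
      3 * (q + m / l ^ 2 * S.angularDeriv (S.angularDeriv V) (η 0)) *
        (m / l ^ 2 *
          S.angularDeriv (S.angularDeriv (S.angularDeriv (S.angularDeriv V))) (η 0)) := by
  have h0 : |(0 : ℝ)| < δ := by simpa using h.pos
  have hHpos := h.chartDensity_pos h0
  -- The even part of the density is constant, so its second derivative vanishes at `0`.
  have hH2 : deriv (deriv (S.chartDensity η)) 0 = 0 := by
    have e := h.eventually_chartDensity_add hK hV hm hl hclosed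
    have hev : ∀ᶠ y in 𝓝 (0 : ℝ), AnalyticAt ℝ (S.chartDensity η) y ∧
        AnalyticAt ℝ (S.chartDensity η) (-y) :=
      eventually_of_mem (setOf_abs_lt_mem_nhds h0) fun y hy =>
        ⟨h.analyticAt_chartDensity hK hy, h.analyticAt_chartDensity hK (by rwa [abs_neg])⟩
    have e1 : ∀ᶠ y in 𝓝 (0 : ℝ),
        deriv (S.chartDensity η) y - deriv (S.chartDensity η) (-y) = 0 := by
      filter_upwards [e.eventually_nhds, hev] with y hy hay
      have d1 := hay.1.differentiableAt.hasDerivAt.add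
        (hay.2.differentiableAt.hasDerivAt.comp y (hasDerivAt_neg y))
      have d2 := d1.unique ((hasDerivAt_const y (2 * S.chartDensity η 0)).congr_of_eventuallyEq hy)
      linarith
    have hH' := (h.analyticAt_chartDensity hK h0).deriv.differentiableAt.hasDerivAt
    have hH'' : HasDerivAt (deriv (S.chartDensity η))
        (deriv (deriv (S.chartDensity η)) 0) (-0) := by
      rwa [neg_zero]
    have d1 := hH'.sub (hH''.comp 0 (hasDerivAt_neg 0))
    have d2 := d1.unique ((hasDerivAt_const 0 (0 : ℝ)).congr_of_eventuallyEq e1)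
    linarith
  have e1 := (mul_eq_zero.1 (h.slope_add_mul_chartDensity hV hm hl h0)).resolve_right hHpos.ne'
  have e2 := h.second_order_mul_sq hK hq hV hm hl
  have e3 := h.third_order_eq hK hq hV hm hl h0
  have e4 := h.fourth_order_eq hK hq hV hm hl h0
  rw [e1, hH2] at e3 e4
  generalize q + m / l ^ 2 * S.angularDeriv (S.angularDeriv V) (η 0) = a2 at *
  have e3' : m / l ^ 2 * S.angularDeriv (S.angularDeriv (S.angularDeriv V)) (η 0) *
        S.chartDensity η 0 ^ 3 +
      3 * a2 * S.chartDensity η 0 * deriv (S.chartDensity η) 0 = 0 := by linarith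
  have e4' : m / l ^ 2 * S.angularDeriv (S.angularDeriv (S.angularDeriv (S.angularDeriv V))) (η 0) *
        S.chartDensity η 0 ^ 4 +
      6 * (m / l ^ 2 * S.angularDeriv (S.angularDeriv (S.angularDeriv V)) (η 0)) *
        S.chartDensity η 0 ^ 2 * deriv (S.chartDensity η) 0 +
      a2 * (3 * deriv (S.chartDensity η) 0 ^ 2) = 0 := by linarith
  generalize m / l ^ 2 * S.angularDeriv (S.angularDeriv (S.angularDeriv V)) (η 0) = a3 at *
  generalize m / l ^ 2 *
    S.angularDeriv (S.angularDeriv (S.angularDeriv (S.angularDeriv V))) (η 0) = a4 at *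
  generalize S.chartDensity η 0 = H at *
  generalize deriv (S.chartDensity η) 0 = H' at *
  have hH := hHpos.ne'
  -- At `y = 0` the relations give `a2 = H⁻²`, `a3 = -3 H' H⁻⁴` and `a4 = 15 H'² H⁻⁶`; eliminating
  -- `H` and `H'` leaves `5 a3² = 3 a2 a4`.
  have ha2 : a2 = 1 / H ^ 2 := by field_simp; exact e2
  subst ha2
  have ha3 : a3 = -3 * H' / H ^ 4 := by
    field_simp at e3' ⊢
    linear_combination e3'
  subst ha3
  have ha4 : a4 = 15 * H' ^ 2 / H ^ 6 := by
    field_simp at e4' ⊢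
    linear_combination e4'
  subst ha4
  field_simp
  ring

end IsWellChart

end SurfaceOfRevolution

/-! ### From a bounded orbit to nondegenerate circular orbits. -/

namespace SurfaceOfRevolution

variable {S : SurfaceOfRevolution} {V : ℝ → ℝ} {m l : ℝ}

namespace NonsingularOrbit

variable (o : S.NonsingularOrbit V m)

lemma energy_eq (hm : m ≠ 0) (hV : AnalyticOnNhd ℝ V S.dom) {t : ℝ} (ht : 0 ≤ t) :
    o.pu t ^ 2 / (2 * m) + S.effectivePotential V m (o.pφ 0) (o.u t) =
      o.pu 0 ^ 2 / (2 * m) + S.effectivePotential V m (o.pφ 0) (o.u 0) := by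
  refine eq_of_hasDerivWithinAt_Ici_zero (F := fun t => o.pu t ^ 2 / (2 * m) +
    S.effectivePotential V m (o.pφ 0) (o.u t)) (fun t ht => ?_) ht
  have hd := o.mem_dom t ht
  have h1 := (((o.eq_pu t ht).pow 2).div_const (2 * m)).add
    ((hasDerivAt_effectivePotential (l := o.pφ 0) hd hm
      (hV _ hd).differentiableAt).comp_hasDerivWithinAt t (o.eq_u t ht))
  refine h1.congr_deriv ?_
  rw [o.pφ_eq ht]
  have := (S.f_pos _ hd).ne'
  push_cast
  field_simp
  ring

/-- Along a closed non-circular orbit, `u` oscillates in a well of the effective potential. -/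
lemma Closed.exists_well {o : S.NonsingularOrbit V m} (h : o.Closed) (hc : ¬ o.Circular) {K : ℝ}
    (hK : S.CurvatureEq K) (hm : 0 < m) (hV : AnalyticOnNhd ℝ V S.dom) :
    ∃ a u b, a ∈ S.dom ∧ b ∈ S.dom ∧ a < u ∧ u < b ∧
      S.effectivePotential V m (o.pφ 0) u < S.effectivePotential V m (o.pφ 0) a ∧
      S.effectivePotential V m (o.pφ 0) u < S.effectivePotential V m (o.pφ 0) b := by
  obtain ⟨T, hT, hper⟩ := h.exists_period hK hm.ne'
  have hnat : ∀ n : ℕ, ∀ t, 0 ≤ t → o.u (t + n * T) = o.u t := by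
    intro n
    induction n with
    | zero => simp
    | succ n ih =>
      intro t ht
      have : t + (n + 1 : ℕ) * T = t + n * T + T := by push_cast; ring
      rw [this, (hper _ (by positivity)).1, ih t ht]
  have hred : ∀ t, 0 ≤ t → ∃ s ∈ Icc 0 T, o.u t = o.u s := by
    intro t ht
    have h1 := Nat.floor_le (div_nonneg ht hT.le)
    have h2 := Nat.lt_floor_add_one (t / T)
    rw [le_div_iff₀ hT] at h1
    rw [div_lt_iff₀ hT] at h2
    refine ⟨t - ⌊t / T⌋₊ * T, ⟨by linarith, by linarith⟩, ?_⟩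
    simpa using hnat ⌊t / T⌋₊ (t - ⌊t / T⌋₊ * T) (by linarith)
  have hcont : ContinuousOn o.u (Icc 0 T) := o.continuousOn_u.mono Icc_subset_Ici_self
  have hne : (Icc 0 T).Nonempty := nonempty_Icc.2 hT.le
  obtain ⟨s₁, hs₁, hmin⟩ := isCompact_Icc.exists_isMinOn hne hcont
  obtain ⟨s₂, hs₂, hmax⟩ := isCompact_Icc.exists_isMaxOn hne hcont
  have hle : ∀ t, 0 ≤ t → o.u s₁ ≤ o.u t := fun t ht => by
    obtain ⟨s, hs, hts⟩ := hred t ht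
    rw [hts]; exact hmin hs
  have hge : ∀ t, 0 ≤ t → o.u t ≤ o.u s₂ := fun t ht => by
    obtain ⟨s, hs, hts⟩ := hred t ht
    rw [hts]; exact hmax hs
  -- An extremum may occur at time `0`, where only a one-sided derivative is available; one period
  -- later it is interior.
  have hderiv : ∀ s, 0 ≤ s → HasDerivAt o.u (o.pu (s + T) / m) (s + T) := fun s hs =>
    (o.eq_u (s + T) (by linarith)).hasDerivAt (Ici_mem_nhds (by linarith))
  have hrest : ∀ s, 0 ≤ s → o.pu (s + T) / m = 0 → o.pu s = 0 := fun s hs h0 => by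
    rw [(hper s hs).2.1] at h0
    exact (div_eq_zero_iff.1 h0).resolve_right hm.ne'
  have hp₁ : o.pu s₁ = 0 := hrest s₁ hs₁.1 <| by
    refine IsLocalMin.hasDerivAt_eq_zero ?_ (hderiv s₁ hs₁.1)
    filter_upwards [Ici_mem_nhds (show 0 < s₁ + T by linarith [hs₁.1])] with t ht
    rw [(hper s₁ hs₁.1).1]
    exact hle t ht
  have hp₂ : o.pu s₂ = 0 := hrest s₂ hs₂.1 <| by
    refine IsLocalMax.hasDerivAt_eq_zero ?_ (hderiv s₂ hs₂.1)
    filter_upwards [Ici_mem_nhds (show 0 < s₂ + T by linarith [hs₂.1])] with t ht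
    rw [(hper s₂ hs₂.1).1]
    exact hge t ht
  have hE₁ := o.energy_eq hm.ne' hV hs₁.1
  have hE₂ := o.energy_eq hm.ne' hV hs₂.1
  rw [hp₁] at hE₁
  rw [hp₂] at hE₂
  obtain ⟨t, ht, hpt⟩ : ∃ t, 0 ≤ t ∧ o.pu t ≠ 0 := by
    by_contra! hcon
    exact hc fun t ht => eq_of_hasDerivWithinAt_Ici_zero
      (fun t ht => (o.eq_u t ht).congr_deriv (by rw [hcon t ht, zero_div])) ht
  have hEt := o.energy_eq hm.ne' hV ht
  have hlt : 0 < o.pu t ^ 2 / (2 * m) := by positivity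
  -- At both turning points `W` equals the energy, and it is strictly smaller at a time with `p_u ≠
  -- 0`.
  rw [← hEt, zero_pow two_ne_zero, zero_div, zero_add] at hE₁ hE₂
  refine ⟨o.u s₁, o.u t, o.u s₂, o.mem_dom _ hs₁.1, o.mem_dom _ hs₂.1,
    (hle t ht).lt_of_ne fun h0 => ?_, (hge t ht).lt_of_ne fun h0 => ?_, by linarith, by linarith⟩
  · rw [h0] at hE₁; linarith
  · rw [h0] at hE₂; linarith

end NonsingularOrbit

/-- If there is a closed non-circular orbit, some effective potential with non-zero angular momentum
is not constant and has a local minimum. -/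
lemma exists_isLocalMin {o : S.NonsingularOrbit V m} (h : o.Closed) (hc : ¬ o.Circular) {K : ℝ}
    (hK : S.CurvatureEq K) (hm : 0 < m) (hV : AnalyticOnNhd ℝ V S.dom) :
    ∃ l, 0 < l ∧ ∃ u ∈ S.dom, IsLocalMin (S.effectivePotential V m l) u ∧
      ∃ a ∈ S.dom, S.effectivePotential V m l a ≠ S.effectivePotential V m l u := by
  obtain ⟨a, u₀, b, ha, hb, hau, hub, h1, h2⟩ := h.exists_well hc hK hm hV
  have hcont : ∀ u, Continuous fun l => S.effectivePotential V m l u := fun u => by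
    unfold effectivePotential; fun_prop
  have hev := ((hcont u₀).continuousAt.eventually_lt (hcont a).continuousAt h1).and
    ((hcont u₀).continuousAt.eventually_lt (hcont b).continuousAt h2)
  -- The well is given by strict inequalities, which survive a small change of `l`; this avoids `l =
  -- 0`, and `W` depends on `l²` only.
  obtain ⟨l₀, hl₀, h1, h2⟩ := (dense_compl_singleton (0 : ℝ)).inter_nhds_nonempty hev
  have habs : ∀ u, S.effectivePotential V m |l₀| u = S.effectivePotential V m l₀ u := fun u => by
    simp only [effectivePotential, sq_abs]
  have hsub : Icc a b ⊆ S.dom := S.ordConnected_dom.out ha hb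
  have hW := analyticOnNhd_effectivePotential hK hm.ne' hV |l₀|
  obtain ⟨u, hu, hmin⟩ := isCompact_Icc.exists_isMinOn (nonempty_Icc.2 (hau.trans hub).le)
    (hW.continuousOn.mono hsub)
  have hle : S.effectivePotential V m |l₀| u ≤ S.effectivePotential V m |l₀| u₀ :=
    hmin ⟨hau.le, hub.le⟩
  rw [← habs, ← habs] at h1 h2
  have hua : u ≠ a := by rintro rfl; linarith
  have hub' : u ≠ b := by rintro rfl; linarith
  exact ⟨|l₀|, abs_pos.2 hl₀, u, hsub hu, hmin.isLocalMin (Icc_mem_nhds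
    (hu.1.lt_of_ne hua.symm) (hu.2.lt_of_ne hub')), a, ha, (hle.trans_lt h1).ne'⟩

/-- A non-constant effective potential is not constant on an interval to the right of a point. -/
lemma not_eqOn_Icc {K : ℝ} (hK : S.CurvatureEq K) (hm : m ≠ 0) (hV : AnalyticOnNhd ℝ V S.dom)
    {u a r : ℝ} (hu : u ∈ S.dom) (ha : a ∈ S.dom)
    (hne : S.effectivePotential V m l a ≠ S.effectivePotential V m l u) (hr : 0 < r)
    (h : ∀ v ∈ Icc u (u + r), S.effectivePotential V m l v = S.effectivePotential V m l u) :
    False := by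
  refine hne ((analyticOnNhd_effectivePotential hK hm hV l).eqOn_of_preconnected_of_frequently_eq
    (g := fun _ => S.effectivePotential V m l u) (fun _ _ => analyticAt_const)
    S.isPreconnected_dom hu ?_ ha)
  have h1 : ∃ᶠ v in 𝓝[>] u, S.effectivePotential V m l v = S.effectivePotential V m l u :=
    (eventually_of_mem (Ioo_mem_nhdsGT (show u < u + r by linarith)) fun v hv =>
      h v (Ioo_subset_Icc_self hv)).frequently
  exact h1.filter_mono (nhdsWithin_mono u fun v hv => ne_of_gt hv)

lemma slope_add_eq_zero_of_isLocalMin (hm : 0 < m)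
    (hV : AnalyticOnNhd ℝ V S.dom) (hl : 0 < l) {u : ℝ} (hu : u ∈ S.dom)
    (hmin : IsLocalMin (S.effectivePotential V m l) u) :
    S.slope u + m / l ^ 2 * S.angularDeriv V u = 0 := by
  have h1 := hmin.deriv_eq_zero
  rw [deriv_effectivePotential hV hm.ne' hl.ne' hu] at h1
  have := (S.f_pos u hu).ne'
  have h2 : l ^ 2 / m ≠ 0 := by positivity
  simpa [this, h2, hl.ne', hm.ne'] using h1

/-- Near a local minimum away from the critical points of `f` there are nondegenerate circular
orbits. -/
lemma exists_nondegenerate {K q : ℝ} (hK : S.CurvatureEq K) (hq : S.SatisfiesProfileEquation q)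
    (hm : 0 < m) (hV : AnalyticOnNhd ℝ V S.dom) (hl : 0 < l) {u₁ a : ℝ} (hu₁ : u₁ ∈ S.dom)
    (hmin : IsLocalMin (S.effectivePotential V m l) u₁) (ha : a ∈ S.dom)
    (hne : S.effectivePotential V m l a ≠ S.effectivePotential V m l u₁) (hx : S.slope u₁ ≠ 0) :
    ∃ u ∈ S.dom, S.slope u ≠ 0 ∧ 0 < -S.slope u / S.angularDeriv V u ∧
      0 < q - S.slope u * S.angularDeriv (S.angularDeriv V) u / S.angularDeriv V u := by
  have hV1 := hK.analyticOnNhd_angularDeriv hV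
  have hxa := hK.analyticOnNhd_slope
  have hcrit := slope_add_eq_zero_of_isLocalMin hm hV hl hu₁ hmin
  set ε := m / l ^ 2 with hε
  have hε0 : 0 < ε := by positivity
  set c := S.angularDeriv V u₁ with hc
  have hc0 : c ≠ 0 := by
    intro h0
    rw [h0, mul_zero, add_zero] at hcrit
    exact hx hcrit
  have hev : ∀ᶠ u in 𝓝 u₁, u ∈ S.dom ∧ 0 < c * S.angularDeriv V u ∧ S.slope u ≠ 0 ∧
      0 < -S.slope u / S.angularDeriv V u ∧
      S.effectivePotential V m l u₁ ≤ S.effectivePotential V m l u := by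
    have hV1c := (hV1 u₁ hu₁).continuousAt
    have hslope : S.slope u₁ = -(ε * c) := by linarith
    have hpos : 0 < -S.slope u₁ / S.angularDeriv V u₁ := by
      rw [hslope, neg_neg, ← hc, mul_div_cancel_right₀ _ hc0]
      exact hε0
    exact Eventually.and (dom_mem_nhds hu₁)
      (((continuousAt_const.mul hV1c).eventually_const_lt (mul_self_pos.2 hc0)).and
      (((hxa u₁ hu₁).continuousAt.eventually_ne hx).and
      ((((hxa u₁ hu₁).continuousAt.neg.div hV1c hc0).eventually_const_lt hpos).and hmin)))
  obtain ⟨r, hr, hball⟩ := Metric.eventually_nhds_iff_ball.1 hev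
  -- Otherwise `slope / V_θ`, times the sign of `V_θ`, is nonincreasing near `u₁`. Its value at `u₁`
  -- is `-ε` times that sign, so `W` is nonincreasing to the right of `u₁`; being minimal at `u₁`,
  -- it is constant there, hence everywhere by analyticity. The factor `c` supplies the sign.
  by_contra! hcon
  have hsub : Icc u₁ (u₁ + r / 2) ⊆ Metric.ball u₁ r := fun v hv => by
    rw [Real.ball_eq_Ioo]; constructor <;> linarith [hv.1, hv.2]
  have hv1 : ∀ v ∈ Metric.ball u₁ r, S.angularDeriv V v ≠ 0 := fun v hv h0 => by
    have := (hball v hv).2.1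
    rw [h0, mul_zero] at this
    exact lt_irrefl _ this
  have hZd : ∀ v ∈ Metric.ball u₁ r, HasDerivAt
      (fun v => c * (S.slope v / S.angularDeriv V v + ε))
      (c * ((q - S.slope v * S.angularDeriv (S.angularDeriv V) v / S.angularDeriv V v) /
        (S.angularDeriv V v * S.f v ^ 2))) v := fun v hv => by
    have hd := (hball v hv).1
    have h0 := hv1 v hv
    have hf := (S.f_pos v hd).ne'
    refine ((((hq.hasDerivAt_slope hd).div (hasDerivAt_angularDeriv hV1 hd) h0).add_const
      ε).const_mul c).congr_deriv ?_
    field_simp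
  have hZ : AntitoneOn (fun v => c * (S.slope v / S.angularDeriv V v + ε))
      (Icc u₁ (u₁ + r / 2)) := by
    refine antitoneOn_of_hasDerivWithinAt_nonpos (convex_Icc _ _)
      (fun v hv => (hZd v (hsub hv)).continuousAt.continuousWithinAt)
      (fun v hv => (hZd v (hsub (interior_subset hv))).hasDerivWithinAt) fun v hv => ?_
    have hv' := hsub (interior_subset hv)
    obtain ⟨hd, h1, h2, h3, -⟩ := hball v hv'
    have h4 := hcon v hd h2 h3
    have h0 := hv1 v hv'
    have hf := S.f_pos v hd
    have : c * ((q - S.slope v * S.angularDeriv (S.angularDeriv V) v / S.angularDeriv V v) /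
        (S.angularDeriv V v * S.f v ^ 2)) = (c * S.angularDeriv V v) *
        (q - S.slope v * S.angularDeriv (S.angularDeriv V) v / S.angularDeriv V v) /
        (S.angularDeriv V v * S.f v) ^ 2 := by field_simp
    rw [this]
    exact div_nonpos_of_nonpos_of_nonneg (mul_nonpos_of_nonneg_of_nonpos h1.le h4) (sq_nonneg _)
  have hWanti : AntitoneOn (S.effectivePotential V m l) (Icc u₁ (u₁ + r / 2)) := by
    have hWd : ∀ v ∈ Icc u₁ (u₁ + r / 2), HasDerivAt (S.effectivePotential V m l)
        (l ^ 2 / m * ((S.slope v + ε * S.angularDeriv V v) / S.f v ^ 2)) v := fun v hv => by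
      have hd := (hball v (hsub hv)).1
      rw [← potential_deriv_eq hd hm.ne' hl.ne']
      exact hasDerivAt_effectivePotential hd hm.ne' (hV v hd).differentiableAt
    refine antitoneOn_of_hasDerivWithinAt_nonpos (convex_Icc _ _)
      (fun v hv => (hWd v hv).continuousAt.continuousWithinAt)
      (fun v hv => (hWd v (interior_subset hv)).hasDerivWithinAt) fun v hv => ?_
    have hv' := interior_subset hv
    obtain ⟨hd, h1, h2, h3, -⟩ := hball v (hsub hv')
    have h0 := hv1 v (hsub hv')
    have h4 := hZ (left_mem_Icc.2 (by linarith)) hv' hv'.1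
    simp only at h4
    have h5 : S.slope u₁ / S.angularDeriv V u₁ + ε = 0 := by
      rw [← hc]; field_simp; linarith
    rw [h5, mul_zero] at h4
    have h6 : S.slope v + ε * S.angularDeriv V v =
        (c * S.angularDeriv V v) * (c * (S.slope v / S.angularDeriv V v + ε)) / c ^ 2 := by
      field_simp
    rw [h6]
    refine mul_nonpos_of_nonneg_of_nonpos (by positivity)
      (div_nonpos_of_nonpos_of_nonneg ?_ (sq_nonneg _))
    exact div_nonpos_of_nonpos_of_nonneg (mul_nonpos_of_nonneg_of_nonpos h1.le h4) (sq_nonneg _)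
  exact not_eqOn_Icc hK hm.ne' hV hu₁ ha hne (half_pos hr) fun v hv => le_antisymm
    (hWanti (left_mem_Icc.2 (by linarith)) hv hv.1) (hball v (hsub hv)).2.2.2.2

end SurfaceOfRevolution

/-! ### Identification of the potential away from critical points of `f`. -/

namespace SurfaceOfRevolution

variable {S : SurfaceOfRevolution} {V : ℝ → ℝ} {m l : ℝ}

lemma isNormalizedPrimitive_slope {q : ℝ} (hq : S.SatisfiesProfileEquation q) (hq0 : q ≠ 0) :
    S.IsNormalizedPrimitive q fun u => S.slope u / q := fun u hu =>
  ⟨((hq.hasDerivAt_slope hu).div_const q).congr_deriv (by field_simp), by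
    simp only [slope]; field_simp⟩

lemma isGravitational_of_angularDeriv_eq {q a : ℝ} (hq : S.SatisfiesProfileEquation q)
    (hq0 : q ≠ 0) (hV : AnalyticOnNhd ℝ V S.dom) (h : ∀ u ∈ S.dom, S.angularDeriv V u = a) :
    S.IsGravitational q V := by
  refine ⟨_, isNormalizedPrimitive_slope hq hq0, a, ?_⟩
  obtain ⟨C, hC⟩ := exists_eq_of_hasDerivAt_zero (S := S)
    (F := fun u => V u - a * (S.slope u / q)) fun u hu => by
      refine ((hasDerivAt_angularDeriv hV hu).sub
        (((hq.hasDerivAt_slope hu).div_const q).const_mul a)).congr_deriv ?_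
      rw [h u hu]
      field_simp
      ring
  exact ⟨C, fun u hu => by rw [← hC u hu]; ring⟩

lemma eqOn_zero_of_eventually {F : ℝ → ℝ} (hF : AnalyticOnNhd ℝ F S.dom) {u₀ : ℝ}
    (hu₀ : u₀ ∈ S.dom) (h : ∀ᶠ u in 𝓝 u₀, F u = 0) {u : ℝ} (hu : u ∈ S.dom) : F u = 0 :=
  hF.eqOn_zero_of_preconnected_of_eventuallyEq_zero S.isPreconnected_dom hu₀ h hu

/-- The two possible relations between the constant apsidal frequency `ρ` and the constant `q` of
the surface. -/
lemma eq_or_eq_of_isochronous {K q : ℝ} (hK : S.CurvatureEq K)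
    (hq : S.SatisfiesProfileEquation q) (hm : 0 < m) (hV : AnalyticOnNhd ℝ V S.dom)
    (hclosed : S.AllBoundedOrbitsClosed V m) {u₀ : ℝ} (hu₀ : u₀ ∈ S.dom) (hx : S.slope u₀ ≠ 0)
    (hε : 0 < -S.slope u₀ / S.angularDeriv V u₀)
    (hρ : 0 < q - S.slope u₀ * S.angularDeriv (S.angularDeriv V) u₀ / S.angularDeriv V u₀) :
    ∃ ρ : ℚ, 0 < ρ ∧ (q = (ρ : ℝ) ^ 2 ∨ q = (ρ : ℝ) ^ 2 / 4) ∧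
      ∀ u ∈ S.dom, S.slope u * S.angularDeriv (S.angularDeriv V) u =
        (q - (ρ : ℝ) ^ 2) * S.angularDeriv V u := by
  have hV1 := hK.analyticOnNhd_angularDeriv hV
  have hV2 := hK.analyticOnNhd_angularDeriv hV1
  have hV3 := hK.analyticOnNhd_angularDeriv hV2
  have hxa := hK.analyticOnNhd_slope
  have hV10 : S.angularDeriv V u₀ ≠ 0 := by
    intro h0
    rw [h0, div_zero] at hε
    exact lt_irrefl _ hε
  have hc := (hxa u₀ hu₀).continuousAt
  have hc1 := (hV1 u₀ hu₀).continuousAt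
  have hc2 := (hV2 u₀ hu₀).continuousAt
  have hev : ∀ᶠ u in 𝓝 u₀, u ∈ S.dom ∧ S.slope u ≠ 0 ∧ S.angularDeriv V u ≠ 0 ∧
      0 < -S.slope u / S.angularDeriv V u ∧
      0 < q - S.slope u * S.angularDeriv (S.angularDeriv V) u / S.angularDeriv V u :=
    Eventually.and (dom_mem_nhds hu₀) ((hc.eventually_ne hx).and ((hc1.eventually_ne hV10).and
      (((hc.neg.div hc1 hV10).eventually_const_lt hε).and
        ((continuousAt_const.sub ((hc.mul hc2).div hc1 hV10)).eventually_const_lt hρ))))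
  obtain ⟨r, hr, hball⟩ := Metric.eventually_nhds_iff_ball.1 hev
  have hchart : ∀ u ∈ Metric.ball u₀ r,
      (∃ ρ : ℚ, 0 < ρ ∧ q - S.slope u * S.angularDeriv (S.angularDeriv V) u / S.angularDeriv V u =
        (ρ : ℝ) ^ 2) ∧
      5 * (-S.slope u / S.angularDeriv V u *
        S.angularDeriv (S.angularDeriv (S.angularDeriv V)) u) ^ 2 =
      3 * (q - S.slope u * S.angularDeriv (S.angularDeriv V) u / S.angularDeriv V u) *
        (-S.slope u / S.angularDeriv V u *
          S.angularDeriv (S.angularDeriv (S.angularDeriv (S.angularDeriv V))) u) := by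
    intro u hu
    obtain ⟨hd, h1, h2, h3, h4⟩ := hball u hu
    -- The angular momentum for which `u` is a circular orbit: `m / l² = -slope / V_θ`.
    set l := √(m / (-S.slope u / S.angularDeriv V u)) with hl
    have hl0 : 0 < l := Real.sqrt_pos.2 (by positivity)
    have hml : m / l ^ 2 = -S.slope u / S.angularDeriv V u := by
      rw [hl, Real.sq_sqrt (by positivity)]
      field_simp
    have e2 : q + m / l ^ 2 * S.angularDeriv (S.angularDeriv V) u =
        q - S.slope u * S.angularDeriv (S.angularDeriv V) u / S.angularDeriv V u := by
      rw [hml]; ring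
    obtain ⟨η, δ, h, hη⟩ := exists_wellChart hK hq hV hm hl0 hd
      (by rw [hml]; field_simp; ring) (by rw [e2]; exact h4)
    have r1 := h.exists_rat_sq_eq hK hq hV hm hl0 hclosed
    have r2 := h.isochronous_condition hK hq hV hm hl0 hclosed
    rw [hη, e2] at r1 r2
    rw [hml] at r2
    exact ⟨r1, r2⟩
  have hmem : u₀ ∈ Metric.ball u₀ r := Metric.mem_ball_self hr
  obtain ⟨ρ, hρ0, hρe⟩ := (hchart u₀ hmem).1
  -- The frequency is a continuous function of the circular orbit with rational values, hence
  -- constant.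
  have hconst : ∀ u ∈ Metric.ball u₀ r,
      q - S.slope u * S.angularDeriv (S.angularDeriv V) u / S.angularDeriv V u = (ρ : ℝ) ^ 2 := by
    intro u hu
    have hcont : ContinuousOn (fun u => √(q - S.slope u * S.angularDeriv (S.angularDeriv V) u /
        S.angularDeriv V u)) (Metric.ball u₀ r) := fun v hv => by
      obtain ⟨hd, -, h2, -⟩ := hball v hv
      exact (continuousAt_const.sub (((hxa v hd).continuousAt.mul
        (hV2 v hd).continuousAt).div (hV1 v hd).continuousAt h2)).sqrt.continuousWithinAt
    have := eq_of_forall_exists_rat (convex_ball u₀ r).isPreconnected hcont (fun v hv => by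
      obtain ⟨⟨ρ', hρ'0, hρ'⟩, -⟩ := hchart v hv
      exact ⟨ρ', by rw [hρ', Real.sqrt_sq (by exact_mod_cast hρ'0.le)]⟩) hu hmem
    rw [Real.sqrt_inj (hball u hu).2.2.2.2.le (hball u₀ hmem).2.2.2.2.le] at this
    rw [this, hρe]
  have R1 : ∀ u ∈ Metric.ball u₀ r, S.slope u * S.angularDeriv (S.angularDeriv V) u -
      (q - (ρ : ℝ) ^ 2) * S.angularDeriv V u = 0 := by
    intro u hu
    have h1 := hconst u hu
    have h2 := (hball u hu).2.2.1
    field_simp at h1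
    linarith
  have hnhds : ∀ u ∈ Metric.ball u₀ r, Metric.ball u₀ r ∈ 𝓝 u :=
    fun u hu => Metric.isOpen_ball.mem_nhds hu
  have R2 : ∀ u ∈ Metric.ball u₀ r, S.slope u * S.angularDeriv (S.angularDeriv (S.angularDeriv V)) u
      + (ρ : ℝ) ^ 2 * S.angularDeriv (S.angularDeriv V) u = 0 := by
    intro u hu
    have hd := (hball u hu).1
    have d1 := (((hq.hasDerivAt_slope hd).mul (hasDerivAt_angularDeriv hV2 hd)).sub
      ((hasDerivAt_angularDeriv hV1 hd).const_mul (q - (ρ : ℝ) ^ 2))).unique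
      ((hasDerivAt_const u (0 : ℝ)).congr_of_eventuallyEq (eventually_of_mem (hnhds u hu) R1))
    have hf := (S.f_pos u hd).ne'
    field_simp at d1
    linarith
  have R3 : S.slope u₀ *
      S.angularDeriv (S.angularDeriv (S.angularDeriv (S.angularDeriv V))) u₀ +
      (q + (ρ : ℝ) ^ 2) * S.angularDeriv (S.angularDeriv (S.angularDeriv V)) u₀ = 0 := by
    have d1 := (((hq.hasDerivAt_slope hu₀).mul (hasDerivAt_angularDeriv hV3 hu₀)).add
      ((hasDerivAt_angularDeriv hV2 hu₀).const_mul ((ρ : ℝ) ^ 2))).unique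
      ((hasDerivAt_const u₀ (0 : ℝ)).congr_of_eventuallyEq
        (eventually_of_mem (hnhds u₀ hmem) R2))
    have hf := (S.f_pos u₀ hu₀).ne'
    field_simp at d1
    linarith
  have hρ' : (ρ : ℝ) ≠ 0 := by exact_mod_cast hρ0.ne'
  refine ⟨ρ, hρ0, ?_, fun u hu => sub_eq_zero.1 (eqOn_zero_of_eventually
    ((hxa.mul hV2).sub (analyticOnNhd_const.mul hV1)) hu₀ (eventually_of_mem (hnhds u₀ hmem) R1)
    hu)⟩
  have e1 := R1 u₀ hmem
  have e2 := R2 u₀ hmem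
  have e4 := (hchart u₀ hmem).2
  rw [hρe] at e4
  generalize S.angularDeriv (S.angularDeriv (S.angularDeriv (S.angularDeriv V))) u₀ = v4 at *
  generalize S.angularDeriv (S.angularDeriv (S.angularDeriv V)) u₀ = v3 at *
  generalize S.angularDeriv (S.angularDeriv V) u₀ = v2 at *
  generalize S.angularDeriv V u₀ = v1 at *
  generalize S.slope u₀ = x at *
  generalize (ρ : ℝ) = b at *
  have f2 : v2 = (q - b ^ 2) * v1 / x := by field_simp; linarith
  subst f2
  have f3 : v3 = -b ^ 2 * (q - b ^ 2) * v1 / x ^ 2 := by field_simp at e2 ⊢; linarith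
  subst f3
  have f4 : v4 = (q + b ^ 2) * b ^ 2 * (q - b ^ 2) * v1 / x ^ 3 := by
    field_simp at R3 ⊢; linarith
  subst f4
  -- `R1`, `R2` and `R3` express all derivatives of `V` through `V_θ`, and the isochronous condition
  -- becomes `(q - b²) (5 (q - b²) + 3 (q + b²)) = 0`.
  have key : (b ^ 4 * v1) * ((q - b ^ 2) * (8 * (q - b ^ 2 / 4))) = 0 := by
    field_simp at e4
    linear_combination (b ^ 4 * v1) * e4
  rcases mul_eq_zero.1 ((mul_eq_zero.1 key).resolve_left (by positivity)) with h | h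
  · exact Or.inl (by linarith)
  · exact Or.inr (by linarith)

/-- The potentials that satisfy the two differential relations. -/
lemma gravitational_or_harmonic {K q : ℝ} (hK : S.CurvatureEq K)
    (hq : S.SatisfiesProfileEquation q) (hV : AnalyticOnNhd ℝ V S.dom) {u₀ : ℝ} (hu₀ : u₀ ∈ S.dom)
    (hx : S.slope u₀ ≠ 0) {ρ : ℚ} (hρ : 0 < ρ) (hqρ : q = (ρ : ℝ) ^ 2 ∨ q = (ρ : ℝ) ^ 2 / 4)
    (h : ∀ u ∈ S.dom, S.slope u * S.angularDeriv (S.angularDeriv V) u =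
        (q - (ρ : ℝ) ^ 2) * S.angularDeriv V u) :
    ∃ β : ℚ, 0 < β ∧
      ((S.SatisfiesProfileEquation ((β : ℝ) ^ 2) ∧ S.IsGravitational ((β : ℝ) ^ 2) V) ∨
        (S.SatisfiesProfileEquation ((β : ℝ) ^ 2 / 4) ∧ S.IsHarmonic ((β : ℝ) ^ 2 / 4) V)) := by
  have hρ' : (ρ : ℝ) ≠ 0 := by exact_mod_cast hρ.ne'
  have hV1 := hK.analyticOnNhd_angularDeriv hV
  have hV2 := hK.analyticOnNhd_angularDeriv hV1
  have hxev := ((hK.analyticOnNhd_slope u₀ hu₀).continuousAt.eventually_ne hx).and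
    (dom_mem_nhds hu₀ : ∀ᶠ u in 𝓝 u₀, u ∈ S.dom)
  rcases hqρ with rfl | rfl
  · refine ⟨ρ, hρ, Or.inl ⟨hq, ?_⟩⟩
    have hz : ∀ u ∈ S.dom, S.angularDeriv (S.angularDeriv V) u = 0 := fun u hu =>
      eqOn_zero_of_eventually hV2 hu₀ (hxev.mono fun v hv => by
        have := h v hv.2
        rw [sub_self, zero_mul] at this
        exact (mul_eq_zero.1 this).resolve_left hv.1) hu
    obtain ⟨a, ha⟩ := exists_eq_of_hasDerivAt_zero (S := S) (F := S.angularDeriv V) fun u hu =>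
      (hasDerivAt_angularDeriv hV1 hu).congr_deriv (by rw [hz u hu, zero_div])
    exact isGravitational_of_angularDeriv_eq hq (by positivity) hV ha
  · set q : ℝ := (ρ : ℝ) ^ 2 / 4 with hqdef
    have hq0 : q ≠ 0 := by positivity
    -- Here `q - ρ² = -3q`, so `slope V_θθ = -3q V_θ` and `slope³ V_θ` is constant. Integrating `V_θ
    -- = c / slope³` with `slope = q Θ` gives `k = -c / (2 q³)`.
    obtain ⟨c, hc⟩ := exists_eq_of_hasDerivAt_zero (S := S)
      (F := fun u => S.slope u ^ 3 * S.angularDeriv V u) fun u hu => by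
        refine (((hq.hasDerivAt_slope hu).pow 3).mul (hasDerivAt_angularDeriv hV1 hu)).congr_deriv
          ?_
        have h1 := h u hu
        have hf := (S.f_pos u hu).ne'
        simp only [Pi.pow_apply]
        push_cast
        field_simp
        have h2 : (ρ : ℝ) ^ 2 = 4 * q := by rw [hqdef]; ring
        rw [h2] at h1
        linear_combination S.slope u ^ 2 * h1
    by_cases hne : ∀ u ∈ S.dom, S.slope u ≠ 0
    · refine ⟨ρ, hρ, Or.inr ⟨hq, _, isNormalizedPrimitive_slope hq hq0,
        fun u hu => div_ne_zero (hne u hu) hq0, -c / (2 * q ^ 3), ?_⟩⟩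
      obtain ⟨C, hC⟩ := exists_eq_of_hasDerivAt_zero (S := S)
        (F := fun u => V u - -c / (2 * q ^ 3) / (S.slope u / q) ^ 2) fun u hu => by
          have hx := hne u hu
          refine ((hasDerivAt_angularDeriv hV hu).sub ((hasDerivAt_const u (-c / (2 * q ^ 3))).div
            (((hq.hasDerivAt_slope hu).div_const q).pow 2)
            (pow_ne_zero 2 (div_ne_zero hx hq0)))).congr_deriv ?_
          have hf := (S.f_pos u hu).ne'
          rw [← hc u hu]
          simp only [Pi.pow_apply]
          push_cast
          field_simp
          ring
      exact ⟨C, fun u hu => by rw [← hC u hu]; ring⟩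
    · push Not at hne
      obtain ⟨v, hv, hv0⟩ := hne
      -- A zero of `slope` forces `c = 0`, so `V` is constant. The harmonic form is unavailable
      -- because `Θ` vanishes, but `q = (ρ/2)²` makes this the gravitational case with `a = 0`.
      have hc0 : c = 0 := by rw [← hc v hv, hv0]; ring
      have hz : ∀ u ∈ S.dom, S.angularDeriv V u = 0 := fun u hu =>
        eqOn_zero_of_eventually hV1 hu₀ (hxev.mono fun v hv => by
          have := hc v hv.2
          rw [hc0] at this
          exact (mul_eq_zero.1 this).resolve_left (pow_ne_zero 3 hv.1)) hu
      have hcast : (((ρ / 2 : ℚ) : ℝ)) ^ 2 = q := by push_cast; rw [hqdef]; ring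
      refine ⟨ρ / 2, by positivity, Or.inl ?_⟩
      rw [hcast]
      exact ⟨hq, isGravitational_of_angularDeriv_eq hq hq0 hV hz⟩

end SurfaceOfRevolution

/-! ### Minima at critical points of `f`, and the proof of necessity. -/

namespace SurfaceOfRevolution

variable {S : SurfaceOfRevolution} {V : ℝ → ℝ} {m l : ℝ}

/-- A negative second derivative would make the point a local maximum too, so `W` would be locally
constant and that derivative zero. -/
lemma second_deriv_nonneg_of_isLocalMin {K q : ℝ} (hK : S.CurvatureEq K)
    (hq : S.SatisfiesProfileEquation q) (hm : 0 < m) (hV : AnalyticOnNhd ℝ V S.dom) (hl : 0 < l)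
    {u : ℝ} (hu : u ∈ S.dom) (hmin : IsLocalMin (S.effectivePotential V m l) u) :
    0 ≤ q + m / l ^ 2 * S.angularDeriv (S.angularDeriv V) u := by
  by_contra! hneg
  have hf := S.f_pos u hu
  have hdd := deriv_deriv_effectivePotential hK hq hV hm.ne' hl.ne' hu
    (slope_add_eq_zero_of_isLocalMin hm hV hl hu hmin)
  have hlt : deriv (deriv (S.effectivePotential V m l)) u < 0 := by
    rw [hdd]
    exact mul_neg_of_pos_of_neg (by positivity) (div_neg_of_neg_of_pos hneg (by positivity))
  have hmax := isLocalMax_of_deriv_deriv_neg hlt hmin.deriv_eq_zero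
    (analyticOnNhd_effectivePotential hK hm.ne' hV l u hu).continuousAt
  have hconst : S.effectivePotential V m l =ᶠ[𝓝 u] fun _ => S.effectivePotential V m l u := by
    filter_upwards [hmin, hmax] with v h1 h2 using le_antisymm h2 h1
  have h1 : deriv (S.effectivePotential V m l) =ᶠ[𝓝 u] fun _ => 0 :=
    hconst.eventuallyEq_nhds.mono fun v hv => by rw [hv.deriv_eq, deriv_const]
  rw [h1.deriv_eq, deriv_const] at hlt
  exact lt_irrefl _ hlt

/-- At a minimum at a critical point of `f`, the apsidal frequency does not depend on `V`. -/
lemma angularDeriv_two_eq_zero {K q : ℝ} (hK : S.CurvatureEq K)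
    (hq : S.SatisfiesProfileEquation q) (hm : 0 < m) (hV : AnalyticOnNhd ℝ V S.dom)
    (hclosed : S.AllBoundedOrbitsClosed V m) {u : ℝ} (hu : u ∈ S.dom) (hx : S.slope u = 0)
    (hV1 : S.angularDeriv V u = 0) (hq0 : q ≠ 0) {ε₀ : ℝ} (hε₀ : 0 < ε₀)
    (h : 0 ≤ q + ε₀ * S.angularDeriv (S.angularDeriv V) u) :
    S.angularDeriv (S.angularDeriv V) u = 0 ∧ ∃ r : ℚ, 0 < r ∧ q = (r : ℝ) ^ 2 := by
  set b := S.angularDeriv (S.angularDeriv V) u with hb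
  have hrat : ∀ ε, 0 < ε → 0 < q + ε * b → ∃ r : ℚ, 0 < r ∧ q + ε * b = (r : ℝ) ^ 2 := by
    intro ε hε hpos
    have hl0 : 0 < √(m / ε) := Real.sqrt_pos.2 (by positivity)
    have hml : m / √(m / ε) ^ 2 = ε := by
      rw [Real.sq_sqrt (by positivity)]
      field_simp
    obtain ⟨η, δ, hη, hη0⟩ := exists_wellChart hK hq hV hm hl0 hu
      (by rw [hx, hV1]; ring) (by rw [hml]; exact hpos)
    have := hη.exists_rat_sq_eq hK hq hV hm hl0 hclosed
    rwa [hη0, hml] at this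
  have hconst : ∀ ε₁ ε₂, 0 < ε₁ → 0 < ε₂ → 0 < q + ε₁ * b → 0 < q + ε₂ * b →
      ε₁ * b = ε₂ * b := by
    intro ε₁ ε₂ h1 h2 h3 h4
    -- The point is critical for every `ε = m / l²`, so `√(q + ε b)` is rational on an interval of
    -- values of `ε`, hence constant, and `b = 0`.
    have hconv : Convex ℝ {ε : ℝ | 0 < ε ∧ 0 < q + ε * b} := by
      rintro x ⟨hx1, hx2⟩ y ⟨hy1, hy2⟩ s t hs ht hst
      refine ⟨(convex_Ioi (0 : ℝ)) hx1 hy1 hs ht hst, ?_⟩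
      have : q + (s • x + t • y) * b = s * (q + x * b) + t * (q + y * b) := by
        simp only [smul_eq_mul]
        linear_combination (-q) * hst
      rw [this]
      exact (convex_Ioi (0 : ℝ)) hx2 hy2 hs ht hst
    have := eq_of_forall_exists_rat (F := fun ε => √(q + ε * b)) hconv.isPreconnected
      (by fun_prop) (fun ε hε => by
        obtain ⟨r, hr, hr'⟩ := hrat ε hε.1 hε.2
        exact ⟨r, by rw [hr', Real.sqrt_sq (by exact_mod_cast hr.le)]⟩) ⟨h1, h3⟩ ⟨h2, h4⟩
    rw [Real.sqrt_inj h3.le h4.le] at this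
    linarith
  have hb0 : b = 0 := by
    rcases lt_trichotomy b 0 with h0 | h0 | h0
    · have := hconst (ε₀ / 2) (ε₀ / 4) (by positivity) (by positivity) (by nlinarith)
        (by nlinarith)
      nlinarith
    · exact h0
    · have := hconst (ε₀ + 1) (ε₀ + 2) (by positivity) (by positivity) (by nlinarith)
        (by nlinarith)
      nlinarith
  refine ⟨hb0, ?_⟩
  rw [hb0, mul_zero, add_zero] at h
  simpa [hb0] using hrat 1 one_pos (by simpa [hb0] using h.lt_of_ne hq0.symm)

namespace IsWellChart

variable {η : ℝ → ℝ} {δ : ℝ} (h : S.IsWellChart V m l η δ) {K : ℝ} (hK : S.CurvatureEq K)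
  (hV : AnalyticOnNhd ℝ V S.dom) (hm : 0 < m) (hl : 0 < l)
  (hclosed : S.AllBoundedOrbitsClosed V m)
include h hK hV hm hl hclosed

/-- The sublevel sets of the effective potential are, as far as their `θ`-measure is concerned,
those of a harmonic oscillator. -/
lemma exists_integral_eq : ∃ r₀, 0 < r₀ ∧ ∀ r, 0 < r → r < r₀ → ∃ A₀, 0 < A₀ ∧ ∀ A, 0 < A → A < A₀ →
    ∫ u in (η 0 - r)..(η 0 + r), max (A ^ 2 / 2 - m / l ^ 2 *
      (S.effectivePotential V m l u - S.effectivePotential V m l (η 0))) 0 ^ 2 / S.f u ^ 2 =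
    S.chartDensity η 0 * ∫ y in (-A)..A, max (A ^ 2 / 2 - y ^ 2 / 2) 0 ^ 2 := by
  obtain ⟨d, hd, heven⟩ := Metric.eventually_nhds_iff.1
    (h.eventually_chartDensity_add hK hV hm hl hclosed)
  simp only [Real.dist_eq, sub_zero] at heven
  obtain ⟨B, hB0, hB⟩ := exists_between (lt_min hd h.pos)
  have hBd : B < d := hB.trans_le (min_le_left _ _)
  have hBδ : B < δ := hB.trans_le (min_le_right _ _)
  have hlt : ∀ y ∈ Icc (-B) B, |y| < δ := fun y hy => (abs_le.2 hy).trans_lt hBδ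
  have hcη : ContinuousOn η (Icc (-B) B) := fun y hy =>
    (h.analyticAt y (hlt y hy)).continuousAt.continuousWithinAt
  have hmono : StrictMonoOn η (Icc (-B) B) := strictMonoOn_of_deriv_pos (convex_Icc _ _) hcη
    fun y hy => h.deriv_pos y (hlt y (interior_subset hy))
  have m0 : (0 : ℝ) ∈ Icc (-B) B := ⟨by linarith, hB0.le⟩
  have mB : B ∈ Icc (-B) B := ⟨by linarith, le_rfl⟩
  have mB' : -B ∈ Icc (-B) B := ⟨le_rfl, by linarith⟩
  have l1 := hmono m0 mB hB0
  have l2 := hmono mB' m0 (by linarith)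
  refine ⟨min (η B - η 0) (η 0 - η (-B)), lt_min (by linarith) (by linarith), fun r hr hr0 => ?_⟩
  have hr1 := hr0.trans_le (min_le_left _ _)
  have hr2 := hr0.trans_le (min_le_right _ _)
  have hivt := intermediate_value_Icc (show -B ≤ B by linarith) hcη
  obtain ⟨y₂, hy₂, he₂⟩ := hivt (show η 0 + r ∈ _ from ⟨by linarith, by linarith⟩)
  obtain ⟨y₁, hy₁, he₁⟩ := hivt (show η 0 - r ∈ _ from ⟨by linarith, by linarith⟩)
  have hy₂0 : 0 < y₂ := (hmono.lt_iff_lt m0 hy₂).1 (by linarith)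
  have hy₁0 : y₁ < 0 := (hmono.lt_iff_lt hy₁ m0).1 (by linarith)
  -- With this bound `[-A, A]` lies inside `[y₁, y₂]`, the interval of `y` that corresponds to `[η 0
  -- - r, η 0 + r]`, and the truncated integrand vanishes on the rest.
  refine ⟨min y₂ (-y₁), lt_min hy₂0 (by linarith), fun A hA0 hA => ?_⟩
  have hA2 := hA.trans_le (min_le_left _ _)
  have hA1 := hA.trans_le (min_le_right _ _)
  have h12 : y₁ ≤ y₂ := by linarith
  have hsub : Icc y₁ y₂ ⊆ Icc (-B) B := Icc_subset_Icc hy₁.1 hy₂.2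
  have hu12 : uIcc y₁ y₂ = Icc y₁ y₂ := uIcc_of_le h12
  have hW := analyticOnNhd_effectivePotential hK hm.ne' hV l
  set g : ℝ → ℝ := fun u => max (A ^ 2 / 2 - m / l ^ 2 *
      (S.effectivePotential V m l u - S.effectivePotential V m l (η 0))) 0 ^ 2 / S.f u ^ 2 with hg
  have hgc : ContinuousOn g S.dom := by
    refine ContinuousOn.div (((continuousOn_const.sub (continuousOn_const.mul
      (hW.continuousOn.sub continuousOn_const))).sup continuousOn_const).pow 2)
      (hK.analyticOnNhd_f.continuousOn.pow 2) fun u hu => pow_ne_zero 2 (S.f_pos u hu).ne'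
  set κ : ℝ → ℝ := fun y => max (A ^ 2 / 2 - y ^ 2 / 2) 0 ^ 2 with hκ
  have hκc : Continuous κ := by fun_prop
  have hHc : ContinuousOn (S.chartDensity η) (Icc (-B) B) := fun y hy =>
    (h.continuousAt_chartDensity (hlt y hy)).continuousWithinAt
  have hsubst : ∫ u in (η 0 - r)..(η 0 + r), g u = ∫ y in y₁..y₂, κ y * S.chartDensity η y := by
    rw [← he₁, ← he₂, ← intervalIntegral.integral_comp_mul_deriv'' (f := η) (f' := deriv η) (g := g)
      (by rw [hu12]; exact hcη.mono hsub)
      (fun y hy => by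
        rw [min_eq_left h12, max_eq_right h12] at hy
        exact (h.analyticAt y (hlt y (hsub (Ioo_subset_Icc_self hy)))).differentiableAt.hasDerivAt
          |>.hasDerivWithinAt)
      (by
        rw [hu12]
        exact fun y hy => (h.analyticAt y (hlt y (hsub hy))).deriv.continuousAt.continuousWithinAt)
      (by
        rw [hu12]
        refine hgc.mono ?_
        rintro _ ⟨y, hy, rfl⟩
        exact h.mem_dom y (hlt y (hsub hy)))]
    refine intervalIntegral.integral_congr fun y hy => ?_
    rw [hu12] at hy
    have e1 := h.potential_eq y (hlt y (hsub hy))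
    simp only [Function.comp_apply, hg, hκ, chartDensity]
    rw [e1, add_sub_cancel_left]
    have : m / l ^ 2 * (l ^ 2 / (2 * m) * y ^ 2) = y ^ 2 / 2 := by field_simp
    rw [this]
    ring
  have hint : ∀ a b, a ∈ Icc (-B) B → b ∈ Icc (-B) B → IntervalIntegrable
      (fun y => κ y * S.chartDensity η y) MeasureTheory.volume a b := fun a b ha hb =>
    ((hκc.continuousOn.mul hHc).mono (OrdConnected.uIcc_subset ordConnected_Icc ha hb)
      ).intervalIntegrable
  have mA : A ∈ Icc (-B) B := ⟨by linarith, by linarith [hy₂.2]⟩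
  have mA' : -A ∈ Icc (-B) B := ⟨by linarith [hy₁.1], by linarith⟩
  have hκ0 : ∀ y, A ^ 2 ≤ y ^ 2 → κ y = 0 := fun y hy => by
    simp only [hκ, max_eq_right (show A ^ 2 / 2 - y ^ 2 / 2 ≤ 0 by linarith)]
    norm_num
  have hz1 : ∫ y in y₁..(-A), κ y * S.chartDensity η y = 0 := by
    rw [intervalIntegral.integral_congr (g := fun _ => 0) fun y hy => ?_]
    · simp
    · rw [uIcc_of_le (by linarith)] at hy
      simp only [hκ0 y (by nlinarith [hy.2]), zero_mul]
  have hz2 : ∫ y in A..y₂, κ y * S.chartDensity η y = 0 := by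
    rw [intervalIntegral.integral_congr (g := fun _ => 0) fun y hy => ?_]
    · simp
    · rw [uIcc_of_le (by linarith)] at hy
      simp only [hκ0 y (by nlinarith [hy.1]), zero_mul]
  have hsplit : ∫ y in y₁..y₂, κ y * S.chartDensity η y =
      ∫ y in (-A)..A, κ y * S.chartDensity η y := by
    rw [← intervalIntegral.integral_add_adjacent_intervals (hint y₁ (-A) hy₁ mA')
      (hint (-A) y₂ mA' hy₂), ← intervalIntegral.integral_add_adjacent_intervals
      (hint (-A) A mA' mA) (hint A y₂ mA hy₂), hz1, hz2]
    ring
  -- The weight `κ` is even, so the density may be replaced by its even part, the constant `H(0)`.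
  have hrefl : ∫ y in (-A)..A, κ y * S.chartDensity η (-y) =
      ∫ y in (-A)..A, κ y * S.chartDensity η y := by
    have := intervalIntegral.integral_comp_neg (a := -A) (b := A)
      (fun y => κ y * S.chartDensity η y)
    simpa [hκ] using this
  have hint' : IntervalIntegrable (fun y => κ y * S.chartDensity η (-y))
      MeasureTheory.volume (-A) A := by
    refine ((hκc.continuousOn.mul (hHc.comp continuous_neg.continuousOn fun y hy => ?_)).mono
      (OrdConnected.uIcc_subset ordConnected_Icc mA' mA)).intervalIntegrable
    exact ⟨by linarith [hy.2], by linarith [hy.1]⟩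
  have hsum : ∫ y in (-A)..A, (κ y * S.chartDensity η y + κ y * S.chartDensity η (-y)) =
      2 * S.chartDensity η 0 * ∫ y in (-A)..A, κ y := by
    rw [← intervalIntegral.integral_const_mul]
    refine intervalIntegral.integral_congr fun y hy => ?_
    rw [uIcc_of_le (by linarith)] at hy
    have := heven (y := y) ((abs_le.2 hy).trans_lt (by linarith [mA.2]))
    rw [← mul_add, this]
    ring
  rw [intervalIntegral.integral_add (hint _ _ mA' mA) hint', hrefl] at hsum
  rw [hsubst, hsplit]
  linarith

end IsWellChart

end SurfaceOfRevolution

/-- Midpoint convexity of the squared positive part, used to compare three angular momenta. -/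
lemma sq_max_add_div_two_le (x z : ℝ) :
    max ((x + z) / 2) 0 ^ 2 ≤ (max x 0 ^ 2 + max z 0 ^ 2) / 2 := by
  have h1 : max ((x + z) / 2) 0 ≤ (max x 0 + max z 0) / 2 := by
    refine max_le ?_ (by positivity)
    linarith [le_max_left x 0, le_max_left z 0]
  have h2 : 0 ≤ max ((x + z) / 2) 0 := le_max_right _ _
  nlinarith [sq_nonneg (max x 0 - max z 0)]

namespace SurfaceOfRevolution

variable {S : SurfaceOfRevolution} {V : ℝ → ℝ} {m l : ℝ}

lemma mul_effectivePotential_sub (hm : m ≠ 0) (hl : l ≠ 0) {u v : ℝ} (hu : u ∈ S.dom)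
    (hv : v ∈ S.dom) :
    m / l ^ 2 * (S.effectivePotential V m l u - S.effectivePotential V m l v) =
      (1 / (2 * S.f u ^ 2) - 1 / (2 * S.f v ^ 2)) + m / l ^ 2 * (V u - V v) := by
  have h1 := (S.f_pos u hu).ne'
  have h2 := (S.f_pos v hv).ne'
  simp only [effectivePotential]
  field_simp
  ring

/-- If the minimum at a critical point of `f` is isochronous for all angular momenta, the potential
is constant near that point. -/
lemma eventually_eq_of_isochronous {K q : ℝ} (hK : S.CurvatureEq K)
    (hq : S.SatisfiesProfileEquation q) (hm : 0 < m) (hV : AnalyticOnNhd ℝ V S.dom)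
    (hclosed : S.AllBoundedOrbitsClosed V m) {u₀ : ℝ} (hu₀ : u₀ ∈ S.dom) (hx : S.slope u₀ = 0)
    (hV1 : S.angularDeriv V u₀ = 0) (hV2 : S.angularDeriv (S.angularDeriv V) u₀ = 0)
    (hq0 : 0 < q) : ∀ᶠ u in 𝓝 u₀, V u = V u₀ := by
  -- `P ε` is the effective potential for `m / l² = ε`, multiplied by `ε` and normalized to vanish
  -- at `u₀`. It is affine in `ε`.
  set P : ℝ → ℝ → ℝ := fun ε u =>
    (1 / (2 * S.f u ^ 2) - 1 / (2 * S.f u₀ ^ 2)) + ε * (V u - V u₀) with hP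
  have hPc : ∀ ε, ContinuousOn (P ε) S.dom := fun ε => by
    have h1 := hK.analyticOnNhd_f.continuousOn
    have h2 := hV.continuousOn
    refine ContinuousOn.add (ContinuousOn.sub (continuousOn_const.div
      (continuousOn_const.mul (h1.pow 2)) fun u hu => ?_) continuousOn_const)
      (continuousOn_const.mul (h2.sub continuousOn_const))
    have := S.f_pos u hu
    positivity
  have hmain : ∀ ε, 0 < ε → ∃ r₀, 0 < r₀ ∧ ∀ r, 0 < r → r < r₀ → ∃ A₀, 0 < A₀ ∧
      ∀ A, 0 < A → A < A₀ →
      ∫ u in (u₀ - r)..(u₀ + r), max (A ^ 2 / 2 - P ε u) 0 ^ 2 / S.f u ^ 2 =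
        √(1 / q) * ∫ y in (-A)..A, max (A ^ 2 / 2 - y ^ 2 / 2) 0 ^ 2 := by
    intro ε hε
    have hl0 : 0 < √(m / ε) := Real.sqrt_pos.2 (by positivity)
    have hml : m / √(m / ε) ^ 2 = ε := by
      rw [Real.sq_sqrt (by positivity)]
      field_simp
    obtain ⟨η, δ, h, hη⟩ := exists_wellChart hK hq hV hm hl0 hu₀
      (by rw [hx, hV1]; ring) (by rw [hV2]; simpa using hq0)
    have hH := h.second_order_mul_sq hK hq hV hm hl0
    rw [hη, hV2, mul_zero, add_zero] at hH
    have hH0 := h.chartDensity_pos (y := 0) (by simpa using h.pos)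
    -- As `V_θθ` vanishes at `u₀`, the central density is the same for all `ε`, so the integrals on
    -- the left of `hmain` do not depend on `ε`.
    have hHq : S.chartDensity η 0 = √(1 / q) := by
      rw [← Real.sqrt_sq hH0.le]
      congr 1
      field_simp
      linarith
    obtain ⟨r₀, hr₀, hr⟩ := h.exists_integral_eq hK hV hm hl0 hclosed
    obtain ⟨r₁, hr₁, hball⟩ := Metric.mem_nhds_iff.1 (dom_mem_nhds hu₀)
    refine ⟨min r₀ r₁, lt_min hr₀ hr₁, fun r hr0 hrlt => ?_⟩
    obtain ⟨A₀, hA₀, hA⟩ := hr r hr0 (hrlt.trans_le (min_le_left _ _))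
    refine ⟨A₀, hA₀, fun A hA0 hAlt => ?_⟩
    have := hA A hA0 hAlt
    rw [hη, hHq] at this
    rw [← this]
    refine intervalIntegral.integral_congr fun u hu => ?_
    rw [uIcc_of_le (by linarith)] at hu
    have hud : u ∈ S.dom := hball (by
      rw [Real.ball_eq_Ioo]
      have := hrlt.trans_le (min_le_right _ _)
      constructor <;> linarith [hu.1, hu.2])
    simp only [hP]
    rw [mul_effectivePotential_sub hm.ne' hl0.ne' hud hu₀, hml]
  obtain ⟨r₁, hr₁, h1⟩ := hmain 1 (by norm_num)
  obtain ⟨r₂, hr₂, h2⟩ := hmain 2 (by norm_num)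
  obtain ⟨r₃, hr₃, h3⟩ := hmain 3 (by norm_num)
  obtain ⟨r₄, hr₄, hball⟩ := Metric.mem_nhds_iff.1 (dom_mem_nhds hu₀)
  obtain ⟨r, hr, hrlt⟩ := exists_between (lt_min hr₁ (lt_min hr₂ (lt_min hr₃ hr₄)))
  simp only [lt_min_iff] at hrlt
  obtain ⟨A₁, hA₁, h1⟩ := h1 r hr hrlt.1
  obtain ⟨A₂, hA₂, h2⟩ := h2 r hr hrlt.2.1
  obtain ⟨A₃, hA₃, h3⟩ := h3 r hr hrlt.2.2.1
  obtain ⟨A, hA, hAlt⟩ := exists_between (lt_min hA₁ (lt_min hA₂ hA₃))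
  simp only [lt_min_iff] at hAlt
  have h1 := h1 A hA hAlt.1
  have h2 := h2 A hA hAlt.2.1
  have h3 := h3 A hA hAlt.2.2
  have hJ : Icc (u₀ - r) (u₀ + r) ⊆ S.dom := fun u hu => hball (by
    rw [Real.ball_eq_Ioo]; constructor <;> linarith [hu.1, hu.2])
  set k : ℝ → ℝ → ℝ := fun ε u => max (A ^ 2 / 2 - P ε u) 0 ^ 2 / S.f u ^ 2 with hk
  have hkc : ∀ ε, ContinuousOn (k ε) (Icc (u₀ - r) (u₀ + r)) := fun ε =>
    ((((continuousOn_const.sub (hPc ε)).sup continuousOn_const).pow 2).div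
      (hK.analyticOnNhd_f.continuousOn.pow 2)
      fun u hu => pow_ne_zero 2 (S.f_pos u hu).ne').mono hJ
  have hle : u₀ - r ≤ u₀ + r := by linarith
  have hki : ∀ ε, IntervalIntegrable (k ε) MeasureTheory.volume (u₀ - r) (u₀ + r) := fun ε =>
    (hkc ε).intervalIntegrable_of_Icc hle
  have hmid : ∀ u, A ^ 2 / 2 - P 2 u =
      ((A ^ 2 / 2 - P 1 u) + (A ^ 2 / 2 - P 3 u)) / 2 := fun u => by
    simp only [hP]; ring
  -- `P 2` is the mean of `P 1` and `P 3`, so convexity gives a nonnegative gap. Its integral is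
  -- zero because the three integrals agree, so the gap vanishes pointwise.
  have hgap : ∀ u ∈ Icc (u₀ - r) (u₀ + r), 0 ≤ (k 1 u + k 3 u) / 2 - k 2 u := fun u hu => by
    have h4 := sq_max_add_div_two_le (A ^ 2 / 2 - P 1 u) (A ^ 2 / 2 - P 3 u)
    rw [← hmid] at h4
    have hf := S.f_pos u (hJ hu)
    have : (k 1 u + k 3 u) / 2 - k 2 u = ((max (A ^ 2 / 2 - P 1 u) 0 ^ 2 +
        max (A ^ 2 / 2 - P 3 u) 0 ^ 2) / 2 - max (A ^ 2 / 2 - P 2 u) 0 ^ 2) / S.f u ^ 2 := by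
      simp only [hk]; ring
    rw [this]
    exact div_nonneg (by linarith) (by positivity)
  have hzero : ∫ u in (u₀ - r)..(u₀ + r), ((k 1 u + k 3 u) / 2 - k 2 u) = 0 := by
    rw [intervalIntegral.integral_sub (((hki 1).add (hki 3)).div_const 2) (hki 2),
      intervalIntegral.integral_div, intervalIntegral.integral_add (hki 1) (hki 3), h1, h2, h3]
    ring
  have hall : ∀ u ∈ Icc (u₀ - r) (u₀ + r), (k 1 u + k 3 u) / 2 - k 2 u = 0 := by
    intro u hu
    by_contra hne
    have := intervalIntegral.integral_pos (show u₀ - r < u₀ + r by linarith)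
      ((((hkc 1).add (hkc 3)).div_const 2).sub (hkc 2))
      (fun v hv => hgap v (Ioc_subset_Icc_self hv)) ⟨u, hu, (hgap u hu).lt_of_ne (Ne.symm hne)⟩
    exact absurd hzero this.ne'
  have hpos : ∀ ε, ∀ᶠ u in 𝓝 u₀, 0 < A ^ 2 / 2 - P ε u := fun ε => by
    have h0 : 0 < A ^ 2 / 2 - P ε u₀ := by
      simp only [hP, sub_self, mul_zero, add_zero, sub_zero]
      positivity
    exact (continuousAt_const.sub ((hPc ε).continuousAt (dom_mem_nhds hu₀))).eventually_const_lt h0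
  filter_upwards [hpos 1, hpos 2, hpos 3, Icc_mem_nhds (show u₀ - r < u₀ by linarith)
    (show u₀ < u₀ + r by linarith)] with u e1 e2 e3 hu
  have h4 := hall u hu
  have hf := (S.f_pos u (hJ hu)).ne'
  simp only [hk] at h4
  rw [max_eq_left e1.le, max_eq_left e2.le, max_eq_left e3.le] at h4
  field_simp at h4
  -- Where the positive parts are not cut off, the numerator of the gap is `(P 1 - P 3)² / 4`, and
  -- `P 3 - P 1 = 2 (V - V(u₀))`.
  have h5 : (P 1 u - P 3 u) ^ 2 = 0 := by
    have := hmid u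
    have h6 : P 2 u = (P 1 u + P 3 u) / 2 := by linarith
    rw [h6] at h4
    nlinarith
  have h6 := pow_eq_zero_iff (two_ne_zero) |>.1 h5
  simp only [hP] at h6
  linarith

/-- On a cylinder there is a bounded orbit that is not closed as soon as there is a bounded
non-circular one. -/
lemma circular_of_closed_of_deriv_f_eq_zero {K : ℝ} (hK : S.CurvatureEq K) (hm : 0 < m)
    (hclosed : S.AllBoundedOrbitsClosed V m) (hf : ∀ u ∈ S.dom, deriv S.f u = 0)
    (o : S.NonsingularOrbit V m) (ho : o.Bounded) : o.Circular := by
  obtain ⟨T, hT, hper⟩ := (hclosed o ho).exists_period hK hm.ne'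
  obtain ⟨F, hF⟩ := exists_eq_of_hasDerivAt_zero (S := S) (F := S.f) fun u hu => by
    rw [← hf u hu]; exact hasDerivAt_f hu
  have hF0 : F ≠ 0 := by
    obtain ⟨u, hu⟩ := S.nonempty_dom
    rw [← hF u hu]; exact (S.f_pos u hu).ne'
  -- On a cylinder the motions of `u` and `φ` decouple, so the angular velocity can be chosen
  -- freely. With this one `φ` advances by `2π√2` in a period `T` of `u`, and a common period `T'`
  -- of the new orbit is incommensurable with `T`.
  set c : ℝ := 2 * Real.pi * √2 / T with hc
  let o' : S.NonsingularOrbit V m :=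
    { u := o.u
      φ := fun t => c * t
      pu := o.pu
      pφ := fun _ => c * (m * F ^ 2)
      mem_dom := o.mem_dom
      eq_u := o.eq_u
      eq_φ := fun t ht => by
        rw [hF _ (o.mem_dom t ht), mul_div_assoc, div_self (by positivity)]
        exact (hasDerivWithinAt_id t _).const_mul c
      eq_pu := fun t ht => by
        have := o.eq_pu t ht
        rw [hf _ (o.mem_dom t ht), mul_zero, zero_div] at this ⊢
        exact this
      eq_pφ := fun t _ => hasDerivWithinAt_const t _ _ }
  have ho' : o'.Bounded := by
    obtain ⟨R, hR⟩ := ho.exists_norm_le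
    obtain ⟨M, hM0, hM⟩ := o.exists_f_le ho
    refine isBounded_iff_forall_norm_le.2 ⟨max M R, ?_⟩
    rintro _ ⟨t, ht, rfl⟩
    have hM' := hM t ht
    have hg : ‖S.g (o.u t)‖ ≤ R := (norm_le_pi_norm (o.position t) 2).trans (hR _ ⟨t, ht, rfl⟩)
    have hfn : ‖S.f (o.u t)‖ ≤ M := by
      rwa [Real.norm_of_nonneg (S.f_pos _ (o.mem_dom t ht)).le]
    refine (pi_norm_le_iff_of_nonneg (hM0.le.trans (le_max_left _ _))).2 fun i => ?_
    fin_cases i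
    · change ‖S.f (o.u t) * Real.cos (c * t)‖ ≤ _
      rw [norm_mul]
      exact (mul_le_of_le_one_right (norm_nonneg _) (Real.abs_cos_le_one _)).trans
        (hfn.trans (le_max_left _ _))
    · change ‖S.f (o.u t) * Real.sin (c * t)‖ ≤ _
      rw [norm_mul]
      exact (mul_le_of_le_one_right (norm_nonneg _) (Real.abs_sin_le_one _)).trans
        (hfn.trans (le_max_left _ _))
    · exact hg.trans (le_max_right _ _)
  obtain ⟨T', hT', hper'⟩ := (hclosed o' ho').exists_period hK hm.ne'
  obtain ⟨j, hj⟩ := (hper' 0 le_rfl).2.2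
  have hj' : c * (0 + T') - c * 0 = 2 * Real.pi * j := hj
  have hjT : T' * √2 = j * T := by
    rw [hc] at hj'
    have := Real.pi_pos
    field_simp at hj'
    simpa [mul_comm] using hj'
  have hirr : Irrational (T / T') := by
    have hj0 : j ≠ 0 := by
      rintro rfl
      have : 0 < T' * √2 := by positivity
      rw [hjT] at this
      simp at this
    have : T / T' = √2 / j := by
      have : (j : ℝ) ≠ 0 := by exact_mod_cast hj0
      field_simp
      linarith
    rw [this]
    exact irrational_sqrt_two.div_intCast hj0
  have hdense := dense_addSubgroupClosure_pair_iff.2 hirr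
  have hnat : ∀ n n' : ℕ, ∀ t, 0 ≤ t → o.u (t + n * T + n' * T') = o.u t := by
    intro n n'
    induction n' with
    | zero =>
      induction n with
      | zero => simp
      | succ n ih =>
        intro t ht
        rw [← ih t ht, ← (hper (t + n * T + (0 : ℕ) * T') (by positivity)).1]
        congr 1
        push_cast
        ring
    | succ n' ih =>
      intro t ht
      rw [← ih t ht, ← (hper' (t + n * T + n' * T') (by positivity)).1]
      change o.u _ = o.u _
      congr 1
      push_cast
      ring
  intro t ht
  rcases ht.eq_or_lt with rfl | ht
  · rfl
  by_contra hne
  have hev : ∀ᶠ s in 𝓝 t, o.u s ≠ o.u 0 ∧ 0 < s :=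
    (((o.continuousOn_u t ht.le).continuousAt (Ici_mem_nhds ht)).eventually_ne hne).and
      (eventually_gt_nhds ht)
  obtain ⟨s, hs, hs1, hs0⟩ := hdense.inter_nhds_nonempty hev
  obtain ⟨a, b, hab⟩ := AddSubgroup.mem_closure_pair.1 hs
  simp only [zsmul_eq_mul] at hab
  apply hs1
  -- The time `s = aT + bT'` may have negative coefficients; adding `(|a| - a)T + (|b| - b)T'` leads
  -- to `|a|T + |b|T'`, which is also reached from time `0`.
  have e1 := hnat (a.natAbs - a).toNat (b.natAbs - b).toNat s hs0.le
  have e2 := hnat a.natAbs b.natAbs 0 le_rfl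
  have c1 : (((a.natAbs - a).toNat : ℤ) : ℝ) = ((a.natAbs : ℤ) : ℝ) - a := by
    rw [Int.toNat_of_nonneg (by omega)]; push_cast; ring
  have c2 : (((b.natAbs - b).toNat : ℤ) : ℝ) = ((b.natAbs : ℤ) : ℝ) - b := by
    rw [Int.toNat_of_nonneg (by omega)]; push_cast; ring
  rw [Int.cast_natCast, Int.cast_natCast] at c1 c2
  rw [← e1, ← e2, c1, c2, ← hab]
  congr 1
  ring

theorem exists_rat_of_allBoundedOrbitsClosed (hS : S.HasConstantCurvature)
    (hV : AnalyticOnNhd ℝ V S.dom) (hm : 0 < m)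
    (horbit : ∃ o : S.NonsingularOrbit V m, o.Bounded ∧ ¬ o.Circular)
    (hclosed : S.AllBoundedOrbitsClosed V m) :
    ∃ β : ℚ, 0 < β ∧
      ((S.SatisfiesProfileEquation ((β : ℝ) ^ 2) ∧ S.IsGravitational ((β : ℝ) ^ 2) V) ∨
        (S.SatisfiesProfileEquation ((β : ℝ) ^ 2 / 4) ∧ S.IsHarmonic ((β : ℝ) ^ 2 / 4) V)) := by
  obtain ⟨K, hK⟩ := hS.exists_deriv_deriv
  replace hK : S.CurvatureEq K := hK
  obtain ⟨q, hq⟩ := hK.exists_const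
  rw [← hK.satisfiesProfileEquation_iff] at hq
  obtain ⟨o, ho, hc⟩ := horbit
  obtain ⟨l, hl, u, hu, hmin, a, ha, hne⟩ := exists_isLocalMin (hclosed o ho) hc hK hm hV
  by_cases hx : S.slope u = 0
  · have hcrit := slope_add_eq_zero_of_isLocalMin hm hV hl hu hmin
    have hε : 0 < m / l ^ 2 := by positivity
    have hV1 : S.angularDeriv V u = 0 := by
      rw [hx, zero_add] at hcrit
      exact (mul_eq_zero.1 hcrit).resolve_left hε.ne'
    -- If `q = 0`, then `slope` is constant, hence zero, and the surface is a cylinder, where every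
    -- bounded orbit would be circular.
    have hq0 : q ≠ 0 := by
      rintro rfl
      refine hc (circular_of_closed_of_deriv_f_eq_zero hK hm hclosed (fun v hv => ?_) o ho)
      have h1 := eq_of_hasDerivAt_zero (S := S) (F := S.slope)
        (fun w hw => (hq.hasDerivAt_slope hw).congr_deriv (zero_div _)) hv hu
      rw [hx, slope, div_eq_zero_iff, neg_eq_zero] at h1
      exact h1.resolve_right (S.f_pos v hv).ne'
    obtain ⟨hV2, r, hr, rfl⟩ := angularDeriv_two_eq_zero hK hq hm hV hclosed hu hx hV1 hq0 hε
      (second_deriv_nonneg_of_isLocalMin hK hq hm hV hl hu hmin)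
    have hev := eventually_eq_of_isochronous hK hq hm hV hclosed hu hx hV1 hV2
      (by have : (0 : ℝ) < r := by exact_mod_cast hr
          positivity)
    refine ⟨r, hr, Or.inl ⟨hq,
      isGravitational_of_angularDeriv_eq (a := 0) hq hq0 hV fun v hv => ?_⟩⟩
    refine eqOn_zero_of_eventually (hK.analyticOnNhd_angularDeriv hV) hu ?_ hv
    filter_upwards [hev.eventually_nhds] with w hw
    rw [angularDeriv, EventuallyEq.deriv_eq hw, deriv_const, mul_zero]
  · obtain ⟨v, hv, hxv, h1, h2⟩ := exists_nondegenerate hK hq hm hV hl hu hmin ha hne hx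
    obtain ⟨ρ, hρ, hqρ, h3⟩ := eq_or_eq_of_isochronous hK hq hm hV hclosed hv hxv h1 h2
    exact gravitational_or_harmonic hK hq hV hv hxv hρ hqρ h3

end SurfaceOfRevolution

theorem mainTheorem1 (S : SurfaceOfRevolution) (hS : S.HasConstantCurvature)
    (V : ℝ → ℝ) (hV : S.IsCentralPotential V) (m : ℝ) (hm : 0 < m)
    (horbit : ∃ o : S.NonsingularOrbit V m, o.Bounded ∧ ¬ o.Circular)
    (hmin : ∃ l : ℝ, ∃ u₀ ∈ S.dom, IsLocalMin (S.effectivePotential V m l) u₀) :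
    S.AllBoundedOrbitsClosed V m ↔
      ∃ β : ℚ, 0 < β ∧
        ((S.SatisfiesProfileEquation ((β : ℝ) ^ 2) ∧
            S.IsGravitational ((β : ℝ) ^ 2) V) ∨
          (S.SatisfiesProfileEquation ((β : ℝ) ^ 2 / 4) ∧
            S.IsHarmonic ((β : ℝ) ^ 2 / 4) V)) := by
  refine ⟨S.exists_rat_of_allBoundedOrbitsClosed hS hV.1 hm horbit, ?_⟩
  rintro ⟨β, hβ, ⟨hq, hgrav⟩ | ⟨hq, hharm⟩⟩
  · exact S.allBoundedOrbitsClosed_of_gravitational hS hm hβ hq hgrav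
  · exact S.allBoundedOrbitsClosed_of_harmonic hS hm hmin hβ hq hharm
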